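/- **Conventions.** $(s,t)$-distribution: $\underline z=\underline x\sqcup\underline y$, where $\underline x$ consists of $s$ pairs $x_i=(x'_{2i-1},x'_{2i})$ of reals, $x'_1<\dots<x'_{2s}$, and $\underline y$ of $t$ reals $y_1<\dots<y_t$ with $[x'_{2i-1},x'_{2i}]\cap\underline y=\emptyset$ for all $i$. It is *trivial* if every point of the pairs is smaller than every $y_j$. *Tropical covers.* A tropical curve $C$ is a connected metric graph with $1$-valent vertices (leaves) and $3$-valent (inner) vertices, at least one of them inner; edges at leaves (ends) have infinite length, the other (inner) edges finite length; the genus is $b_1(C)$. A tropical cover $\varphi:C\to\mathbb R\cup\{\pm\infty\}$ of type $(g,\lambda,\mu,\underline z)$ is a continuous map from a curve of genus $g$, affine on each edge $e$ with integer slope (weight) $\omega(e)>0$, balanced at each inner vertex, mapping leaves to $\pm\infty$, such that the image of the set of inner vertices is the set of all the points $x'_j$ and $y_j$, and $\lambda$ (resp. $\mu$) is the multiset of weights of the ends going to $-\infty$ (resp. $+\infty$). Edges are oriented so that $\varphi$ increases. Two covers are isomorphic if there is an isomorphism of the curves that commutes with the maps; covers are counted up to isomorphism. Edges are called even or odd according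 to their weights. A symmetric cycle (resp. fork) is a pair of inner edges (resp. ends) of equal weight at the same two inner vertices (resp. the same inner vertex). *Resolving covers.* A cover is resolving if over each pair $x_i$ there lie two vertices $u,v$, with $\varphi(u)=x'_{2i-1}$, $\varphi(v)=x'_{2i}$, joined by an edge $u\to v$ in one of these ways: (a) $u$ has two incoming edges, which form a symmetric fork or cycle, and the outgoing edge $f$ of $u$ and another edge enter $v$, which one edge leaves; (b) $u$ has one incoming edge, and two outgoing edges of which exactly one, $f$, enters $v$; no other edge enters $v$, and the two edges leaving $v$ form a symmetric fork or cycle; (c) one edge $a$ enters $u$, two edges $c,f$ leave $u$, the edge $f$ and an edge $b\ne c$ enter $v$, and one edge $d$ leaves $v$; (d) one edge enters $u$, two edges, not both odd, lead from $u$ to $v$, and one edge leaves $v$. The edges joining such $u$ and $v$ are called contractible. $\mathrm{Sym}_3(\varphi)$ (resp. $\mathrm{Sym}_2(\varphi)$) is the set of symmetric cycles and forks that contain no contractible edge and have (resp. do not have) a vertex in common with a contractible edge. *Generalized zigzag covers.* A resolving cover is a generalized zigzag cover if there is a non-empty connected subgraph $S\subset C$ that contains no edge of an element of $\mathrm{Sym}_2(\varphi)$,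 such that: $S$ contains all contractible edges and at least one inner vertex; every even edge of $S$ is contractible; each connected component of $C\setminus S$ is a tail. A tail consists, starting from $S$, of an even edge, any number of symmetric cycles of odd weight with an even edge after each of them, and then either the leaf of the last even edge, or a symmetric fork at the last vertex. $\mathcal Z_g(\lambda,\mu;\underline z)$ is the set of isomorphism classes of generalized zigzag covers of type $(g,\lambda,\mu,\underline z)$. *Multiplicities.* A colouring $\rho$ of a cover is a set $I_\rho$ of symmetric cycles and forks, together with a colour, red or blue, for each component of the graph of even edges outside $I_\rho$. Let $r$ be the edge alone on its side (incoming or outgoing) of an inner vertex, and $a,b$ the two other edges there. The vertex is positive if either $r$ is odd and the even one of $a,b$ is blue; or $r,a,b$ are even, $\{a,b\}\notin I_\rho$, and they are blue; or $r$ is even and red, $a,b$ are odd, and $\{a,b\}\notin I_\rho$; or $r$ is blue and $\{a,b\}\in I_\rho$. It is negative if this holds with red and blue exchanged. The colouring is effective if the two vertices over each pair $x_i$ have the same sign, $\mathrm{Sym}_3(\varphi)\subset I_\rho$, and $I_\rho$ contains no symmetric cycle with a contractible edge. Its multiplicity is $$\mathrm{mult}(\varphi,\rho)=2^{A+B+D-|\mathrm{Sym}_2(\varphi)|}\prod\omega(p),$$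 where the product is over the symmetric cycles $p\in I_\rho$, $\omega(p)$ is the weight of either edge of $p$, $A$ is the number of non-contractible even inner edges outside $I_\rho$, $B$ the number of symmetric cycles in $\mathrm{Sym}_3(\varphi)$, and $D$ the number of pairs of even contractible edges of different weights with the same endpoints. The generalized zigzag number is $Z_g(\lambda,\mu;\underline z)=\sum_{[\varphi]\in\mathcal Z_g(\lambda,\mu;\underline z)}2^{m(\varphi)}$, where $m(\varphi)=0$ if $\mathrm{mult}(\varphi,\rho)$ is an odd integer for an effective colouring $\rho$, and $m(\varphi)=1$ otherwise. For $\Lambda_{s,0}$ (resp. $\Lambda_{0,t}$) in place of $\underline z$, any $(s,0)$- (resp. $(0,t)$-) distribution is meant. *Proper zigzag numbers.* Let $\underline z$ be trivial. A generalized zigzag cover of type $(g,\lambda,\mu,\underline z)$ is properly mixed if, for some $S$ as above, $S$ contains an odd inner edge $E_c$, oriented from $v_1$ to $v_2$, such that: removing the interior of $E_c$ leaves two components, the inner vertices of one lying over the points of $\underline x$ and those of the other over $\underline y$; there is a vertex $v_1'$ such that $(v_1',v_1)$ lies over the pair $x_1$ and is as in (c), where $c,d$ are odd, $d=E_c$,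 $f$ is even, and $a,b$ are ends of the same odd weight; $v_2$ lies over the largest point $y_t$ and has two odd incoming edges. $Z_g(\lambda,\mu;s,t)$ is the number of isomorphism classes of properly mixed generalized zigzag covers of type $(g,\lambda,\mu,\underline z)$, for any trivial $(s,t)$-distribution $\underline z$. *Partitions.* $l(\lambda)$ is the number of entries of $\lambda$, $|\lambda|$ their sum, $(1^n)$ the partition with $n$ entries $1$, and $(\lambda,1^n)$ is $\lambda$ with $n$ entries $1$ added. $\lambda_e$ consists of the even integers that appear an odd number of times in $\lambda$, each taken once. For an odd integer $o$ that appears at least twice in $\lambda$, put $\lambda'=\lambda\setminus(\lambda_e,o,o)$, $\mu'=\mu\setminus\mu_e$, $2c=\bigl||\lambda_e|+2o-|\mu_e|\bigr|$, $s(h)=\frac{l(\lambda')+l(\mu')}2+c+h$, $t(m)=l(\lambda_e)+l(\mu_e)+2g-2+4m+2c$, and $$z_{\lambda,\mu}(g,h,m)=Z_g\bigl((\lambda,1^{2c+h+2m-1}),(\mu,1^{2c+h+2m-1});s(h),t(m)\bigr).$$ **Theorem.** Let $\lambda,\mu$ be partitions with $|\lambda|=|\mu|$. There is an integer $n_0\ge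 0$, depending only on $\lambda$ and $\mu$, such that the following holds for every odd integer $o\neq1$ that appears at least twice in $\lambda$, provided that some even integer $e\ge 2o$ appears an odd number of times in $\mu$ (that is, $e$ is an entry of $\mu_e$). For all integers $g\ge0$, $h>n_0+3$ and $m>1$, $$z_{\lambda,\mu}(g,h,m)\ \ge\ \bigl|\mathcal Z_0\bigl((1^{h-n_0}),(1^{h-n_0});\Lambda_{h-n_0-1,0}\bigr)\bigr|\cdot Z_g\bigl((1^{2m-1}),(1^{2m-1});\Lambda_{0,4m+2g-4}\bigr).$$ -/

import Mathlib

open scoped ENNReal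

/-! ### Distributions of branch points on the tropical line -/

/-- An `(s,t)`-distribution: `s` pairs of real points (the triple branch points) and `t` real
points (the simple branch points); no point of any kind lies between the two points of a pair. -/
structure BranchDistribution (s t : ℕ) where
  x : Fin s → ℝ × ℝ
  y : Fin t → ℝ
  x_lt : ∀ i, (x i).1 < (x i).2
  x_mono : ∀ i j, i < j → (x i).2 < (x j).1
  y_mono : StrictMono y
  sep : ∀ i j, y j ∉ Set.Icc (x i).1 (x i).2

namespace BranchDistribution

variable {s t : ℕ}

/-- The `2s` points that occur in the pairs. -/
def xPoints (z : BranchDistribution s t) : Set ℝ := {r | ∃ i, r = (z.x i).1 ∨ r = (z.x i).2}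

/-- The `t` single points. -/
def yPoints (z : BranchDistribution s t) : Set ℝ := Set.range z.y

/-- The trivial distribution `w_1 < ⋯ < w_{2s+t}`: the first `2s` points form the pairs, the last
`t` points are the single points. -/
def IsTrivial (z : BranchDistribution s t) : Prop := ∀ i j, (z.x i).2 < z.y j

theorem finite_points (z : BranchDistribution s t) :
    (z.xPoints ∪ z.yPoints).Finite := by
  refine Set.Finite.union ?_ (Set.finite_range _)
  have : z.xPoints ⊆ Set.range (fun i => (z.x i).1) ∪ Set.range (fun i => (z.x i).2) := by
    rintro r ⟨i, rfl | rfl⟩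
    · exact Or.inl ⟨i, rfl⟩
    · exact Or.inr ⟨i, rfl⟩
  exact ((Set.finite_range _).union (Set.finite_range _)).subset this

end BranchDistribution

/-! ### Tropical covers -/

open Classical in
/-- A tropical cover `φ : C → T𝐏¹` of the tropical line by a tropical curve with at least one inner
vertex.  `V` is the set of inner (trivalent) vertices of `C` and `E` its set of edges.  Each edge is
oriented so that `φ` increases along it; `src e = none` means that `e` is an end which starts at a
leaf over `-∞`, and `tgt e = none` that it is an end which stops at a leaf over `+∞` (each end has a
leaf of its own).  `len e` is the length of `e`, `pos v` is `φ v`, and `weight e` is the slope of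
`φ` along `e`. -/
structure TropicalCover where
  V : Type
  E : Type
  [fintypeV : Fintype V]
  [fintypeE : Fintype E]
  src : E → Option V
  tgt : E → Option V
  weight : E → ℕ
  len : E → ℝ≥0∞
  pos : V → ℝ
  nonempty : Nonempty V
  incident : ∀ e, src e ≠ none ∨ tgt e ≠ none
  connected : ∀ u v, Relation.ReflTransGen
    (fun a b => ∃ e, (src e = some a ∧ tgt e = some b) ∨ (src e = some b ∧ tgt e = some a)) u v
  trivalent : ∀ v, {e | tgt e = some v}.ncard + {e | src e = some v}.ncard = 3
  weight_pos : ∀ e, 0 < weight e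
  len_end : ∀ e, src e = none ∨ tgt e = none → len e = ⊤
  len_inner : ∀ e, src e ≠ none → tgt e ≠ none → len e ≠ 0 ∧ len e ≠ ⊤
  slope : ∀ e u v, src e = some u → tgt e = some v →
    pos v - pos u = weight e * (len e).toReal
  balanced : ∀ v, ∑ e with tgt e = some v, weight e = ∑ e with src e = some v, weight e

namespace TropicalCover

attribute [instance] TropicalCover.fintypeV TropicalCover.fintypeE

variable (C : TropicalCover) {s t : ℕ} (z : BranchDistribution s t)

/-- Edges which enter `v`. -/
def inE (v : C.V) : Set C.E := {e | C.tgt e = some v}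

/-- Edges which leave `v`. -/
def outE (v : C.V) : Set C.E := {e | C.src e = some v}

/-- `e` is an inner edge, i.e. not an end. -/
def IsInner (e : C.E) : Prop := C.src e ≠ none ∧ C.tgt e ≠ none

/-- `v` is an endpoint of `e`. -/
def Touches (e : C.E) (v : C.V) : Prop := C.src e = some v ∨ C.tgt e = some v

/-- `u` and `v` are joined by a path of edges from `K`. -/
def Joined (K : Set C.E) (u v : C.V) : Prop :=
  Relation.ReflTransGen (fun a b => ∃ e ∈ K, C.Touches e a ∧ C.Touches e b) u v

/-- The source curve (which is connected) has first Betti number `g`. -/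
def HasGenus (g : ℕ) : Prop := {e | C.IsInner e}.ncard + 1 = Fintype.card C.V + g

/-- The cover is of type `(g, lam, mu, z)`. -/
structure HasType (g : ℕ) (lam mu : Multiset ℕ) : Prop where
  genus : C.HasGenus g
  image : Set.range C.pos = z.xPoints ∪ z.yPoints
  left : (Finset.univ.filter fun e => C.src e = none).val.map C.weight = lam
  right : (Finset.univ.filter fun e => C.tgt e = none).val.map C.weight = mu

open Classical in
/-- Edges of a cover of type `(g, lam, mu, z)` have weight at most `|lam|`. -/
theorem HasType.weight_le {C : TropicalCover} {s t : ℕ} {z : BranchDistribution s t} {g : ℕ}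
    {lam mu : Multiset ℕ} (h : C.HasType z g lam mu) (e : C.E) : C.weight e ≤ lam.sum := by
  have hl : lam.sum = ∑ f with C.src f = none, C.weight f := by
    rw [← h.left]; rfl
  rcases hs : C.src e with _ | u
  · rw [hl]
    exact Finset.single_le_sum (f := C.weight) (fun _ _ => Nat.zero_le _) (by simp [hs])
  have mono : ∀ f a b, C.src f = some a → C.tgt f = some b → C.pos a < C.pos b := by
    intro f a b ha hb
    have h1 := C.slope f a b ha hb
    have h2 := C.len_inner f (by simp [ha]) (by simp [hb])
    have h3 := ENNReal.toReal_pos h2.1 h2.2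
    have h4 : (0 : ℝ) < C.weight f := by exact_mod_cast C.weight_pos f
    nlinarith [mul_pos h4 h3]
  let U : Finset C.V := Finset.univ.filter fun v => C.pos v ≤ C.pos u
  let A : Finset C.E := U.biUnion fun v => Finset.univ.filter fun f => C.tgt f = some v
  let B : Finset C.E := U.biUnion fun v => Finset.univ.filter fun f => C.src f = some v
  have key : ∑ f ∈ A, C.weight f = ∑ f ∈ B, C.weight f := by
    rw [Finset.sum_biUnion, Finset.sum_biUnion]
    · exact Finset.sum_congr rfl fun v _ => C.balanced v
    · intro a _ b _ hab
      refine Finset.disjoint_left.2 fun f hf hf' => hab ?_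
      simp only [Finset.mem_filter, Finset.mem_univ, true_and] at hf hf'
      exact Option.some.inj (hf.symm.trans hf')
    · intro a _ b _ hab
      refine Finset.disjoint_left.2 fun f hf hf' => hab ?_
      simp only [Finset.mem_filter, Finset.mem_univ, true_and] at hf hf'
      exact Option.some.inj (hf.symm.trans hf')
  have memA : ∀ f, f ∈ A ↔ ∃ v, C.pos v ≤ C.pos u ∧ C.tgt f = some v := by
    intro f; simp [A, U]
  have memB : ∀ f, f ∈ B ↔ ∃ v, C.pos v ≤ C.pos u ∧ C.src f = some v := by
    intro f; simp [B, U]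
  have heB : e ∈ B := (memB e).2 ⟨u, le_rfl, hs⟩
  have heA : e ∉ A := by
    rw [memA]
    rintro ⟨v, hv, ht⟩
    exact absurd (mono e u v hs ht) (not_lt.2 hv)
  have hsub : A ⊆ B.erase e ∪ Finset.univ.filter fun f => C.src f = none := by
    intro f hf
    obtain ⟨v, hv, ht⟩ := (memA f).1 hf
    have hne : f ≠ e := fun h => heA (h ▸ hf)
    rcases hsf : C.src f with _ | a
    · simp [hsf]
    · refine Finset.mem_union_left _ (Finset.mem_erase.2 ⟨hne, (memB f).2 ⟨a, ?_, hsf⟩⟩)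
      exact (mono f a v hsf ht).le.trans hv
  have h1 : ∑ f ∈ A, C.weight f ≤ ∑ f ∈ B.erase e, C.weight f + lam.sum := by
    rw [hl]
    exact (Finset.sum_le_sum_of_subset hsub).trans (Finset.sum_union_inter (f := C.weight) ▸
      Nat.le_add_right _ _)
  have h2 := Finset.add_sum_erase B C.weight heB
  omega

open Classical in
/-- The numbers of inner vertices and of edges are determined by the type. -/
theorem HasType.card {C : TropicalCover} {s t : ℕ} {z : BranchDistribution s t} {g : ℕ}
    {lam mu : Multiset ℕ} (h : C.HasType z g lam mu) :
    Fintype.card C.V = 2 * g + lam.card + mu.card - 2 ∧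
      Fintype.card C.E = 3 * g + 2 * lam.card + 2 * mu.card - 3 := by
  have hV : 0 < Fintype.card C.V := @Fintype.card_pos _ _ C.nonempty
  have hl : (Finset.univ.filter fun e => C.src e = none).card = lam.card := by
    rw [← h.left, Multiset.card_map]; congr
  have hr : (Finset.univ.filter fun e => C.tgt e = none).card = mu.card := by
    rw [← h.right, Multiset.card_map]; congr
  have hg := h.genus
  unfold HasGenus at hg
  have cnt : ∀ w : C.E → Option C.V,
      ∑ v, (Finset.univ.filter fun e => w e = some v).card +
        (Finset.univ.filter fun e => w e = none).card = Fintype.card C.E := by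
    intro w
    have := Finset.card_eq_sum_card_fiberwise (f := w) (s := Finset.univ) (t := Finset.univ)
      (fun _ _ => Finset.mem_coe.2 (Finset.mem_univ _))
    rw [Fintype.sum_option] at this
    rw [← Finset.card_univ, this, add_comm]
  have h3 : ∑ v, ((Finset.univ.filter fun e => C.tgt e = some v).card +
      (Finset.univ.filter fun e => C.src e = some v).card) = 3 * Fintype.card C.V := by
    rw [Finset.sum_congr rfl (g := fun _ => 3)]
    · simp [mul_comm]
    · intro v _
      have := C.trivalent v
      rwa [Set.ncard_eq_toFinset_card', Set.ncard_eq_toFinset_card', Set.toFinset_ofPred,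
        Set.toFinset_ofPred] at this
  rw [Finset.sum_add_distrib] at h3
  have ht := cnt C.tgt
  have hs := cnt C.src
  have hi : {e | C.IsInner e}.ncard + lam.card + mu.card = Fintype.card C.E := by
    rw [← hl, ← hr, Set.ncard_eq_toFinset_card', Set.toFinset_ofPred, add_assoc,
      ← Finset.card_union_of_disjoint, ← Finset.card_union_of_disjoint, ← Finset.card_univ]
    · congr 1
      ext e
      simp only [IsInner, Finset.mem_union, Finset.mem_filter, Finset.mem_univ, true_and, iff_true]
      tauto
    · rw [Finset.disjoint_left]
      intro e
      simp only [IsInner, Finset.mem_union, Finset.mem_filter, Finset.mem_univ, true_and]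
      tauto
    · rw [Finset.disjoint_left]
      intro e
      simp only [Finset.mem_filter, Finset.mem_univ, true_and]
      have := C.incident e
      tauto
  omega

/-- An isomorphism of tropical covers: an isomorphism of the source curves which commutes with the
maps to the tropical line.  It is automatically an isometry, see `Iso.len_eq`. -/
structure Iso (C D : TropicalCover) where
  onV : C.V ≃ D.V
  onE : C.E ≃ D.E
  src_eq : ∀ e, D.src (onE e) = (C.src e).map onV
  tgt_eq : ∀ e, D.tgt (onE e) = (C.tgt e).map onV
  weight_eq : ∀ e, D.weight (onE e) = C.weight e
  pos_eq : ∀ v, D.pos (onV v) = C.pos v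

/-- Isomorphisms preserve the lengths of edges. -/
theorem Iso.len_eq {C D : TropicalCover} (f : Iso C D) (e : C.E) : D.len (f.onE e) = C.len e := by
  rcases hs : C.src e with _ | u
  · rw [C.len_end e (Or.inl hs), D.len_end _ (Or.inl (by simp [f.src_eq, hs]))]
  rcases ht : C.tgt e with _ | v
  · rw [C.len_end e (Or.inr ht), D.len_end _ (Or.inr (by simp [f.tgt_eq, ht]))]
  have hs' : D.src (f.onE e) = some (f.onV u) := by simp [f.src_eq, hs]
  have ht' : D.tgt (f.onE e) = some (f.onV v) := by simp [f.tgt_eq, ht]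
  have h1 := C.slope e u v hs ht
  have h2 := D.slope _ _ _ hs' ht'
  rw [f.pos_eq, f.pos_eq, f.weight_eq, h1] at h2
  have hw : (C.weight e : ℝ) ≠ 0 := by exact_mod_cast (C.weight_pos e).ne'
  have h3 := mul_left_cancel₀ hw h2
  exact ((ENNReal.toReal_eq_toReal_iff' (C.len_inner e (by simp [hs]) (by simp [ht])).2
    (D.len_inner _ (by simp [hs']) (by simp [ht'])).2).1 h3).symm

/-- The identity. -/
def Iso.refl (C : TropicalCover) : Iso C C :=
  ⟨Equiv.refl _, Equiv.refl _, by simp, by simp, by simp, by simp⟩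

/-- The inverse isomorphism. -/
def Iso.symm {C D : TropicalCover} (f : Iso C D) : Iso D C where
  onV := f.onV.symm
  onE := f.onE.symm
  src_eq e := by
    have h := f.src_eq (f.onE.symm e)
    simp only [Equiv.apply_symm_apply] at h
    rw [h]; cases C.src (f.onE.symm e) <;> simp
  tgt_eq e := by
    have h := f.tgt_eq (f.onE.symm e)
    simp only [Equiv.apply_symm_apply] at h
    rw [h]; cases C.tgt (f.onE.symm e) <;> simp
  weight_eq e := by simpa using (f.weight_eq (f.onE.symm e)).symm
  pos_eq v := by simpa using (f.pos_eq (f.onV.symm v)).symm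

/-- The composite of two isomorphisms. -/
def Iso.trans {C D F : TropicalCover} (f : Iso C D) (h : Iso D F) : Iso C F where
  onV := f.onV.trans h.onV
  onE := f.onE.trans h.onE
  src_eq e := by simp [h.src_eq, f.src_eq]
  tgt_eq e := by simp [h.tgt_eq, f.tgt_eq]
  weight_eq e := by simp [h.weight_eq, f.weight_eq]
  pos_eq v := by simp [h.pos_eq, f.pos_eq]

/-! ### Symmetric cycles and forks, resolving covers -/

/-- `e` and `f` have the same weight and run between the same two inner vertices, or are ends
of the same weight at the same inner vertex. -/
def Parallel (e f : C.E) : Prop :=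
  e ≠ f ∧ C.src e = C.src f ∧ C.tgt e = C.tgt f ∧ C.weight e = C.weight f

/-- The set of symmetric cycles and symmetric forks, each given by its two edges. -/
def Sym : Set (Finset C.E) := {p | ∃ e f, C.Parallel e f ∧ (p : Set C.E) = {e, f}}

/-- The set of symmetric cycles. -/
def Symc : Set (Finset C.E) := {p | p ∈ C.Sym ∧ ∀ e ∈ p, C.IsInner e}

/-- First row of the list of local pictures, two incoming flags of the same weight `k`:
`k, k → 2k` at `u`, then `2k, c → c + 2k` at `v`. -/
def PairJoin (u v : C.V) : Prop :=
  ∃ a b f c d, C.Parallel a b ∧ f ≠ c ∧ C.inE u = {a, b} ∧ C.outE u = {f} ∧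
    C.inE v = {f, c} ∧ C.outE v = {d}

/-- First row of the list of local pictures, two outgoing flags of the same weight `k`:
`c + 2k → c, 2k` at `u`, then `2k → k, k` at `v`. -/
def PairSplit (u v : C.V) : Prop :=
  ∃ a b f c d, C.Parallel a b ∧ f ≠ c ∧ C.inE u = {d} ∧ C.outE u = {f, c} ∧
    C.inE v = {f} ∧ C.outE v = {a, b}

/-- Second and third row of the list of local pictures, one for each choice of the parities of
`a`, `f`, `b`: `a → c, f` at `u`, then `f, b → d` at `v`; the four edges `a, b, c, d` are other
than the contractible edge `f`, and `b` is not `c`. -/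
def PairExchange (u v : C.V) (a c f b d : C.E) : Prop :=
  c ≠ f ∧ b ≠ f ∧ b ≠ c ∧ C.inE u = {a} ∧ C.outE u = {c, f} ∧ C.inE v = {f, b} ∧ C.outE v = {d}

/-- Last row of the list of local pictures: `a → f, f'` at `u`, then `f, f' → d` at `v`; either all
weights are even, or `a` and `d` are odd and exactly one of `f`, `f'` is even. -/
def PairCycle (u v : C.V) : Prop :=
  ∃ a f f' d, f ≠ f' ∧ C.inE u = {a} ∧ C.outE u = {f, f'} ∧ C.inE v = {f, f'} ∧ C.outE v = {d} ∧
    Even (C.weight f)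

/-- Resolving tropical covers. -/
def IsResolving : Prop :=
  ∀ i, ∃ u v, C.pos u = (z.x i).1 ∧ C.pos v = (z.x i).2 ∧
    (C.PairJoin u v ∨ C.PairSplit u v ∨ (∃ a c f b d, C.PairExchange u v a c f b d) ∨
      C.PairCycle u v)

/-- The contractible edges: those which connect the two vertices over a pair of points. -/
def IsContractible (e : C.E) : Prop :=
  ∃ i u v, C.src e = some u ∧ C.tgt e = some v ∧ C.pos u = (z.x i).1 ∧ C.pos v = (z.x i).2

/-- Non-contractible symmetric cycles and forks. -/
def NonContractibleSym : Set (Finset C.E) := {p | p ∈ C.Sym ∧ ∀ e ∈ p, ¬ C.IsContractible z e}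

/-- `p` has a vertex in common with some contractible edge. -/
def AdjacentContractible (p : Finset C.E) : Prop :=
  ∃ e ∈ p, ∃ f v, C.IsContractible z f ∧ C.Touches e v ∧ C.Touches f v

/-- Non-contractible symmetric cycles and forks adjacent to a contractible edge. -/
def Sym3 : Set (Finset C.E) := {p | p ∈ C.NonContractibleSym z ∧ C.AdjacentContractible z p}

/-- Non-contractible symmetric cycles and forks not adjacent to a contractible edge. -/
def Sym2 : Set (Finset C.E) := {p | p ∈ C.NonContractibleSym z ∧ ¬ C.AdjacentContractible z p}

/-- Contractible symmetric cycles. -/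
def SymcC : Set (Finset C.E) := {p | p ∈ C.Symc ∧ ∃ e ∈ p, C.IsContractible z e}

/-- Nonsymmetric cycles which consist of two even contractible edges. -/
def NsymC : Set (Finset C.E) :=
  {p | ∃ e f, (p : Set C.E) = {e, f} ∧ C.src e = C.src f ∧ C.tgt e = C.tgt f ∧
    C.weight e ≠ C.weight f ∧ (∀ x ∈ p, C.IsContractible z x ∧ Even (C.weight x))}

/-! ### Generalized zigzag covers -/

/-- `IsTail near far SV r T`: the set of edges `T` is a tail with root edge `r`, outside the vertex
set `SV`.  Here `near e` is the endpoint of `e` on the side of the root and `far e` the one on the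
other side.  A tail is a single even end, or an even edge followed by a symmetric fork, or an even
edge followed by a symmetric cycle of odd weight and a further tail. -/
inductive IsTail (near far : C.E → Option C.V) (SV : Set C.V) : C.E → Set C.E → Prop
  | single (r : C.E) : far r = none → Even (C.weight r) → IsTail near far SV r {r}
  | fork (r a b : C.E) (v : C.V) : v ∉ SV → far r = some v → {e | far e = some v} = {r} →
      {e | near e = some v} = {a, b} → far a = none → far b = none → C.Parallel a b →
      IsTail near far SV r {r, a, b}
  | cycle (r a b r' : C.E) (v u : C.V) (T : Set C.E) : v ∉ SV → u ∉ SV → far r = some v →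
      {e | far e = some v} = {r} → {e | near e = some v} = {a, b} →
      {e | far e = some u} = {a, b} → {e | near e = some u} = {r'} →
      C.Parallel a b → Odd (C.weight a) → IsTail near far SV r' T →
      IsTail near far SV r ({r, a, b} ∪ T)

/-- The set of edges `T` is an inward or an outward tail which is attached by its root to `SV`. -/
def IsTailAt (SV : Set C.V) (T : Set C.E) : Prop :=
  ∃ r, ∃ v ∈ SV, (C.tgt r = some v ∧ C.IsTail C.tgt C.src SV r T) ∨
    (C.src r = some v ∧ C.IsTail C.src C.tgt SV r T)

/-- The subgraph `S` with vertices `SV` and edges `SE` satisfies the conditions in the definition of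
a generalized zigzag cover. -/
structure IsZigzagCore (SV : Set C.V) (SE : Set C.E) : Prop where
  subgraph : ∀ e ∈ SE, ∀ v, C.Touches e v → v ∈ SV
  nonempty : SV.Nonempty
  connected : ∀ u ∈ SV, ∀ v ∈ SV, C.Joined SE u v
  disjoint : ∀ p ∈ C.Sym2 z, ∀ e ∈ p, e ∉ SE
  contractible : ∀ e, C.IsContractible z e → e ∈ SE
  odd : ∀ e ∈ SE, Even (C.weight e) → C.IsContractible z e
  tails : ∀ e ∉ SE, ∃ T, e ∈ T ∧ C.IsTailAt SV T

/-- Generalized zigzag covers of type `(g, lam, mu, z)`. -/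
structure IsZigzag (g : ℕ) (lam mu : Multiset ℕ) : Prop where
  type : C.HasType z g lam mu
  resolving : C.IsResolving z
  core : ∃ SV SE, C.IsZigzagCore z SV SE

/-- Properly mixed generalized zigzag covers of type `(g, lam, mu, z)`; this notion is used for
trivial distributions `z`.  Here `c` is the characteristic edge. -/
structure IsProperlyMixed (g : ℕ) (lam mu : Multiset ℕ) : Prop where
  type : C.HasType z g lam mu
  resolving : C.IsResolving z
  mixed : ∃ SV SE, C.IsZigzagCore z SV SE ∧ ∃ c ∈ SE, ∃ v₁ v₂ v₁',
    C.src c = some v₁ ∧ C.tgt c = some v₂ ∧ Odd (C.weight c) ∧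
    -- removing the characteristic edge leaves two components, one over the pairs, one over the
    -- single points
    ¬ C.Joined {e | e ≠ c} v₁ v₂ ∧
    (∀ u, (C.Joined {e | e ≠ c} v₁ u ∧ C.pos u ∈ z.xPoints) ∨
      (C.Joined {e | e ≠ c} v₂ u ∧ C.pos u ∈ z.yPoints)) ∧
    -- the pair `(v₁', v₁)` lies over the first pair of points
    (∃ i : Fin s, i.val = 0 ∧ C.pos v₁' = (z.x i).1 ∧ C.pos v₁ = (z.x i).2) ∧
    -- at this pair, `a` and `b` are odd inward ends of the same weight, and the contractible edge
    -- is even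
    (∃ a k f b, C.PairExchange v₁' v₁ a k f b c ∧ Even (C.weight f) ∧ Odd (C.weight k) ∧
      C.src a = none ∧ C.src b = none ∧ Odd (C.weight a) ∧ C.weight a = C.weight b) ∧
    -- `v₂` lies over the last point and has two odd incoming edges
    (∃ j : Fin t, j.val + 1 = t ∧ C.pos v₂ = z.y j) ∧
    ∃ p q, p ≠ q ∧ C.inE v₂ = {p, q} ∧ Odd (C.weight p) ∧ Odd (C.weight q)

/-! ### Colourings and multiplicities -/

/-- A colouring of a tropical cover: a set `I` of symmetric cycles and forks, and a colour (`true`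
for red, `false` for blue) for each component of the graph of even edges outside `I`; the values of
`red` at other edges carry no meaning. -/
structure Colouring where
  I : Set (Finset C.E)
  sub : I ⊆ C.Sym
  red : C.E → Bool
  const : ∀ e f v, (Even (C.weight e) ∧ ∀ p ∈ I, e ∉ p) → (Even (C.weight f) ∧ ∀ p ∈ I, f ∉ p) →
    C.Touches e v → C.Touches f v → red e = red f

namespace Colouring

variable {C} (ρ : C.Colouring)

/-- `e` lies outside the symmetric cycles and forks of `I`. -/
def Outside (e : C.E) : Prop := ∀ p ∈ ρ.I, e ∉ p

/-- The vertex `v` is positive.  `r` is the edge alone on its side of `v`, and `a`, `b` are the two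
edges on the other side. -/
def IsPositive (v : C.V) : Prop :=
  ∃ r a b, a ≠ b ∧ ((C.inE v = {r} ∧ C.outE v = {a, b}) ∨ (C.outE v = {r} ∧ C.inE v = {a, b})) ∧
    -- an odd edge `r`, and a blue even edge `b` on the other side
    ((Odd (C.weight r) ∧ Even (C.weight b) ∧ ρ.red b = false) ∨
    -- three blue even edges
      (Even (C.weight r) ∧ Even (C.weight a) ∧ Even (C.weight b) ∧ ρ.Outside a ∧ ρ.Outside b ∧
        ρ.red r = false) ∨
    -- a red even edge `r`, and two odd edges outside `I`
      (Odd (C.weight a) ∧ Odd (C.weight b) ∧ ρ.Outside a ∧ ρ.Outside b ∧ ρ.red r = true) ∨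
    -- a blue even edge `r`, and a symmetric cycle or fork in `I`
      ((∃ p ∈ ρ.I, (p : Set C.E) = {a, b}) ∧ ρ.red r = false))

/-- The vertex `v` is negative: the same with the colours exchanged. -/
def IsNegative (v : C.V) : Prop :=
  ∃ r a b, a ≠ b ∧ ((C.inE v = {r} ∧ C.outE v = {a, b}) ∨ (C.outE v = {r} ∧ C.inE v = {a, b})) ∧
    ((Odd (C.weight r) ∧ Even (C.weight b) ∧ ρ.red b = true) ∨
      (Even (C.weight r) ∧ Even (C.weight a) ∧ Even (C.weight b) ∧ ρ.Outside a ∧ ρ.Outside b ∧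
        ρ.red r = true) ∨
      (Odd (C.weight a) ∧ Odd (C.weight b) ∧ ρ.Outside a ∧ ρ.Outside b ∧ ρ.red r = false) ∨
      ((∃ p ∈ ρ.I, (p : Set C.E) = {a, b}) ∧ ρ.red r = true))

/-- Effective colourings. -/
structure IsEffective : Prop where
  sign : ∀ i u v, C.pos u = (z.x i).1 → C.pos v = (z.x i).2 →
    (ρ.IsPositive u ∧ ρ.IsPositive v) ∨ (ρ.IsNegative u ∧ ρ.IsNegative v)
  sym3 : C.Sym3 z ⊆ ρ.I
  symc : C.SymcC z ∩ ρ.I = ∅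

/-- The real multiplicity of an effectively coloured cover; `p.sup C.weight` is the common weight of
the two edges of a symmetric cycle `p`. -/
noncomputable def mult : ℚ :=
  2 ^ ({e | C.IsInner e ∧ Even (C.weight e) ∧ ρ.Outside e ∧ ¬ C.IsContractible z e}.ncard +
      (C.Symc ∩ C.Sym3 z).ncard + (C.NsymC z).ncard) / 2 ^ (C.Sym2 z).ncard *
    ∏ᶠ p ∈ C.Symc ∩ ρ.I, ((p.sup C.weight : ℕ) : ℚ)

end Colouring

/-- Some effective colouring has odd multiplicity. -/
def HasOddMult : Prop :=
  ∃ ρ : C.Colouring, ρ.IsEffective z ∧ ∃ k : ℤ, Odd k ∧ ρ.mult z = k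

end TropicalCover

/-! ### Isomorphism classes and zigzag numbers -/

/-- Isomorphism of tropical covers, for covers with a given property. -/
def isoSetoid (P : TropicalCover → Prop) : Setoid {C : TropicalCover // P C} where
  r C D := Nonempty (TropicalCover.Iso C.1 D.1)
  iseqv := ⟨fun C => ⟨TropicalCover.Iso.refl C.1⟩, fun ⟨f⟩ => ⟨f.symm⟩, fun ⟨f⟩ ⟨h⟩ => ⟨f.trans h⟩⟩

/-- There are only finitely many isomorphism classes of covers of a given type. -/
theorem finite_isoClasses {s t g : ℕ} {lam mu : Multiset ℕ} {z : BranchDistribution s t}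
    {P : TropicalCover → Prop} (hP : ∀ C, P C → C.HasType z g lam mu) :
    Finite (Quotient (isoSetoid P)) := by
  classical
  let n := 2 * g + lam.card + mu.card - 2
  let k := 3 * g + 2 * lam.card + 2 * mu.card - 3
  have : Finite ↥(z.xPoints ∪ z.yPoints) := z.finite_points
  let vE : ∀ C : {C : TropicalCover // P C}, C.1.V ≃ Fin n := fun C =>
    Fintype.equivFinOfCardEq (hP C.1 C.2).card.1
  let eE : ∀ C : {C : TropicalCover // P C}, C.1.E ≃ Fin k := fun C =>
    Fintype.equivFinOfCardEq (hP C.1 C.2).card.2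
  let code : {C : TropicalCover // P C} → (Fin k → Option (Fin n)) × (Fin k → Option (Fin n)) ×
      (Fin k → Fin (lam.sum + 1)) × (Fin n → ↥(z.xPoints ∪ z.yPoints)) := fun C =>
    ⟨fun i => (C.1.src ((eE C).symm i)).map (vE C), fun i => (C.1.tgt ((eE C).symm i)).map (vE C),
      fun i => ⟨C.1.weight ((eE C).symm i), Nat.lt_succ_of_le ((hP C.1 C.2).weight_le _)⟩,
      fun i => ⟨C.1.pos ((vE C).symm i), (hP C.1 C.2).image ▸ Set.mem_range_self _⟩⟩
  suffices main : ∀ C D, code C = code D → Nonempty (TropicalCover.Iso C.1 D.1) by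
    refine Finite.of_injective (fun q : Quotient (isoSetoid P) => code q.out) fun q r h => ?_
    rw [← q.out_eq, ← r.out_eq]
    exact Quotient.sound (main _ _ h)
  intro C D h
  simp only [code, Prod.mk.injEq, funext_iff, Fin.mk.injEq, Subtype.mk.injEq] at h
  obtain ⟨h1, h2, h3, h4⟩ := h
  have inj : ∀ a b, Option.map (vE C) a = Option.map (vE D) b →
      b = Option.map ((vE C).trans (vE D).symm) a := by
    intro a b hab
    rcases a with _ | a <;> rcases b with _ | b <;> simp_all
  exact ⟨⟨(vE C).trans (vE D).symm, (eE C).trans (eE D).symm,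
    fun e => inj _ _ (by simpa using h1 (eE C e)),
    fun e => inj _ _ (by simpa using h2 (eE C e)),
    fun e => by simpa using (h3 (eE C e)).symm,
    fun v => by simpa using (h4 (vE C v)).symm⟩⟩

/-- The set of isomorphism classes of generalized zigzag covers of type `(g, lam, mu, z)`. -/
def ZigzagClass {s t : ℕ} (g : ℕ) (lam mu : Multiset ℕ) (z : BranchDistribution s t) : Type 1 :=
  Quotient (isoSetoid fun C => C.IsZigzag z g lam mu)

/-- The set of isomorphism classes of properly mixed generalized zigzag covers. -/
def ProperZigzagClass {s t : ℕ} (g : ℕ) (lam mu : Multiset ℕ) (z : BranchDistribution s t) : Type 1 :=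
  Quotient (isoSetoid fun C => C.IsProperlyMixed z g lam mu)

instance {s t g : ℕ} {lam mu : Multiset ℕ} {z : BranchDistribution s t} :
    Finite (ZigzagClass g lam mu z) :=
  finite_isoClasses fun _ h => h.type

instance {s t g : ℕ} {lam mu : Multiset ℕ} {z : BranchDistribution s t} :
    Finite (ProperZigzagClass g lam mu z) :=
  finite_isoClasses fun _ h => h.type

open Classical in
/-- The exponent `m(φ)`: `0` if the multiplicity is odd for an effective colouring, else `1`. -/
noncomputable def ZigzagClass.exponent {s t g : ℕ} {lam mu : Multiset ℕ} {z : BranchDistribution s t}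
    (q : ZigzagClass g lam mu z) : ℕ :=
  if (Quotient.out q).1.HasOddMult z then 0 else 1

/-- The generalized zigzag number. -/
noncomputable def zigzagNumber {s t : ℕ} (g : ℕ) (lam mu : Multiset ℕ) (z : BranchDistribution s t) : ℕ :=
  ∑ᶠ q : ZigzagClass g lam mu z, 2 ^ q.exponent

/-- The proper zigzag number (for a trivial distribution `z`). -/
noncomputable def properZigzagNumber {s t : ℕ} (g : ℕ) (lam mu : Multiset ℕ)
    (z : BranchDistribution s t) : ℕ :=
  Nat.card (ProperZigzagClass g lam mu z)

/-! ### The numerical data of the theorem -/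

/-- The even part `lam_e` of the tail decomposition of `lam`: the even entries of odd multiplicity,
each taken once. -/
def evenPart (lam : Multiset ℕ) : Multiset ℕ :=
  lam.dedup.filter fun k => Even k ∧ Odd (lam.count k)

/-- The integer `c` with `2c = ||lam_e| + 2o - |mu_e||` (the right-hand side is even). -/
def cConst (lam mu : Multiset ℕ) (o : ℕ) : ℕ :=
  (((evenPart lam).sum + 2 * o : ℤ) - (evenPart mu).sum).natAbs / 2

/-- The number `2c + h + 2m - 1` of ones that are added to both partitions. -/
def numOnes (lam mu : Multiset ℕ) (o h m : ℕ) : ℕ :=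
  2 * cConst lam mu o + h + 2 * m - 1

/-- The number `(l(lam') + l(mu')) / 2 + c + h` of triple branch points, where `lam'` is `lam`
without `lam_e` and two entries `o`, and `mu'` is `mu` without `mu_e`. -/
def numTriple (lam mu : Multiset ℕ) (o h : ℕ) : ℕ :=
  ((lam - evenPart lam - {o, o}).card + (mu - evenPart mu).card) / 2 + cConst lam mu o + h

/-- The number `l(lam_e) + l(mu_e) + 2g - 2 + 4m + 2c` of simple branch points. -/
def numSimple (lam mu : Multiset ℕ) (o g m : ℕ) : ℕ :=
  (evenPart lam).card + (evenPart mu).card + 2 * g + 4 * m + 2 * cConst lam mu o - 2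

/-- The partition `(1^n)`. -/
def ones (n : ℕ) : Multiset ℕ := Multiset.replicate n 1

/-! The inequality comes from an injection. Let `A` be a zigzag cover of genus 0 over pairs and `B`
one of genus `g` over single points, all their ends having weight 1. Both are built into one
properly mixed cover of the required type, from which they can be recovered up to isomorphism. With
`d` the common size of the partitions, `n₀ = d + 2` works.

Over the pairs, small covers with two vertices are chained along odd edges. Read from left to right,
the first pair carries the exchange picture with two left ends `o`; it sends out the characteristic
edge, of weight `2 * o - 1`, and passes on an edge of weight 1. Along the chain this edge is then
joined by doubled left ends, absorbs the remaining odd entries of `lam`, emits the odd entries of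
`mu`, and splits off doubled right ends until its weight is 1 again. It then enters `A`, which
occupies the last pairs. Absorbing an odd entry costs a right end of weight 1, and emitting one
costs a left end of weight 1; doubled ends of weight 1 fill up the numbers.

Over the single points, a fork of two left ends of weight 1 lies over the first two points, and its
even edge splits into two odd edges of weight 1. One enters `B`, placed over the following points.
The other runs on past `B`, takes in the even entries of odd multiplicity of `lam`, gives off those
of `mu` except `e`, and takes in or gives off forks of weight 1 to balance the totals. At the last
point it meets the characteristic edge, and together they form the end `e`; its own weight there is
`e - 2 * o + 1`, which is where `2 * o ≤ e` enters.

`Block.join` shows that gluing along odd edges of the cores keeps the zigzag conditions: such an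
edge lies in no tail, and being a bridge it lies in no symmetric pair. `exists_left_end_of_pairs`
and `exists_left_end_of_odd` provide the left ends at which `A` and `B` are attached. Injectivity is
`Emb.nonempty_iso`: an isomorphism preserves the images of the vertices, and over the points
reserved for `A` there are only vertices of `A`; likewise for `B`. Finally `zigzagNumber_ones` turns
the zigzag number on the right-hand side into a plain count, because all covers concerned have odd
multiplicity. -/

namespace TropicalCover

/-! ### Covers from combinatorial data -/

open Classical in
/-- The tropical cover with given combinatorial data; the lengths are determined by the slopes. -/
noncomputable def ofNet (V E : Type) [Fintype V] [Fintype E] (src tgt : E → Option V)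
    (weight : E → ℕ) (pos : V → ℝ) (nonempty : Nonempty V)
    (incident : ∀ e, src e ≠ none ∨ tgt e ≠ none)
    (connected : ∀ u v, Relation.ReflTransGen (fun a b => ∃ e,
      (src e = some a ∧ tgt e = some b) ∨ (src e = some b ∧ tgt e = some a)) u v)
    (trivalent : ∀ v, {e | tgt e = some v}.ncard + {e | src e = some v}.ncard = 3)
    (weight_pos : ∀ e, 0 < weight e)
    (mono : ∀ e u v, src e = some u → tgt e = some v → pos u < pos v)
    (balanced : ∀ v, ∑ e with tgt e = some v, weight e = ∑ e with src e = some v, weight e) :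
    TropicalCover where
  V := V
  E := E
  src := src
  tgt := tgt
  weight := weight
  len e := (src e).elim ⊤ fun u => (tgt e).elim ⊤ fun v =>
    ENNReal.ofReal ((pos v - pos u) / weight e)
  pos := pos
  nonempty := nonempty
  incident := incident
  connected := connected
  trivalent := trivalent
  weight_pos := weight_pos
  len_end := by
    rintro e (h | h)
    · simp [h]
    · cases src e <;> simp [h]
  len_inner := by
    intro e hs ht
    obtain ⟨u, hu⟩ := Option.ne_none_iff_exists'.1 hs
    obtain ⟨v, hv⟩ := Option.ne_none_iff_exists'.1 ht
    have h1 := mono e u v hu hv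
    have h2 : (0 : ℝ) < weight e := by exact_mod_cast weight_pos e
    simp only [hu, hv, Option.elim_some]
    refine ⟨?_, ENNReal.ofReal_ne_top⟩
    rw [Ne, ENNReal.ofReal_eq_zero, not_le]
    exact div_pos (sub_pos.2 h1) h2
  slope := by
    intro e u v hu hv
    have h1 := mono e u v hu hv
    have h2 : (0 : ℝ) < weight e := by exact_mod_cast weight_pos e
    simp only [hu, hv, Option.elim_some]
    rw [ENNReal.toReal_ofReal (div_pos (sub_pos.2 h1) h2).le]
    field_simp
  balanced := balanced

theorem pos_lt (C : TropicalCover) {e : C.E} {u v : C.V} (hu : C.src e = some u)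
    (hv : C.tgt e = some v) : C.pos u < C.pos v := by
  have h1 := C.slope e u v hu hv
  have h2 := C.len_inner e (by simp [hu]) (by simp [hv])
  have h3 := ENNReal.toReal_pos h2.1 h2.2
  have h4 : (0 : ℝ) < C.weight e := by exact_mod_cast C.weight_pos e
  nlinarith [mul_pos h4 h3]

theorem Parallel.symm {C : TropicalCover} {e f : C.E} (h : C.Parallel e f) : C.Parallel f e :=
  ⟨h.1.symm, h.2.1.symm, h.2.2.1.symm, h.2.2.2.symm⟩

theorem exists_touches (C : TropicalCover) (e : C.E) : ∃ v, C.Touches e v := by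
  rcases C.incident e with h | h
  · obtain ⟨u, hu⟩ := Option.ne_none_iff_exists'.1 h
    exact ⟨u, Or.inl hu⟩
  · obtain ⟨u, hu⟩ := Option.ne_none_iff_exists'.1 h
    exact ⟨u, Or.inr hu⟩

/-! ### Embeddings with full stars -/

/-- An embedding of `A` in `C` which identifies the stars of the vertices of `A` with stars in `C`,
and whose image contains all vertices over the image of `A`. -/
structure Emb (A C : TropicalCover) where
  onV : A.V → C.V
  onE : A.E → C.E
  injV : Function.Injective onV
  injE : Function.Injective onE
  weight_eq : ∀ e, C.weight (onE e) = A.weight e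
  pos_eq : ∀ v, C.pos (onV v) = A.pos v
  src_iff : ∀ f v, C.src f = some (onV v) ↔ ∃ e, f = onE e ∧ A.src e = some v
  tgt_iff : ∀ f v, C.tgt f = some (onV v) ↔ ∃ e, f = onE e ∧ A.tgt e = some v
  full : ∀ v, C.pos v ∈ Set.range A.pos → v ∈ Set.range onV

namespace Emb

variable {A B C D : TropicalCover}

theorem src_onE (i : Emb A C) {e : A.E} {v : A.V} :
    C.src (i.onE e) = some (i.onV v) ↔ A.src e = some v := by
  rw [i.src_iff]
  constructor
  · rintro ⟨f, hf, h⟩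
    rwa [i.injE hf]
  · exact fun h => ⟨e, rfl, h⟩

theorem tgt_onE (i : Emb A C) {e : A.E} {v : A.V} :
    C.tgt (i.onE e) = some (i.onV v) ↔ A.tgt e = some v := by
  rw [i.tgt_iff]
  constructor
  · rintro ⟨f, hf, h⟩
    rwa [i.injE hf]
  · exact fun h => ⟨e, rfl, h⟩

theorem touches_onE (i : Emb A C) {e : A.E} {v : A.V} :
    C.Touches (i.onE e) (i.onV v) ↔ A.Touches e v := by
  simp only [Touches, i.src_onE, i.tgt_onE]

theorem touches_iff (i : Emb A C) {f : C.E} {v : A.V} :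
    C.Touches f (i.onV v) ↔ ∃ e, f = i.onE e ∧ A.Touches e v := by
  simp only [Touches, i.src_iff, i.tgt_iff]
  constructor
  · rintro (⟨e, h, h'⟩ | ⟨e, h, h'⟩)
    · exact ⟨e, h, Or.inl h'⟩
    · exact ⟨e, h, Or.inr h'⟩
  · rintro ⟨e, h, h' | h'⟩
    · exact Or.inl ⟨e, h, h'⟩
    · exact Or.inr ⟨e, h, h'⟩

theorem inE_onV (i : Emb A C) (v : A.V) : C.inE (i.onV v) = i.onE '' A.inE v := by
  ext f
  simp only [inE, Set.mem_ofPred_eq, i.tgt_iff, Set.mem_image]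
  exact ⟨fun ⟨e, h, h'⟩ => ⟨e, h', h.symm⟩, fun ⟨e, h, h'⟩ => ⟨e, h'.symm, h⟩⟩

theorem outE_onV (i : Emb A C) (v : A.V) : C.outE (i.onV v) = i.onE '' A.outE v := by
  ext f
  simp only [outE, Set.mem_ofPred_eq, i.src_iff, Set.mem_image]
  exact ⟨fun ⟨e, h, h'⟩ => ⟨e, h', h.symm⟩, fun ⟨e, h, h'⟩ => ⟨e, h'.symm, h⟩⟩

/-- The identity embedding. -/
def refl (A : TropicalCover) : Emb A A where
  onV := id
  onE := id
  injV := Function.injective_id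
  injE := Function.injective_id
  weight_eq _ := rfl
  pos_eq _ := rfl
  src_iff f v := by simp
  tgt_iff f v := by simp
  full v _ := ⟨v, rfl⟩

/-- The composite of two embeddings. -/
def trans (i : Emb A B) (j : Emb B C) : Emb A C where
  onV := j.onV ∘ i.onV
  onE := j.onE ∘ i.onE
  injV := j.injV.comp i.injV
  injE := j.injE.comp i.injE
  weight_eq e := (j.weight_eq _).trans (i.weight_eq e)
  pos_eq e := (j.pos_eq _).trans (i.pos_eq e)
  src_iff f v := by
    simp only [Function.comp, j.src_iff, i.src_iff]
    constructor
    · rintro ⟨_, h, e, rfl, h'⟩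
      exact ⟨e, h, h'⟩
    · rintro ⟨e, h, h'⟩
      exact ⟨_, h, e, rfl, h'⟩
  tgt_iff f v := by
    simp only [Function.comp, j.tgt_iff, i.tgt_iff]
    constructor
    · rintro ⟨_, h, e, rfl, h'⟩
      exact ⟨e, h, h'⟩
    · rintro ⟨e, h, h'⟩
      exact ⟨_, h, e, rfl, h'⟩
  full v h := by
    obtain ⟨w, rfl⟩ := j.full v (by
      obtain ⟨a, ha⟩ := h
      exact ⟨i.onV a, (i.pos_eq a).trans ha⟩)
    rw [j.pos_eq] at h
    obtain ⟨a, rfl⟩ := i.full w h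
    exact ⟨a, rfl⟩

/-- This is where `full` is used: the isomorphism preserves the image on the line, and over the
points of `B` there are no vertices of `D` besides those of `B`. -/
theorem exists_onV_of_iso (i : Emb A C) (j : Emb B D) (f : Iso C D)
    (h : Set.range A.pos ⊆ Set.range B.pos) (v : A.V) : ∃ w, j.onV w = f.onV (i.onV v) := by
  refine j.full _ (h ⟨v, ?_⟩)
  rw [f.pos_eq, i.pos_eq]

/-- Every edge has an inner vertex, and the star of an embedded vertex consists of embedded edges,
so the edges follow the vertices. -/
theorem exists_onE_of_iso (i : Emb A C) (j : Emb B D) (f : Iso C D)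
    (h : Set.range A.pos ⊆ Set.range B.pos) (e : A.E) : ∃ e', j.onE e' = f.onE (i.onE e) := by
  rcases A.incident e with h' | h'
  · obtain ⟨u, hu⟩ := Option.ne_none_iff_exists'.1 h'
    obtain ⟨w, hw⟩ := exists_onV_of_iso i j f h u
    obtain ⟨e', he', -⟩ := (j.src_iff (f.onE (i.onE e)) w).1
      (by rw [f.src_eq, i.src_onE.2 hu, hw]; rfl)
    exact ⟨e', he'.symm⟩
  · obtain ⟨u, hu⟩ := Option.ne_none_iff_exists'.1 h'
    obtain ⟨w, hw⟩ := exists_onV_of_iso i j f h u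
    obtain ⟨e', he', -⟩ := (j.tgt_iff (f.onE (i.onE e)) w).1
      (by rw [f.tgt_eq, i.tgt_onE.2 hu, hw]; rfl)
    exact ⟨e', he'.symm⟩

/-- An isomorphism restricts to embedded covers over the same points. -/
theorem nonempty_iso (i : Emb A C) (j : Emb B D) (f : Iso C D)
    (h : Set.range A.pos = Set.range B.pos) : Nonempty (Iso A B) := by
  choose φ hφ using exists_onV_of_iso i j f h.subset
  choose ψ hψ using exists_onV_of_iso j i f.symm h.superset
  choose φ' hφ' using exists_onE_of_iso i j f h.subset
  choose ψ' hψ' using exists_onE_of_iso j i f.symm h.superset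
  have e1 : ∀ v, f.symm.onV (f.onV v) = v := fun v => f.onV.symm_apply_apply v
  have e2 : ∀ v, f.onV (f.symm.onV v) = v := fun v => f.onV.apply_symm_apply v
  have e3 : ∀ v, f.symm.onE (f.onE v) = v := fun v => f.onE.symm_apply_apply v
  have e4 : ∀ v, f.onE (f.symm.onE v) = v := fun v => f.onE.apply_symm_apply v
  -- Restricting the isomorphism and its inverse gives maps in both directions; they are inverse to
  -- each other because the embeddings are injective.
  have hl : ∀ v, ψ (φ v) = v := fun v => i.injV (by rw [hψ, hφ, e1])
  have hr : ∀ v, φ (ψ v) = v := fun v => j.injV (by rw [hφ, hψ, e2])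
  have hl' : ∀ v, ψ' (φ' v) = v := fun v => i.injE (by rw [hψ', hφ', e3])
  have hr' : ∀ v, φ' (ψ' v) = v := fun v => j.injE (by rw [hφ', hψ', e4])
  have key : ∀ e v, A.src e = some v ↔ B.src (φ' e) = some (φ v) := by
    intro e v
    rw [← i.src_onE, ← j.src_onE, hφ, hφ', f.src_eq]
    cases C.src (i.onE e) <;> simp
  have key' : ∀ e v, A.tgt e = some v ↔ B.tgt (φ' e) = some (φ v) := by
    intro e v
    rw [← i.tgt_onE, ← j.tgt_onE, hφ, hφ', f.tgt_eq]
    cases C.tgt (i.onE e) <;> simp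
  refine ⟨⟨⟨φ, ψ, hl, hr⟩, ⟨φ', ψ', hl', hr'⟩, fun e => ?_, fun e => ?_, fun e => ?_, fun v => ?_⟩⟩
  · ext w
    rw [← hr w]
    simp only [Equiv.coe_fn_mk, Option.map_eq_some_iff]
    rw [← key]
    exact ⟨fun h => ⟨_, h, rfl⟩, fun ⟨a, h, h'⟩ => by
      rw [← hl (ψ w), ← h', hl]; exact h⟩
  · ext w
    rw [← hr w]
    simp only [Equiv.coe_fn_mk, Option.map_eq_some_iff]
    rw [← key']
    exact ⟨fun h => ⟨_, h, rfl⟩, fun ⟨a, h, h'⟩ => by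
      rw [← hl (ψ w), ← h', hl]; exact h⟩
  · rw [Equiv.coe_fn_mk, ← j.weight_eq, hφ', f.weight_eq, i.weight_eq]
  · rw [Equiv.coe_fn_mk, ← j.pos_eq, hφ, f.pos_eq, i.pos_eq]

end Emb

/-! ### Gluing two covers along an end -/

/-- The data of a right end of `A` and a left end of `B` that can be glued. -/
structure Gluing (A B : TropicalCover) where
  l : A.E
  r : B.E
  tgt_l : A.tgt l = none
  src_r : B.src r = none
  weight_eq : A.weight l = B.weight r
  lt : ∀ u v, A.src l = some u → B.tgt r = some v → A.pos u < B.pos v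
  disjoint : Disjoint (Set.range A.pos) (Set.range B.pos)

namespace Gluing

variable {A B : TropicalCover} (G : Gluing A B)

theorem exists_src : ∃ u, A.src G.l = some u :=
  Option.ne_none_iff_exists'.1 ((A.incident G.l).resolve_right (by simp [G.tgt_l]))

theorem exists_tgt : ∃ u, B.tgt G.r = some u :=
  Option.ne_none_iff_exists'.1 ((B.incident G.r).resolve_left (by simp [G.src_r]))

/-- Edges of the glued cover. -/
abbrev GE : Type := A.E ⊕ {e : B.E // e ≠ G.r}

/-- Starting points of the edges of the glued cover. -/
def gsrc : G.GE → Option (A.V ⊕ B.V) :=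
  Sum.elim (fun e => (A.src e).map Sum.inl) (fun e => (B.src e).map Sum.inr)

open Classical in
/-- End points of the edges of the glued cover. -/
noncomputable def gtgt : G.GE → Option (A.V ⊕ B.V) :=
  Sum.elim (fun e => if e = G.l then (B.tgt G.r).map Sum.inr else (A.tgt e).map Sum.inl)
    (fun e => (B.tgt e).map Sum.inr)

/-- The weights of the edges of the glued cover. -/
def gweight : G.GE → ℕ := Sum.elim A.weight (fun e => B.weight e)

open Classical in
/-- The inclusion of the edges of the second cover. -/
noncomputable def inr (e : B.E) : G.GE := if h : e = G.r then Sum.inl G.l else Sum.inr ⟨e, h⟩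

theorem inr_r : G.inr G.r = Sum.inl G.l := by simp [inr]

theorem inr_of_ne {e : B.E} (h : e ≠ G.r) : G.inr e = Sum.inr ⟨e, h⟩ := by simp [inr, h]

theorem inr_injective : Function.Injective G.inr := by
  intro e f h
  by_cases he : e = G.r <;> by_cases hf : f = G.r
  · rw [he, hf]
  · rw [he, inr_r, inr_of_ne _ hf] at h; cases h
  · rw [hf, inr_r, inr_of_ne _ he] at h; cases h
  · rw [inr_of_ne _ hf, inr_of_ne _ he] at h
    exact congrArg Subtype.val (Sum.inr.inj h)

/-- The glued edge is the only edge that the two covers share; it is stored as the edge `l` of the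
first cover. -/
theorem inr_eq_inl {e : B.E} {f : A.E} : G.inr e = Sum.inl f ↔ e = G.r ∧ f = G.l := by
  by_cases he : e = G.r
  · rw [he, inr_r]
    simp [eq_comm]
  · rw [inr_of_ne _ he]
    simp [he]

theorem gweight_inr (e : B.E) : G.gweight (G.inr e) = B.weight e := by
  by_cases he : e = G.r
  · rw [he, inr_r]; exact G.weight_eq
  · rw [inr_of_ne _ he]; rfl

theorem exists_edge (e : G.GE) : (∃ a, e = Sum.inl a) ∨ ∃ b, b ≠ G.r ∧ e = G.inr b := by
  rcases e with a | ⟨b, hb⟩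
  · exact Or.inl ⟨a, rfl⟩
  · exact Or.inr ⟨b, hb, (G.inr_of_ne hb).symm⟩

theorem gsrc_inl (a : A.E) : G.gsrc (Sum.inl a) = (A.src a).map Sum.inl := rfl

theorem gsrc_inr {b : B.E} (h : b ≠ G.r) : G.gsrc (G.inr b) = (B.src b).map Sum.inr := by
  rw [inr_of_ne _ h]; rfl

theorem gtgt_inl {a : A.E} (h : a ≠ G.l) : G.gtgt (Sum.inl a) = (A.tgt a).map Sum.inl := by
  simp [gtgt, h]

theorem gtgt_l : G.gtgt (Sum.inl G.l) = (B.tgt G.r).map Sum.inr := by simp [gtgt]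

theorem gtgt_inr (b : B.E) : G.gtgt (G.inr b) = (B.tgt b).map Sum.inr := by
  by_cases h : b = G.r
  · rw [h, inr_r, gtgt_l]
  · rw [inr_of_ne _ h]; rfl

theorem gsrc_eq_inl {e : G.GE} {v : A.V} :
    G.gsrc e = some (Sum.inl v) ↔ ∃ a, e = Sum.inl a ∧ A.src a = some v := by
  rcases G.exists_edge e with ⟨a, rfl⟩ | ⟨b, hb, rfl⟩
  · simp [gsrc_inl]
  · rw [gsrc_inr _ hb]
    constructor
    · intro h; simp at h
    · rintro ⟨a, h, -⟩
      exact absurd (G.inr_eq_inl.1 h).1 hb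

theorem gtgt_eq_inl {e : G.GE} {v : A.V} :
    G.gtgt e = some (Sum.inl v) ↔ ∃ a, e = Sum.inl a ∧ A.tgt a = some v := by
  rcases G.exists_edge e with ⟨a, rfl⟩ | ⟨b, hb, rfl⟩
  · by_cases h : a = G.l
    · subst h
      rw [gtgt_l]
      simp [G.tgt_l]
    · simp [gtgt_inl _ h]
  · rw [gtgt_inr]
    constructor
    · intro h; simp at h
    · rintro ⟨a, h, -⟩
      exact absurd (G.inr_eq_inl.1 h).1 hb

theorem gsrc_eq_inr {e : G.GE} {v : B.V} :
    G.gsrc e = some (Sum.inr v) ↔ ∃ b, e = G.inr b ∧ B.src b = some v := by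
  rcases G.exists_edge e with ⟨a, rfl⟩ | ⟨b, hb, rfl⟩
  · rw [gsrc_inl]
    constructor
    · intro h; simp at h
    · rintro ⟨b, h, h'⟩
      rw [(G.inr_eq_inl.1 h.symm).1, G.src_r] at h'
      cases h'
  · rw [gsrc_inr _ hb]
    simp [G.inr_injective.eq_iff]

theorem gtgt_eq_inr {e : G.GE} {v : B.V} :
    G.gtgt e = some (Sum.inr v) ↔ ∃ b, e = G.inr b ∧ B.tgt b = some v := by
  rcases G.exists_edge e with ⟨a, rfl⟩ | ⟨b, hb, rfl⟩
  · by_cases h : a = G.l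
    · subst h
      rw [gtgt_l, ← G.inr_r]
      simp [G.inr_injective.eq_iff]
    · rw [gtgt_inl _ h]
      constructor
      · intro h; simp at h
      · rintro ⟨b, h', -⟩
        exact absurd (G.inr_eq_inl.1 h'.symm).2 h
  · rw [gtgt_inr]
    simp [G.inr_injective.eq_iff]

open Classical in
/-- The glued cover. -/
noncomputable def join : TropicalCover :=
  ofNet (A.V ⊕ B.V) G.GE G.gsrc G.gtgt G.gweight (Sum.elim A.pos B.pos)
    (A.nonempty.map Sum.inl)
    (by
      intro e
      rcases G.exists_edge e with ⟨a, rfl⟩ | ⟨b, hb, rfl⟩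
      · by_cases h : a = G.l
        · subst h
          obtain ⟨u, hu⟩ := G.exists_tgt
          right
          rw [gtgt_l, hu]; simp
        · rw [gsrc_inl, gtgt_inl _ h]
          simpa using A.incident a
      · rw [gsrc_inr _ hb, gtgt_inr]
        simpa using B.incident b)
    (by
      set R : A.V ⊕ B.V → A.V ⊕ B.V → Prop := fun a b => ∃ e,
        (G.gsrc e = some a ∧ G.gtgt e = some b) ∨ (G.gsrc e = some b ∧ G.gtgt e = some a)
        with hR
      have hsymm : ∀ a b, R a b → R b a := fun a b ⟨e, h⟩ => ⟨e, h.symm⟩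
      have hA : ∀ u v, Relation.ReflTransGen R (Sum.inl u) (Sum.inl v) := by
        intro u v
        refine Relation.ReflTransGen.lift (p := R) Sum.inl ?_ _ _ (A.connected u v)
        rintro a b ⟨e, h | h⟩
        · exact ⟨Sum.inl e, Or.inl ⟨G.gsrc_eq_inl.2 ⟨e, rfl, h.1⟩, G.gtgt_eq_inl.2 ⟨e, rfl, h.2⟩⟩⟩
        · exact ⟨Sum.inl e, Or.inr ⟨G.gsrc_eq_inl.2 ⟨e, rfl, h.1⟩, G.gtgt_eq_inl.2 ⟨e, rfl, h.2⟩⟩⟩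
      have hB : ∀ u v, Relation.ReflTransGen R (Sum.inr u) (Sum.inr v) := by
        intro u v
        refine Relation.ReflTransGen.lift (p := R) Sum.inr ?_ _ _ (B.connected u v)
        rintro a b ⟨e, h | h⟩
        · exact ⟨G.inr e, Or.inl ⟨G.gsrc_eq_inr.2 ⟨e, rfl, h.1⟩, G.gtgt_eq_inr.2 ⟨e, rfl, h.2⟩⟩⟩
        · exact ⟨G.inr e, Or.inr ⟨G.gsrc_eq_inr.2 ⟨e, rfl, h.1⟩, G.gtgt_eq_inr.2 ⟨e, rfl, h.2⟩⟩⟩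
      obtain ⟨p, hp⟩ := G.exists_src
      obtain ⟨q, hq⟩ := G.exists_tgt
      have hpq : R (Sum.inl p) (Sum.inr q) :=
        ⟨Sum.inl G.l, Or.inl ⟨G.gsrc_eq_inl.2 ⟨_, rfl, hp⟩,
          G.gtgt_eq_inr.2 ⟨G.r, G.inr_r.symm, hq⟩⟩⟩
      rintro (u | u) (v | v)
      · exact hA u v
      · exact ((hA u p).tail hpq).trans (hB q v)
      · exact ((hB u q).tail (hsymm _ _ hpq)).trans (hA p v)
      · exact hB u v)
    (by
      rintro (v | v)
      · rw [show {e | G.gtgt e = some (Sum.inl v)} = Sum.inl '' {e | A.tgt e = some v} by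
          ext e; rw [Set.mem_ofPred_eq, gtgt_eq_inl]; simp [eq_comm, and_comm],
          show {e | G.gsrc e = some (Sum.inl v)} = Sum.inl '' {e | A.src e = some v} by
          ext e; rw [Set.mem_ofPred_eq, gsrc_eq_inl]; simp [eq_comm, and_comm],
          Set.ncard_image_of_injective _ Sum.inl_injective,
          Set.ncard_image_of_injective _ Sum.inl_injective]
        exact A.trivalent v
      · rw [show {e | G.gtgt e = some (Sum.inr v)} = G.inr '' {e | B.tgt e = some v} by
          ext e; rw [Set.mem_ofPred_eq, gtgt_eq_inr]; simp [eq_comm, and_comm],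
          show {e | G.gsrc e = some (Sum.inr v)} = G.inr '' {e | B.src e = some v} by
          ext e; rw [Set.mem_ofPred_eq, gsrc_eq_inr]; simp [eq_comm, and_comm],
          Set.ncard_image_of_injective _ G.inr_injective,
          Set.ncard_image_of_injective _ G.inr_injective]
        exact B.trivalent v)
    (by
      rintro (e | e)
      · exact A.weight_pos e
      · exact B.weight_pos e)
    (by
      rintro e (u | u) (v | v) hu hv
      · obtain ⟨a, rfl, ha⟩ := G.gsrc_eq_inl.1 hu
        obtain ⟨a', h, ha'⟩ := G.gtgt_eq_inl.1 hv
        cases Sum.inl.inj h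
        exact A.pos_lt ha ha'
      · obtain ⟨a, rfl, ha⟩ := G.gsrc_eq_inl.1 hu
        obtain ⟨b, h, hb⟩ := G.gtgt_eq_inr.1 hv
        obtain ⟨rfl, rfl⟩ := G.inr_eq_inl.1 h.symm
        exact G.lt u v ha hb
      · obtain ⟨b, rfl, hb⟩ := G.gsrc_eq_inr.1 hu
        obtain ⟨a, h, ha⟩ := G.gtgt_eq_inl.1 hv
        obtain ⟨rfl, rfl⟩ := G.inr_eq_inl.1 h
        rw [G.src_r] at hb; cases hb
      · obtain ⟨b, rfl, hb⟩ := G.gsrc_eq_inr.1 hu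
        obtain ⟨a, h, ha⟩ := G.gtgt_eq_inr.1 hv
        cases G.inr_injective h
        exact B.pos_lt hb ha)
    (by
      rintro (v | v)
      · have h1 : ∑ e with G.gtgt e = some (Sum.inl v), G.gweight e =
            ∑ e with A.tgt e = some v, A.weight e := by
          symm
          refine Finset.sum_nbij Sum.inl ?_ Sum.inl_injective.injOn ?_ (fun _ _ => rfl)
          · intro a ha; simpa [gtgt_eq_inl] using ha
          · intro e he
            obtain ⟨a, rfl, ha⟩ := G.gtgt_eq_inl.1 (by simpa using he)
            exact ⟨a, by simpa using ha, rfl⟩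
        have h2 : ∑ e with G.gsrc e = some (Sum.inl v), G.gweight e =
            ∑ e with A.src e = some v, A.weight e := by
          symm
          refine Finset.sum_nbij Sum.inl ?_ Sum.inl_injective.injOn ?_ (fun _ _ => rfl)
          · intro a ha; simpa [gsrc_eq_inl] using ha
          · intro e he
            obtain ⟨a, rfl, ha⟩ := G.gsrc_eq_inl.1 (by simpa using he)
            exact ⟨a, by simpa using ha, rfl⟩
        have h3 := h1.trans ((A.balanced v).trans h2.symm)
        convert h3
      · have h1 : ∑ e with G.gtgt e = some (Sum.inr v), G.gweight e =
            ∑ e with B.tgt e = some v, B.weight e := by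
          symm
          refine Finset.sum_nbij G.inr ?_ G.inr_injective.injOn ?_
            (fun e _ => (G.gweight_inr e).symm)
          · intro a ha
            simpa [gtgt_eq_inr, G.inr_injective.eq_iff] using ha
          · intro e he
            obtain ⟨a, rfl, ha⟩ := G.gtgt_eq_inr.1 (by simpa using he)
            exact ⟨a, by simpa using ha, rfl⟩
        have h2 : ∑ e with G.gsrc e = some (Sum.inr v), G.gweight e =
            ∑ e with B.src e = some v, B.weight e := by
          symm
          refine Finset.sum_nbij G.inr ?_ G.inr_injective.injOn ?_
            (fun e _ => (G.gweight_inr e).symm)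
          · intro a ha
            simpa [gsrc_eq_inr, G.inr_injective.eq_iff] using ha
          · intro e he
            obtain ⟨a, rfl, ha⟩ := G.gsrc_eq_inr.1 (by simpa using he)
            exact ⟨a, by simpa using ha, rfl⟩
        have h3 := h1.trans ((B.balanced v).trans h2.symm)
        convert h3)

/-- The embedding of the first cover. -/
noncomputable def embl : Emb A G.join where
  onV := Sum.inl
  onE := Sum.inl
  injV := Sum.inl_injective
  injE := Sum.inl_injective
  weight_eq _ := rfl
  pos_eq _ := rfl
  src_iff f v := G.gsrc_eq_inl
  tgt_iff f v := G.gtgt_eq_inl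
  -- A vertex of the other cover cannot lie over these points, since the two images are disjoint.
  full v h := by
    rcases v with v | v
    · exact ⟨v, rfl⟩
    · exact (Set.disjoint_left.1 G.disjoint h ⟨v, rfl⟩).elim

/-- The embedding of the second cover. -/
noncomputable def embr : Emb B G.join where
  onV := Sum.inr
  onE := G.inr
  injV := Sum.inr_injective
  injE := G.inr_injective
  weight_eq := G.gweight_inr
  pos_eq _ := rfl
  src_iff f v := G.gsrc_eq_inr
  tgt_iff f v := G.gtgt_eq_inr
  full v h := by
    rcases v with v | v
    · exact (Set.disjoint_left.1 G.disjoint ⟨v, rfl⟩ h).elim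
    · exact ⟨v, rfl⟩

end Gluing

end TropicalCover

/-! ### Subsets of the branch points -/

namespace BranchDistribution

variable {s t : ℕ} (z : BranchDistribution s t)

/-- The points in the pairs of `I` and the single points of `J`. -/
def points (I : Set (Fin s)) (J : Set (Fin t)) : Set ℝ :=
  {r | ∃ i ∈ I, r = (z.x i).1 ∨ r = (z.x i).2} ∪ z.y '' J

theorem points_union (I I' : Set (Fin s)) (J J' : Set (Fin t)) :
    z.points (I ∪ I') (J ∪ J') = z.points I J ∪ z.points I' J' := by
  ext r
  simp only [points, Set.image_union, Set.mem_union, Set.mem_ofPred_eq]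
  constructor
  · rintro (⟨i, hi | hi, h⟩ | h | h)
    · exact Or.inl (Or.inl ⟨i, hi, h⟩)
    · exact Or.inr (Or.inl ⟨i, hi, h⟩)
    · exact Or.inl (Or.inr h)
    · exact Or.inr (Or.inr h)
  · rintro ((⟨i, hi, h⟩ | h) | (⟨i, hi, h⟩ | h))
    · exact Or.inl ⟨i, Or.inl hi, h⟩
    · exact Or.inr (Or.inl h)
    · exact Or.inl ⟨i, Or.inr hi, h⟩
    · exact Or.inr (Or.inr h)

theorem points_univ : z.points Set.univ Set.univ = z.xPoints ∪ z.yPoints := by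
  simp [points, xPoints, yPoints]

/-- The closed intervals spanned by the pairs are disjoint. -/
theorem x_index_unique {i j : Fin s} {r q : ℝ} (hr : (z.x i).1 ≤ r ∧ r ≤ (z.x i).2)
    (hq : (z.x j).1 ≤ q ∧ q ≤ (z.x j).2) (h : r = q) : i = j := by
  rcases lt_trichotomy i j with hij | hij | hij
  · have := z.x_mono i j hij
    linarith [hr.2, hq.1]
  · exact hij
  · have := z.x_mono j i hij
    linarith [hr.1, hq.2]

theorem mem_pair {i : Fin s} {r : ℝ} (h : r = (z.x i).1 ∨ r = (z.x i).2) :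
    (z.x i).1 ≤ r ∧ r ≤ (z.x i).2 := by
  have := (z.x_lt i).le
  rcases h with rfl | rfl
  · exact ⟨le_rfl, this⟩
  · exact ⟨this, le_rfl⟩

theorem mem_of_mem_points {i : Fin s} {r : ℝ} {I : Set (Fin s)} {J : Set (Fin t)}
    (h : r = (z.x i).1 ∨ r = (z.x i).2) (hr : r ∈ z.points I J) : i ∈ I := by
  rcases hr with ⟨j, hj, h'⟩ | ⟨j, -, rfl⟩
  · rwa [z.x_index_unique (z.mem_pair h) (z.mem_pair h') rfl]
  · exact absurd (z.mem_pair h) (z.sep i j)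

end BranchDistribution

/-! ### Multisets of ends, and transport of structure along embeddings -/

namespace TropicalCover

open Classical in
/-- The multiset of weights of the left ends. -/
noncomputable def leftEnds (C : TropicalCover) : Multiset ℕ :=
  ∑ e, if C.src e = none then {C.weight e} else 0

open Classical in
/-- The multiset of weights of the right ends. -/
noncomputable def rightEnds (C : TropicalCover) : Multiset ℕ :=
  ∑ e, if C.tgt e = none then {C.weight e} else 0

/-- Links the filtered multisets in `HasType` with sums over all edges. The sums are convenient for
gluing because they decompose over a disjoint union of edge sets. -/
theorem sum_ite_singleton {α : Type*} [Fintype α] (p : α → Prop) [DecidablePred p] (w : α → ℕ) :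
    (∑ e, if p e then ({w e} : Multiset ℕ) else 0) = (Finset.univ.filter p).val.map w := by
  rw [← Finset.sum_filter]
  change (Multiset.map (fun e => {w e}) _).sum = _
  rw [show (fun e => ({w e} : Multiset ℕ)) = (fun k => {k}) ∘ w from rfl, ← Multiset.map_map,
    Multiset.sum_map_singleton]

/-- The local pictures over a pair of points. -/
def PairPattern (C : TropicalCover) (u v : C.V) : Prop :=
  C.PairJoin u v ∨ C.PairSplit u v ∨ (∃ a c f b d, C.PairExchange u v a c f b d) ∨ C.PairCycle u v

/-- All ends other than `x` remain ends. -/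
structure Emb.Keeps {A C : TropicalCover} (i : Emb A C) (x : A.E) : Prop where
  src : ∀ e, e ≠ x → A.src e = none → C.src (i.onE e) = none
  tgt : ∀ e, e ≠ x → A.tgt e = none → C.tgt (i.onE e) = none

theorem Joined.symm {C : TropicalCover} {K : Set C.E} {u v : C.V} (h : C.Joined K u v) :
    C.Joined K v u := by
  have : Std.Symm fun a b => ∃ e ∈ K, C.Touches e a ∧ C.Touches e b :=
    ⟨fun a b ⟨e, he, h1, h2⟩ => ⟨e, he, h2, h1⟩⟩
  exact (Relation.ReflTransGen.stdSymm (r := fun a b => ∃ e ∈ K, C.Touches e a ∧ C.Touches e b)).symm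
    _ _ h

namespace Emb

variable {A C : TropicalCover} (i : Emb A C) {x : A.E} {s t : ℕ} (z : BranchDistribution s t)

theorem Keeps.src_eq {i : Emb A C} (h : i.Keeps x) {e : A.E} (he : e ≠ x) :
    C.src (i.onE e) = (A.src e).map i.onV := by
  rcases hs : A.src e with _ | u
  · exact h.src e he hs
  · exact i.src_onE.2 hs

theorem Keeps.tgt_eq {i : Emb A C} (h : i.Keeps x) {e : A.E} (he : e ≠ x) :
    C.tgt (i.onE e) = (A.tgt e).map i.onV := by
  rcases hs : A.tgt e with _ | u
  · exact h.tgt e he hs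
  · exact i.tgt_onE.2 hs

theorem Keeps.parallel {i : Emb A C} (h : i.Keeps x) {a b : A.E} (ha : a ≠ x) (hb : b ≠ x)
    (hab : A.Parallel a b) : C.Parallel (i.onE a) (i.onE b) := by
  refine ⟨fun h' => hab.1 (i.injE h'), ?_, ?_, ?_⟩
  · rw [h.src_eq ha, h.src_eq hb, hab.2.1]
  · rw [h.tgt_eq ha, h.tgt_eq hb, hab.2.2.1]
  · rw [i.weight_eq, i.weight_eq, hab.2.2.2]

theorem src_of_none {e : A.E} (h : C.src (i.onE e) = none) : A.src e = none := by
  by_contra h'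
  obtain ⟨u, hu⟩ := Option.ne_none_iff_exists'.1 h'
  rw [i.src_onE.2 hu] at h
  cases h

theorem tgt_of_none {e : A.E} (h : C.tgt (i.onE e) = none) : A.tgt e = none := by
  by_contra h'
  obtain ⟨u, hu⟩ := Option.ne_none_iff_exists'.1 h'
  rw [i.tgt_onE.2 hu] at h
  cases h

/-- A partner of the image shares with it a vertex of the image of `A`, and the whole star there
comes from `A`. Hence gluing creates no symmetric pair that was not already present. -/
theorem Keeps.exists_parallel {i : Emb A C} (h : i.Keeps x) {a : A.E} (ha : a ≠ x) {f : C.E}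
    (hf : C.Parallel (i.onE a) f) : ∃ b, f = i.onE b ∧ A.Parallel a b := by
  have hs := hf.2.1
  have ht := hf.2.2.1
  rw [h.src_eq ha] at hs
  rw [h.tgt_eq ha] at ht
  obtain ⟨b, rfl⟩ : ∃ b, f = i.onE b := by
    obtain ⟨v, hv | hv⟩ := A.exists_touches a
    · rw [hv] at hs
      obtain ⟨b, hb, -⟩ := (i.src_iff f v).1 hs.symm
      exact ⟨b, hb⟩
    · rw [hv] at ht
      obtain ⟨b, hb, -⟩ := (i.tgt_iff f v).1 ht.symm
      exact ⟨b, hb⟩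
  refine ⟨b, rfl, fun h' => hf.1 (by rw [h']), ?_, ?_, ?_⟩
  · rcases hv : A.src a with _ | v
    · rw [hv] at hs
      exact (i.src_of_none hs.symm).symm
    · rw [hv] at hs
      exact (i.src_onE.1 hs.symm).symm
  · rcases hv : A.tgt a with _ | v
    · rw [hv] at ht
      exact (i.tgt_of_none ht.symm).symm
    · rw [hv] at ht
      exact (i.tgt_onE.1 ht.symm).symm
  · rw [← i.weight_eq, ← i.weight_eq, hf.2.2.2]

theorem isContractible {e : A.E} (h : A.IsContractible z e) : C.IsContractible z (i.onE e) := by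
  obtain ⟨k, u, v, hu, hv, pu, pv⟩ := h
  exact ⟨k, i.onV u, i.onV v, i.src_onE.2 hu, i.tgt_onE.2 hv, by rw [i.pos_eq, pu],
    by rw [i.pos_eq, pv]⟩

theorem joined {K : Set A.E} {K' : Set C.E} (hK : ∀ e ∈ K, i.onE e ∈ K') {u v : A.V}
    (h : A.Joined K u v) : C.Joined K' (i.onV u) (i.onV v) := by
  refine Relation.ReflTransGen.lift (p := fun a b => ∃ e ∈ K', C.Touches e a ∧ C.Touches e b)
    i.onV ?_ _ _ h
  rintro a b ⟨e, he, h1, h2⟩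
  exact ⟨i.onE e, hK e he, i.touches_onE.2 h1, i.touches_onE.2 h2⟩

/-- Stated for abstract near and far endpoints, so that it serves inward and outward tails alike.
The edge `x` must be avoided because it may stop being an end. -/
theorem isTail_map {nA fA : A.E → Option A.V} {nC fC : C.E → Option C.V} {SV : Set A.V}
    {SV' : Set C.V} {r : A.E} {T : Set A.E}
    (hn : ∀ f v, nC f = some (i.onV v) ↔ ∃ e, f = i.onE e ∧ nA e = some v)
    (hf : ∀ f v, fC f = some (i.onV v) ↔ ∃ e, f = i.onE e ∧ fA e = some v)
    (keep : ∀ e, e ≠ x → fA e = none → fC (i.onE e) = none)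
    (par : ∀ a b, a ≠ x → b ≠ x → A.Parallel a b → C.Parallel (i.onE a) (i.onE b))
    (hS : ∀ v, i.onV v ∈ SV' → v ∈ SV) (h : A.IsTail nA fA SV r T) (hx : x ∉ T) :
    C.IsTail nC fC SV' (i.onE r) (i.onE '' T) := by
  have hn' : ∀ v, {e | nC e = some (i.onV v)} = i.onE '' {e | nA e = some v} := by
    intro v; ext f
    simp only [Set.mem_ofPred_eq, hn, Set.mem_image]
    exact ⟨fun ⟨e, h, h'⟩ => ⟨e, h', h.symm⟩, fun ⟨e, h, h'⟩ => ⟨e, h'.symm, h⟩⟩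
  have hf' : ∀ v, {e | fC e = some (i.onV v)} = i.onE '' {e | fA e = some v} := by
    intro v; ext f
    simp only [Set.mem_ofPred_eq, hf, Set.mem_image]
    exact ⟨fun ⟨e, h, h'⟩ => ⟨e, h', h.symm⟩, fun ⟨e, h, h'⟩ => ⟨e, h'.symm, h⟩⟩
  induction h with
  | single r h1 h2 =>
    rw [Set.image_singleton]
    exact IsTail.single _ (keep r (fun h => hx (by simp [h])) h1) (by rwa [i.weight_eq])
  | fork r a b v h1 h2 h3 h4 h5 h6 h7 =>
    rw [Set.image_insert_eq, Set.image_pair]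
    have hxa : a ≠ x := fun h => hx (by simp [h])
    have hxb : b ≠ x := fun h => hx (by simp [h])
    refine IsTail.fork _ _ _ (i.onV v) (fun h => h1 (hS v h)) ((hf _ _).2 ⟨r, rfl, h2⟩) ?_ ?_
      (keep a hxa h5) (keep b hxb h6) (par a b hxa hxb h7)
    · rw [hf', h3, Set.image_singleton]
    · rw [hn', h4, Set.image_pair]
  | cycle r a b r' v u T h1 h2 h3 h4 h5 h6 h7 h8 h9 _ ih =>
    rw [Set.image_union, Set.image_insert_eq, Set.image_pair]
    have hxa : a ≠ x := fun h => hx (by simp [h])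
    have hxb : b ≠ x := fun h => hx (by simp [h])
    refine IsTail.cycle _ _ _ (i.onE r') (i.onV v) (i.onV u) _ (fun h => h1 (hS v h))
      (fun h => h2 (hS u h)) ((hf _ _).2 ⟨r, rfl, h3⟩) ?_ ?_ ?_ ?_ (par a b hxa hxb h8)
      (by rwa [i.weight_eq]) (ih fun h => hx (Or.inr h))
    · rw [hf', h4, Set.image_singleton]
    · rw [hn', h5, Set.image_pair]
    · rw [hf', h6, Set.image_pair]
    · rw [hn', h7, Set.image_singleton]

theorem Keeps.isTailAt {i : Emb A C} (h : i.Keeps x) {SV : Set A.V} {SV' : Set C.V} {T : Set A.E}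
    (hS : ∀ v, i.onV v ∈ SV' ↔ v ∈ SV) (hT : A.IsTailAt SV T) (hx : x ∉ T) :
    C.IsTailAt SV' (i.onE '' T) := by
  have par := fun a b ha hb => h.parallel (a := a) (b := b) ha hb
  obtain ⟨r, v, hv, ⟨h1, h2⟩ | ⟨h1, h2⟩⟩ := hT
  · exact ⟨i.onE r, i.onV v, (hS v).2 hv, Or.inl ⟨i.tgt_onE.2 h1,
      i.isTail_map i.tgt_iff i.src_iff h.src par (fun v => (hS v).1) h2 hx⟩⟩
  · exact ⟨i.onE r, i.onV v, (hS v).2 hv, Or.inr ⟨i.src_onE.2 h1,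
      i.isTail_map i.src_iff i.tgt_iff h.tgt par (fun v => (hS v).1) h2 hx⟩⟩

theorem pairExchange {u v : A.V} {a c f b d : A.E} (h : A.PairExchange u v a c f b d) :
    C.PairExchange (i.onV u) (i.onV v) (i.onE a) (i.onE c) (i.onE f) (i.onE b) (i.onE d) := by
  obtain ⟨h1, h2, h3, h4, h5, h6, h7⟩ := h
  refine ⟨i.injE.ne h1, i.injE.ne h2, i.injE.ne h3, ?_, ?_, ?_, ?_⟩
  · rw [i.inE_onV, h4, Set.image_singleton]
  · rw [i.outE_onV, h5, Set.image_pair]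
  · rw [i.inE_onV, h6, Set.image_pair]
  · rw [i.outE_onV, h7, Set.image_singleton]

/-- The patterns of joining and splitting may use a symmetric fork, which would be destroyed if one
of its ends were glued; this is excluded by the assumption that `x` has no parallel edge. -/
theorem Keeps.pairPattern {i : Emb A C} (h : i.Keeps x) (hx : ∀ f, ¬ A.Parallel x f) {u v : A.V}
    (hp : A.PairPattern u v) : C.PairPattern (i.onV u) (i.onV v) := by
  have par : ∀ a b, A.Parallel a b → C.Parallel (i.onE a) (i.onE b) := fun a b hab =>
    h.parallel (fun h' => hx b (h' ▸ hab)) (fun h' => hx a (h' ▸ hab.symm)) hab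
  rcases hp with ⟨a, b, f, c, d, h1, h2, h3, h4, h5, h6⟩ | ⟨a, b, f, c, d, h1, h2, h3, h4, h5, h6⟩ |
    ⟨a, c, f, b, d, h'⟩ | ⟨a, f, f', d, h1, h2, h3, h4, h5, h6⟩
  · refine Or.inl ⟨_, _, i.onE f, i.onE c, i.onE d, par a b h1, i.injE.ne h2, ?_, ?_, ?_, ?_⟩
    · rw [i.inE_onV, h3, Set.image_pair]
    · rw [i.outE_onV, h4, Set.image_singleton]
    · rw [i.inE_onV, h5, Set.image_pair]
    · rw [i.outE_onV, h6, Set.image_singleton]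
  · refine Or.inr (Or.inl ⟨_, _, i.onE f, i.onE c, i.onE d, par a b h1, i.injE.ne h2, ?_, ?_, ?_,
      ?_⟩)
    · rw [i.inE_onV, h3, Set.image_singleton]
    · rw [i.outE_onV, h4, Set.image_pair]
    · rw [i.inE_onV, h5, Set.image_singleton]
    · rw [i.outE_onV, h6, Set.image_pair]
  · exact Or.inr (Or.inr (Or.inl ⟨_, _, _, _, _, i.pairExchange h'⟩))
  · refine Or.inr (Or.inr (Or.inr ⟨i.onE a, i.onE f, i.onE f', i.onE d, i.injE.ne h1, ?_, ?_, ?_,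
      ?_, by rwa [i.weight_eq]⟩))
    · rw [i.inE_onV, h2, Set.image_singleton]
    · rw [i.outE_onV, h3, Set.image_pair]
    · rw [i.inE_onV, h4, Set.image_pair]
    · rw [i.outE_onV, h5, Set.image_singleton]

/-- Used in contrapositive form: a pair that is not adjacent to a contractible edge in the large
cover is not adjacent to one in the small cover either. -/
theorem adjacentContractible {p : Finset A.E} {p' : Finset C.E} (hp : ∀ e ∈ p, i.onE e ∈ p')
    (h : A.AdjacentContractible z p) : C.AdjacentContractible z p' := by
  obtain ⟨e, he, f, v, hf, h1, h2⟩ := h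
  exact ⟨i.onE e, hp e he, i.onE f, i.onV v, i.isContractible z hf, i.touches_onE.2 h1,
    i.touches_onE.2 h2⟩

open Classical in
/-- A symmetric pair of the big cover with an edge in the small one comes from a symmetric pair of
the small cover. -/
theorem Keeps.exists_sym2 {i : Emb A C} (h : i.Keeps x) {p : Finset C.E} (hp : p ∈ C.Sym2 z)
    {a : A.E} (ha : a ≠ x) (hap : i.onE a ∈ p) (hxp : i.onE x ∉ p) :
    ∃ q ∈ A.Sym2 z, a ∈ q ∧ x ∉ q := by
  obtain ⟨⟨⟨e, f, hef, hpe⟩, hnc⟩, hadj⟩ := hp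
  have key : ∃ g, C.Parallel (i.onE a) g ∧ (p : Set C.E) = {i.onE a, g} := by
    have : i.onE a ∈ (p : Set C.E) := hap
    rw [hpe] at this
    rcases this with h' | h'
    · exact ⟨f, h' ▸ hef, h' ▸ hpe⟩
    · rw [Set.mem_singleton_iff] at h'
      exact ⟨e, h' ▸ hef.symm, by rw [hpe, h', Set.pair_comm]⟩
  obtain ⟨g, hg, hpg⟩ := key
  obtain ⟨b, rfl, hab⟩ := h.exists_parallel ha hg
  have hmem : ∀ y ∈ ({a, b} : Finset A.E), i.onE y ∈ p := by
    intro y hy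
    have : i.onE y ∈ (p : Set C.E) := by
      rw [hpg]
      rw [Finset.mem_insert, Finset.mem_singleton] at hy
      rcases hy with rfl | rfl <;> simp
    exact this
  refine ⟨{a, b}, ⟨⟨⟨a, b, hab, by simp⟩, fun y hy hc => ?_⟩, fun hc => ?_⟩, by simp, fun hx => ?_⟩
  · exact hnc _ (hmem y hy) (i.isContractible z hc)
  · exact hadj (i.adjacentContractible z hmem hc)
  · exact hxp (hmem x hx)

end Emb

/-! ### Partial zigzag covers -/

/-- A zigzag cover over the pairs of `I` and the single points of `J`, with core `(SV, SE)`.  The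
condition on symmetric pairs is only imposed for pairs which do not meet `W`. -/
structure Block {s t : ℕ} (z : BranchDistribution s t) (C : TropicalCover) (W : Set C.E)
    (SV : Set C.V) (SE : Set C.E) (I : Set (Fin s)) (J : Set (Fin t)) (g : ℕ)
    (L R : Multiset ℕ) : Prop where
  genus : C.HasGenus g
  image : Set.range C.pos = z.points I J
  left : C.leftEnds = L
  right : C.rightEnds = R
  resolving : ∀ i ∈ I, ∃ u v, C.pos u = (z.x i).1 ∧ C.pos v = (z.x i).2 ∧ C.PairPattern u v
  subgraph : ∀ e ∈ SE, ∀ v, C.Touches e v → v ∈ SV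
  nonempty : SV.Nonempty
  connected : ∀ u ∈ SV, ∀ v ∈ SV, C.Joined SE u v
  disjoint : ∀ p ∈ C.Sym2 z, (∀ e ∈ p, e ∉ W) → ∀ e ∈ p, e ∉ SE
  contractible : ∀ e, C.IsContractible z e → e ∈ SE
  odd : ∀ e ∈ SE, Even (C.weight e) → C.IsContractible z e
  tails : ∀ e ∉ SE, ∃ T, e ∈ T ∧ C.IsTailAt SV T

/-! ### Balancing at a vertex and parity in tails -/

theorem sum_in_eq_sum_out (C : TropicalCover) {v : C.V} {S T : Finset C.E} (hS : C.inE v = S)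
    (hT : C.outE v = T) : ∑ e ∈ S, C.weight e = ∑ e ∈ T, C.weight e := by
  classical
  have h := C.balanced v
  have h1 : (Finset.univ.filter fun e => C.tgt e = some v) = S := by
    ext e
    have : e ∈ C.inE v ↔ e ∈ (S : Set C.E) := by rw [hS]
    simpa [inE] using this
  have h2 : (Finset.univ.filter fun e => C.src e = some v) = T := by
    ext e
    have : e ∈ C.outE v ↔ e ∈ (T : Set C.E) := by rw [hT]
    simpa [outE] using this
  rw [← h1, ← h2]
  convert h

theorem weight_of_split (C : TropicalCover) {v : C.V} {r a b : C.E} (hab : a ≠ b)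
    (h1 : C.inE v = {r}) (h2 : C.outE v = {a, b}) : C.weight r = C.weight a + C.weight b := by
  classical
  have := C.sum_in_eq_sum_out (S := {r}) (T := {a, b}) (by simpa using h1) (by simpa using h2)
  rwa [Finset.sum_singleton, Finset.sum_pair hab] at this

theorem weight_of_join (C : TropicalCover) {v : C.V} {r a b : C.E} (hab : a ≠ b)
    (h1 : C.outE v = {r}) (h2 : C.inE v = {a, b}) : C.weight r = C.weight a + C.weight b := by
  classical
  have := C.sum_in_eq_sum_out (T := {r}) (S := {a, b}) (by simpa using h2) (by simpa using h1)
  rw [Finset.sum_singleton, Finset.sum_pair hab] at this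
  exact this.symm

theorem even_of_split (C : TropicalCover) (a b r : C.E) (v : C.V) (hab : C.Parallel a b)
    (h1 : {e | C.tgt e = some v} = {r}) (h2 : {e | C.src e = some v} = {a, b}) :
    Even (C.weight r) := by
  rw [C.weight_of_split hab.1 h1 h2, hab.2.2.2]
  exact ⟨_, rfl⟩

theorem even_of_join (C : TropicalCover) (a b r : C.E) (v : C.V) (hab : C.Parallel a b)
    (h1 : {e | C.src e = some v} = {r}) (h2 : {e | C.tgt e = some v} = {a, b}) :
    Even (C.weight r) := by
  rw [C.weight_of_join hab.1 h1 h2, hab.2.2.2]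
  exact ⟨_, rfl⟩

/-- A tail of a single edge is even by definition. Otherwise the root is alone on its side of its
far vertex, opposite two parallel edges, so balancing makes its weight twice theirs. The hypothesis
`hbal` is `even_of_split` or `even_of_join`, according to the direction of the tail. -/
theorem IsTail.even_root {C : TropicalCover} {n f : C.E → Option C.V} {SV : Set C.V} {r : C.E}
    {T : Set C.E} (h : C.IsTail n f SV r T)
    (hbal : ∀ a b r v, C.Parallel a b → {e | f e = some v} = {r} → {e | n e = some v} = {a, b} →
      Even (C.weight r)) : Even (C.weight r) := by
  cases h with
  | single _ h1 h2 => exact h2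
  | fork _ a b v h1 h2 h3 h4 h5 h6 h7 => exact hbal a b r v h7 h3 h4
  | cycle _ a b r' v u T h1 h2 h3 h4 h5 h6 h7 h8 h9 => exact hbal a b r v h8 h4 h5

/-- Odd edges of the core do not occur in tails. -/
theorem IsTail.notMem {C : TropicalCover} {n f : C.E → Option C.V} {SV : Set C.V} {r x : C.E}
    {T : Set C.E} (h : C.IsTail n f SV r T) (hx : ∀ v, n x = some v → v ∈ SV)
    (hodd : Odd (C.weight x))
    (hbal : ∀ a b r v, C.Parallel a b → {e | f e = some v} = {r} → {e | n e = some v} = {a, b} →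
      Even (C.weight r)) : x ∉ T := by
  -- All roots occurring along the tail are even; the remaining edges start at vertices outside the
  -- core. An odd edge whose near vertex lies in the core is neither.
  have hr : ∀ r T, C.IsTail n f SV r T → x ≠ r := by
    rintro r T h rfl
    exact (Nat.not_even_iff_odd.2 hodd) (h.even_root hbal)
  induction h with
  | single r h1 h2 => exact hr r _ (IsTail.single r h1 h2)
  | fork r a b v h1 h2 h3 h4 h5 h6 h7 =>
    have ha : n a = some v := h4.symm.subset (by simp : a ∈ ({a, b} : Set C.E))
    have hb : n b = some v := h4.symm.subset (by simp : b ∈ ({a, b} : Set C.E))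
    rintro (h | rfl | rfl)
    · exact hr r _ (IsTail.fork r a b v h1 h2 h3 h4 h5 h6 h7) h
    · exact h1 (hx v ha)
    · exact h1 (hx v hb)
  | cycle r a b r' v u T h1 h2 h3 h4 h5 h6 h7 h8 h9 h10 ih =>
    have ha : n a = some v := h5.symm.subset (by simp : a ∈ ({a, b} : Set C.E))
    have hb : n b = some v := h5.symm.subset (by simp : b ∈ ({a, b} : Set C.E))
    rintro ((h | rfl | rfl) | h)
    · exact hr r _ (IsTail.cycle r a b r' v u T h1 h2 h3 h4 h5 h6 h7 h8 h9 h10) h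
    · exact h1 (hx v ha)
    · exact h1 (hx v hb)
    · exact ih h

theorem IsTailAt.notMem {C : TropicalCover} {SV : Set C.V} {x : C.E} {T : Set C.E}
    (h : C.IsTailAt SV T) (hx : ∀ v, C.Touches x v → v ∈ SV) (hodd : Odd (C.weight x)) :
    x ∉ T := by
  obtain ⟨r, v, hv, ⟨h1, h2⟩ | ⟨h1, h2⟩⟩ := h
  · exact h2.notMem (fun v h => hx v (Or.inr h)) hodd C.even_of_join
  · exact h2.notMem (fun v h => hx v (Or.inl h)) hodd C.even_of_split

/-! ### Gluing of partial zigzag covers -/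

namespace Gluing

variable {A B : TropicalCover} (G : Gluing A B)

theorem keeps_embl : G.embl.Keeps G.l where
  src e he h := by
    change G.gsrc (Sum.inl e) = none
    rw [G.gsrc_inl, h]; rfl
  tgt e he h := by
    change G.gtgt (Sum.inl e) = none
    rw [G.gtgt_inl he, h]; rfl

theorem keeps_embr : G.embr.Keeps G.r where
  src e he h := by
    change G.gsrc (G.inr e) = none
    rw [G.gsrc_inr he, h]; rfl
  tgt e he h := by
    change G.gtgt (G.inr e) = none
    rw [G.gtgt_inr, h]; rfl

theorem embl_l : G.embl.onE G.l = G.embr.onE G.r := G.inr_r.symm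

theorem embr_eq_embl {b : B.E} {a : A.E} (h : G.embl.onE a = G.embr.onE b) :
    a = G.l ∧ b = G.r := (G.inr_eq_inl.1 h.symm).symm

theorem onV_ne (u : A.V) (v : B.V) : G.embl.onV u ≠ G.embr.onV v := by
  intro h
  cases (h : (Sum.inl u : A.V ⊕ B.V) = Sum.inr v)

theorem exists_vertex (v : G.join.V) : (∃ u, v = G.embl.onV u) ∨ ∃ u, v = G.embr.onV u := by
  rcases v with v | v
  · exact Or.inl ⟨v, rfl⟩
  · exact Or.inr ⟨v, rfl⟩

theorem exists_edge' (e : G.join.E) :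
    (∃ a, a ≠ G.l ∧ e = G.embl.onE a) ∨ (∃ b, b ≠ G.r ∧ e = G.embr.onE b) ∨
      (e = G.embl.onE G.l ∧ e = G.embr.onE G.r) := by
  rcases G.exists_edge e with ⟨a, rfl⟩ | ⟨b, hb, rfl⟩
  · by_cases h : a = G.l
    · subst h
      exact Or.inr (Or.inr ⟨rfl, G.embl_l⟩)
    · exact Or.inl ⟨a, h, rfl⟩
  · exact Or.inr (Or.inl ⟨b, hb, rfl⟩)

/-- The inner edges of the glued cover are those of both parts and the new edge, so the Betti
numbers add up. -/
theorem genus {g g' : ℕ} (hA : A.HasGenus g) (hB : B.HasGenus g') :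
    G.join.HasGenus (g + g') := by
  have hV : Fintype.card G.join.V = Fintype.card A.V + Fintype.card B.V := Fintype.card_sum
  have hE : {e | G.join.IsInner e} = G.embl.onE '' insert G.l {e | A.IsInner e} ∪
      G.embr.onE '' {e | B.IsInner e} := by
    ext e
    simp only [Set.mem_ofPred_eq, Set.mem_union, Set.mem_image, Set.mem_insert_iff]
    constructor
    · intro h
      rcases G.exists_edge' e with ⟨a, ha, rfl⟩ | ⟨b, hb, rfl⟩ | ⟨h1, h2⟩
      · refine Or.inl ⟨a, Or.inr ⟨?_, ?_⟩, rfl⟩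
        · exact fun h' => h.1 (G.keeps_embl.src a ha h')
        · exact fun h' => h.2 (G.keeps_embl.tgt a ha h')
      · refine Or.inr ⟨b, ⟨?_, ?_⟩, rfl⟩
        · exact fun h' => h.1 (G.keeps_embr.src b hb h')
        · exact fun h' => h.2 (G.keeps_embr.tgt b hb h')
      · exact Or.inl ⟨_, Or.inl rfl, h1.symm⟩
    · have hl : ∀ a, A.IsInner a → G.join.IsInner (G.embl.onE a) := fun a ha =>
        ⟨fun h => ha.1 (G.embl.src_of_none h), fun h => ha.2 (G.embl.tgt_of_none h)⟩
      have hr : ∀ a, B.IsInner a → G.join.IsInner (G.embr.onE a) := fun a ha =>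
        ⟨fun h => ha.1 (G.embr.src_of_none h), fun h => ha.2 (G.embr.tgt_of_none h)⟩
      rintro (⟨a, rfl | ha, rfl⟩ | ⟨b, hb, rfl⟩)
      · obtain ⟨u, hu⟩ := G.exists_src
        obtain ⟨v, hv⟩ := G.exists_tgt
        refine ⟨?_, ?_⟩
        · rw [G.embl.src_onE.2 hu]; simp
        · rw [G.embl_l, G.embr.tgt_onE.2 hv]; simp
      · exact hl a ha
      · exact hr b hb
  unfold HasGenus at *
  rw [hE, Set.ncard_union_eq, Set.ncard_image_of_injective _ G.embl.injE,
    Set.ncard_image_of_injective _ G.embr.injE, Set.ncard_insert_of_notMem, hV]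
  · omega
  · exact fun h => h.2 G.tgt_l
  · rw [Set.disjoint_left]
    rintro _ ⟨a, -, rfl⟩ ⟨b, hb, h⟩
    exact hb.1 ((G.embr_eq_embl h.symm).2 ▸ G.src_r)

theorem leftEnds_join {R : Multiset ℕ} (h : B.leftEnds = B.weight G.r ::ₘ R) :
    G.join.leftEnds = A.leftEnds + R := by
  classical
  have h1 : G.join.leftEnds = A.leftEnds +
      ∑ e : {e : B.E // e ≠ G.r}, if B.src e = none then ({B.weight e} : Multiset ℕ) else 0 := by
    unfold leftEnds
    refine (Fintype.sum_sum_type _).trans ?_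
    congr 1
    · refine Finset.sum_congr rfl fun a _ => ?_
      have : G.join.src (Sum.inl a) = none ↔ A.src a = none := by
        change G.gsrc (Sum.inl a) = none ↔ _
        rw [G.gsrc_inl, Option.map_eq_none_iff]
      by_cases h : A.src a = none
      · rw [if_pos h, if_pos (this.2 h)]; rfl
      · rw [if_neg h, if_neg (fun h' => h (this.1 h'))]
    · refine Finset.sum_congr rfl fun b _ => ?_
      have : G.join.src (Sum.inr b) = none ↔ B.src b = none := by
        change G.gsrc (Sum.inr b) = none ↔ _
        exact Option.map_eq_none_iff
      by_cases h : B.src b = none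
      · rw [if_pos h, if_pos (this.2 h)]; rfl
      · rw [if_neg h, if_neg (fun h' => h (this.1 h'))]
  have h2 : B.leftEnds = {B.weight G.r} +
      ∑ e : {e : B.E // e ≠ G.r}, if B.src e = none then ({B.weight e} : Multiset ℕ) else 0 := by
    unfold leftEnds
    rw [Fintype.sum_eq_add_sum_subtype_ne _ G.r]
    congr 1
    · rw [if_pos G.src_r]
  rw [h1]
  rw [h, Multiset.singleton_add] at h2
  rw [(Multiset.cons_inj_right _).1 h2]

theorem rightEnds_join {R : Multiset ℕ} (h : A.rightEnds = A.weight G.l ::ₘ R) :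
    G.join.rightEnds = R + B.rightEnds := by
  classical
  have h2 : A.rightEnds = {A.weight G.l} +
      ∑ e : {e : A.E // e ≠ G.l}, if A.tgt e = none then ({A.weight e} : Multiset ℕ) else 0 := by
    unfold rightEnds
    rw [Fintype.sum_eq_add_sum_subtype_ne _ G.l]
    congr 1
    · rw [if_pos G.tgt_l]
  have h3 : B.rightEnds = (if B.tgt G.r = none then ({B.weight G.r} : Multiset ℕ) else 0) +
      ∑ e : {e : B.E // e ≠ G.r}, if B.tgt e = none then ({B.weight e} : Multiset ℕ) else 0 := by
    unfold rightEnds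
    rw [Fintype.sum_eq_add_sum_subtype_ne _ G.r]
  rw [h, Multiset.singleton_add] at h2
  rw [(Multiset.cons_inj_right _).1 h2, h3]
  obtain ⟨v, hv⟩ := G.exists_tgt
  rw [if_neg (by simp [hv]), zero_add]
  unfold rightEnds
  refine (Fintype.sum_sum_type _).trans ?_
  congr 1
  · rw [Fintype.sum_eq_add_sum_subtype_ne _ G.l]
    have : ¬ G.join.tgt (Sum.inl G.l) = none := by
      change ¬ G.gtgt (Sum.inl G.l) = none
      rw [G.gtgt_l, hv]; simp
    rw [if_neg this, zero_add]
    refine Finset.sum_congr rfl fun a _ => ?_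
    have : G.join.tgt (Sum.inl a) = none ↔ A.tgt a = none := by
      change G.gtgt (Sum.inl a) = none ↔ _
      rw [G.gtgt_inl a.2, Option.map_eq_none_iff]
    by_cases h : A.tgt a = none
    · rw [if_pos h, if_pos (this.2 h)]; rfl
    · rw [if_neg h, if_neg (fun h' => h (this.1 h'))]
  · refine Finset.sum_congr rfl fun b _ => ?_
    have : G.join.tgt (Sum.inr b) = none ↔ B.tgt b = none := by
      change G.gtgt (Sum.inr b) = none ↔ _
      exact Option.map_eq_none_iff
    by_cases h : B.tgt b = none
    · rw [if_pos h, if_pos (this.2 h)]; rfl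
    · rw [if_neg h, if_neg (fun h' => h (this.1 h'))]

end Gluing

/-- Two partial zigzag covers can be glued along odd ends which belong to the cores. -/
theorem Block.join {s t : ℕ} {z : BranchDistribution s t} {A B : TropicalCover} (G : Gluing A B)
    {WA : Set A.E} {WB : Set B.E} {SVA : Set A.V} {SVB : Set B.V} {SEA : Set A.E} {SEB : Set B.E}
    {I I' : Set (Fin s)} {J J' : Set (Fin t)} {g g' : ℕ} {L L' R R' : Multiset ℕ}
    (hA : Block z A WA SVA SEA I J g L (A.weight G.l ::ₘ R))
    (hB : Block z B WB SVB SEB I' J' g' (B.weight G.r ::ₘ L') R')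
    (hWA : WA ⊆ {G.l}) (hWB : WB ⊆ {G.r}) (hl : G.l ∈ SEA) (hr : G.r ∈ SEB)
    (hodd : Odd (A.weight G.l)) (hlp : I = ∅ ∨ ∀ f, ¬ A.Parallel G.l f)
    (hrp : I' = ∅ ∨ ∀ f, ¬ B.Parallel G.r f) (hI : Disjoint I I') :
    Block z G.join ∅ (G.embl.onV '' SVA ∪ G.embr.onV '' SVB)
      (G.embl.onE '' SEA ∪ G.embr.onE '' SEB) (I ∪ I') (J ∪ J') (g + g') (L + L') (R + R') := by
  have memVl : ∀ v, G.embl.onV v ∈ G.embl.onV '' SVA ∪ G.embr.onV '' SVB ↔ v ∈ SVA := by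
    intro v
    rw [Set.mem_union, G.embl.injV.mem_set_image, or_iff_left]
    rintro ⟨w, -, h⟩
    exact G.onV_ne v w h.symm
  have memVr : ∀ v, G.embr.onV v ∈ G.embl.onV '' SVA ∪ G.embr.onV '' SVB ↔ v ∈ SVB := by
    intro v
    rw [Set.mem_union, G.embr.injV.mem_set_image, or_iff_right]
    rintro ⟨w, -, h⟩
    exact G.onV_ne w v h
  have memEl : ∀ a, G.embl.onE a ∈ G.embl.onE '' SEA ∪ G.embr.onE '' SEB ↔ a ∈ SEA := by
    intro a
    rw [Set.mem_union, G.embl.injE.mem_set_image]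
    refine ⟨?_, Or.inl⟩
    rintro (h | ⟨w, -, h⟩)
    · exact h
    · rw [(G.embr_eq_embl h.symm).1]; exact hl
  have memEr : ∀ a, G.embr.onE a ∈ G.embl.onE '' SEA ∪ G.embr.onE '' SEB ↔ a ∈ SEB := by
    intro a
    rw [Set.mem_union, G.embr.injE.mem_set_image]
    refine ⟨?_, Or.inr⟩
    rintro (⟨w, -, h⟩ | h)
    · rw [(G.embr_eq_embl h).2]; exact hr
    · exact h
  have hSl : ∀ v, G.join.Touches (G.embl.onE G.l) v → v ∈ G.embl.onV '' SVA ∪ G.embr.onV '' SVB := by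
    intro v hv
    rcases G.exists_vertex v with ⟨u, rfl⟩ | ⟨u, rfl⟩
    · exact (memVl u).2 (hA.subgraph _ hl _ (G.embl.touches_onE.1 hv))
    · rw [G.embl_l] at hv
      exact (memVr u).2 (hB.subgraph _ hr _ (G.embr.touches_onE.1 hv))
  have hposl : ∀ i u, A.pos u = (z.x i).1 ∨ A.pos u = (z.x i).2 → i ∈ I := fun i u h =>
    z.mem_of_mem_points h (hA.image ▸ Set.mem_range_self u)
  have hposr : ∀ i u, B.pos u = (z.x i).1 ∨ B.pos u = (z.x i).2 → i ∈ I' := fun i u h =>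
    z.mem_of_mem_points h (hB.image ▸ Set.mem_range_self u)
  -- The glued edge is the only one running from the first part to the second, so it has no parallel
  -- edge. A symmetric fork that contained the end before gluing thereby disappears, which is why
  -- pairs meeting `W` are exempted in the parts and the result has `W = ∅`.
  have lnosym : ∀ p ∈ G.join.Sym2 z, G.embl.onE G.l ∉ p := by
    rintro p ⟨⟨⟨e, f, hef, hpe⟩, -⟩, -⟩ hlp
    obtain ⟨u, hu⟩ := G.exists_src
    obtain ⟨v, hv⟩ := G.exists_tgt
    have key : ∀ x, G.join.src x = some (G.embl.onV u) → G.join.tgt x = some (G.embr.onV v) →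
        x = G.embl.onE G.l := by
      intro x h1 h2
      obtain ⟨a, rfl, -⟩ := (G.embl.src_iff _ _).1 h1
      obtain ⟨b, h, -⟩ := (G.embr.tgt_iff _ _).1 h2
      rw [(G.embr_eq_embl h).1]
    have h1 : G.join.src (G.embl.onE G.l) = some (G.embl.onV u) := G.embl.src_onE.2 hu
    have h2 : G.join.tgt (G.embl.onE G.l) = some (G.embr.onV v) := by
      rw [G.embl_l]; exact G.embr.tgt_onE.2 hv
    have : G.embl.onE G.l ∈ (p : Set G.join.E) := hlp
    rw [hpe] at this
    rcases this with h | h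
    · rw [h] at h1 h2
      exact hef.1 ((key e h1 h2).trans (key f (hef.2.1 ▸ h1) (hef.2.2.1 ▸ h2)).symm)
    · rw [Set.mem_singleton_iff] at h
      rw [h] at h1 h2
      exact hef.1 ((key e (hef.2.1 ▸ h1) (hef.2.2.1 ▸ h2)).trans (key f h1 h2).symm)
  refine ⟨G.genus hA.genus hB.genus, ?_, ?_, ?_, ?_, ?_, ?_, ?_, ?_, ?_, ?_, ?_⟩
  · rw [z.points_union, ← hA.image, ← hB.image]
    exact Set.Sum.elim_range _ _
  · rw [G.leftEnds_join hB.left, hA.left]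
  · rw [G.rightEnds_join hA.right, hB.right]
  · rintro i (hi | hi)
    · obtain ⟨u, v, hu, hv, h⟩ := hA.resolving i hi
      refine ⟨G.embl.onV u, G.embl.onV v, hu, hv, G.keeps_embl.pairPattern ?_ h⟩
      exact hlp.resolve_left (Set.nonempty_of_mem hi).ne_empty
    · obtain ⟨u, v, hu, hv, h⟩ := hB.resolving i hi
      refine ⟨G.embr.onV u, G.embr.onV v, hu, hv, G.keeps_embr.pairPattern ?_ h⟩
      exact hrp.resolve_left (Set.nonempty_of_mem hi).ne_empty
  · intro e he v hv
    rcases G.exists_edge' e with ⟨a, ha, rfl⟩ | ⟨b, hb, rfl⟩ | ⟨rfl, -⟩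
    · rcases G.exists_vertex v with ⟨u, rfl⟩ | ⟨u, rfl⟩
      · exact (memVl u).2 (hA.subgraph _ ((memEl a).1 he) _ (G.embl.touches_onE.1 hv))
      · obtain ⟨b, h, -⟩ := G.embr.touches_iff.1 hv
        exact absurd (G.embr_eq_embl h).1 ha
    · rcases G.exists_vertex v with ⟨u, rfl⟩ | ⟨u, rfl⟩
      · obtain ⟨a, h, -⟩ := G.embl.touches_iff.1 hv
        exact absurd (G.embr_eq_embl h.symm).2 hb
      · exact (memVr u).2 (hB.subgraph _ ((memEr b).1 he) _ (G.embr.touches_onE.1 hv))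
    · exact hSl v hv
  · obtain ⟨v, hv⟩ := hA.nonempty
    exact ⟨_, (memVl v).2 hv⟩
  · obtain ⟨p, hp⟩ := G.exists_src
    obtain ⟨q, hq⟩ := G.exists_tgt
    have hpS := hA.subgraph _ hl p (Or.inl hp)
    have hqS := hB.subgraph _ hr q (Or.inr hq)
    have hpq : G.join.Joined (G.embl.onE '' SEA ∪ G.embr.onE '' SEB) (G.embl.onV p)
        (G.embr.onV q) := by
      refine Relation.ReflTransGen.single ⟨G.embl.onE G.l, (memEl _).2 hl, Or.inl
        (G.embl.src_onE.2 hp), Or.inr ?_⟩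
      rw [G.embl_l]; exact G.embr.tgt_onE.2 hq
    have hAA : ∀ u ∈ SVA, ∀ v ∈ SVA, G.join.Joined (G.embl.onE '' SEA ∪ G.embr.onE '' SEB)
        (G.embl.onV u) (G.embl.onV v) := fun u hu v hv =>
      G.embl.joined (fun e he => (memEl e).2 he) (hA.connected u hu v hv)
    have hBB : ∀ u ∈ SVB, ∀ v ∈ SVB, G.join.Joined (G.embl.onE '' SEA ∪ G.embr.onE '' SEB)
        (G.embr.onV u) (G.embr.onV v) := fun u hu v hv =>
      G.embr.joined (fun e he => (memEr e).2 he) (hB.connected u hu v hv)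
    have hAB : ∀ u ∈ SVA, ∀ v ∈ SVB, G.join.Joined (G.embl.onE '' SEA ∪ G.embr.onE '' SEB)
        (G.embl.onV u) (G.embr.onV v) := fun u hu v hv =>
      ((hAA u hu p hpS).trans hpq).trans (hBB q hqS v hv)
    rintro _ (⟨u, hu, rfl⟩ | ⟨u, hu, rfl⟩) _ (⟨v, hv, rfl⟩ | ⟨v, hv, rfl⟩)
    · exact hAA u hu v hv
    · exact hAB u hu v hv
    · exact (hAB v hv u hu).symm
    · exact hBB u hu v hv
  · intro p hp _ e hep he
    rcases G.exists_edge' e with ⟨a, ha, rfl⟩ | ⟨b, hb, rfl⟩ | ⟨rfl, -⟩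
    · obtain ⟨q, hq, haq, hlq⟩ := G.keeps_embl.exists_sym2 z hp ha hep (lnosym p hp)
      exact hA.disjoint q hq (fun x hx hxW => hlq (Set.mem_singleton_iff.1 (hWA hxW) ▸ hx)) a haq
        ((memEl a).1 he)
    · obtain ⟨q, hq, haq, hlq⟩ := G.keeps_embr.exists_sym2 z hp hb hep
        (G.embl_l ▸ lnosym p hp)
      exact hB.disjoint q hq (fun x hx hxW => hlq (Set.mem_singleton_iff.1 (hWB hxW) ▸ hx)) b haq
        ((memEr b).1 he)
    · exact lnosym p hp hep
  -- Both points of a pair belong to the same part because `I` and `I'` are disjoint, so the glued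
  -- edge is never a new contractible edge.
  · rintro e ⟨i, u, v, hu, hv, pu, pv⟩
    rcases G.exists_vertex u with ⟨u, rfl⟩ | ⟨u, rfl⟩ <;>
      rcases G.exists_vertex v with ⟨v, rfl⟩ | ⟨v, rfl⟩
    · obtain ⟨a, rfl, ha⟩ := (G.embl.src_iff _ _).1 hu
      exact (memEl a).2 (hA.contractible a ⟨i, u, v, ha, G.embl.tgt_onE.1 hv, pu, pv⟩)
    · exact (Set.disjoint_left.1 hI (hposl i u (Or.inl pu)) (hposr i v (Or.inr pv))).elim
    · exact (Set.disjoint_left.1 hI (hposl i v (Or.inr pv)) (hposr i u (Or.inl pu))).elim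
    · obtain ⟨a, rfl, ha⟩ := (G.embr.src_iff _ _).1 hu
      exact (memEr a).2 (hB.contractible a ⟨i, u, v, ha, G.embr.tgt_onE.1 hv, pu, pv⟩)
  · intro e he hev
    rcases he with ⟨a, ha, rfl⟩ | ⟨a, ha, rfl⟩
    · rw [G.embl.weight_eq] at hev
      exact G.embl.isContractible z (hA.odd a ha hev)
    · rw [G.embr.weight_eq] at hev
      exact G.embr.isContractible z (hB.odd a ha hev)
  -- The tails of the parts remain tails: the glued edge is odd and its inner endpoints lie in the
  -- cores, so no tail contains it.
  · intro e he
    rcases G.exists_edge' e with ⟨a, -, rfl⟩ | ⟨b, -, rfl⟩ | ⟨rfl, -⟩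
    · obtain ⟨T, haT, hT⟩ := hA.tails a (fun h => he ((memEl a).2 h))
      exact ⟨G.embl.onE '' T, ⟨a, haT, rfl⟩, G.keeps_embl.isTailAt memVl hT
        (hT.notMem (hA.subgraph _ hl) hodd)⟩
    · obtain ⟨T, haT, hT⟩ := hB.tails b (fun h => he ((memEr b).2 h))
      exact ⟨G.embr.onE '' T, ⟨b, haT, rfl⟩, G.keeps_embr.isTailAt memVr hT
        (hT.notMem (hB.subgraph _ hr) (G.weight_eq ▸ hodd))⟩
    · exact absurd ((memEl _).2 hl) he

end TropicalCover

namespace TropicalCover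

theorem isTailAt_end (C : TropicalCover) {SV : Set C.V} {e : C.E}
    (he : C.src e = none ∨ C.tgt e = none) (hS : ∀ v, C.Touches e v → v ∈ SV)
    (hev : Even (C.weight e)) : C.IsTailAt SV {e} := by
  obtain ⟨v, hv⟩ := C.exists_touches e
  refine ⟨e, v, hS v hv, ?_⟩
  rcases he with h | h
  · exact Or.inl ⟨hv.resolve_left (by simp [h]), IsTail.single e h hev⟩
  · exact Or.inr ⟨hv.resolve_right (by simp [h]), IsTail.single e h hev⟩

/-! ### Covers with one vertex -/

/-- Combinatorial data of a cover with one vertex: the edge `0` is a left end, the edge `2` a right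
end, and the edge `1` is a left end if `p` holds and a right end otherwise. -/
structure Tripod where
  p : Bool
  w : Fin 3 → ℕ
  w_pos : ∀ e, 0 < w e
  r : ℝ
  bal : w 0 + (if p then w 1 else 0) = w 2 + if p then 0 else w 1

namespace Tripod

variable (T : Tripod)

/-- The starting points of the edges. -/
def srcTable (p : Bool) : Fin 3 → Option Unit := ![none, if p then none else some (), some ()]

/-- The end points of the edges. -/
def tgtTable (p : Bool) : Fin 3 → Option Unit := ![some (), if p then some () else none, none]

/-- The incidences depend only on a flag, not on weights or positions, so the combinatorial facts
about these covers are finite checks on tables. -/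
theorem table_incident : ∀ p e, srcTable p e ≠ none ∨ tgtTable p e ≠ none := by decide

theorem table_is_end : ∀ p e, srcTable p e = none ∨ tgtTable p e = none := by decide

theorem table_trivalent : ∀ p v, (Finset.univ.filter fun e => tgtTable p e = some v).card +
    (Finset.univ.filter fun e => srcTable p e = some v).card = 3 := by decide

theorem table_parallel : ∀ p e f, e ≠ f → srcTable p e = srcTable p f →
    tgtTable p e = tgtTable p f → e = 1 ∨ f = 1 := by decide

/-- The cover with one vertex. -/
noncomputable def cover : TropicalCover :=
  ofNet Unit (Fin 3) (srcTable T.p) (tgtTable T.p) T.w (fun _ => T.r) ⟨()⟩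
    (table_incident T.p)
    (fun _ _ => Relation.ReflTransGen.refl)
    (by
      intro v
      rw [Set.ncard_eq_toFinset_card', Set.ncard_eq_toFinset_card', Set.toFinset_ofPred,
        Set.toFinset_ofPred]
      exact table_trivalent T.p v)
    T.w_pos
    (by
      intro e u v hu hv
      rcases table_is_end T.p e with h | h
      · exact (Option.some_ne_none _ (hu.symm.trans h)).elim
      · exact (Option.some_ne_none _ (hv.symm.trans h)).elim)
    (by
      intro v
      obtain ⟨p, w, hw, r, hb⟩ := T
      cases p
      · simpa [srcTable, tgtTable, Finset.sum_filter, Fin.sum_univ_three, add_comm] using hb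
      · simpa [srcTable, tgtTable, Finset.sum_filter, Fin.sum_univ_three] using hb)

theorem leftEnds_cover : T.cover.leftEnds = T.w 0 ::ₘ if T.p then {T.w 1} else 0 := by
  refine (Fin.sum_univ_three _).trans ?_
  change (if (srcTable T.p) 0 = none then ({T.w 0} : Multiset ℕ) else 0) +
    (if (srcTable T.p) 1 = none then ({T.w 1} : Multiset ℕ) else 0) +
    (if (srcTable T.p) 2 = none then ({T.w 2} : Multiset ℕ) else 0) = _
  cases h : T.p
  · simp [srcTable]
  · simp [srcTable]

theorem rightEnds_cover : T.cover.rightEnds = T.w 2 ::ₘ if T.p then 0 else {T.w 1} := by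
  refine (Fin.sum_univ_three _).trans ?_
  change (if (tgtTable T.p) 0 = none then ({T.w 0} : Multiset ℕ) else 0) +
    (if (tgtTable T.p) 1 = none then ({T.w 1} : Multiset ℕ) else 0) +
    (if (tgtTable T.p) 2 = none then ({T.w 2} : Multiset ℕ) else 0) = _
  cases h : T.p
  · simp [tgtTable]
    exact Multiset.cons_swap _ _ 0
  · simp [tgtTable]

theorem not_isContractible {s t : ℕ} (z : BranchDistribution s t) (e : T.cover.E) :
    ¬ T.cover.IsContractible z e := by
  rintro ⟨i, u, v, hu, hv, -⟩
  rcases table_is_end T.p e with h | h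
  · exact Option.some_ne_none _ (hu.symm.trans h)
  · exact Option.some_ne_none _ (hv.symm.trans h)

/-- The core consists of the vertex and the odd edges, and each even edge is a tail by itself. A
symmetric fork of odd ends violates the core condition, and it is tolerated only if it meets `W`,
that is, if gluing is going to break it. -/
theorem block {s t : ℕ} (z : BranchDistribution s t) (W : Set T.cover.E) (j : Fin t)
    (hj : T.r = z.y j)
    (hW : ∀ e f, T.cover.Parallel e f → Odd (T.cover.weight e) → e ∈ W ∨ f ∈ W) :
    Block z T.cover W Set.univ {e | Odd (T.cover.weight e)} ∅ {j} 0
      (T.w 0 ::ₘ if T.p then {T.w 1} else 0) (T.w 2 ::ₘ if T.p then 0 else {T.w 1}) where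
  genus := by
    have h : {e | T.cover.IsInner e} = ∅ := by
      ext e
      simp only [Set.mem_ofPred_eq, Set.mem_empty_iff_false, iff_false]
      rintro ⟨h1, h2⟩
      exact (table_is_end T.p e).elim h1 h2
    have h' : Fintype.card T.cover.V = 1 := Fintype.card_unit
    rw [HasGenus, h, h', Set.ncard_empty]
  image := by
    rw [BranchDistribution.points, Set.image_singleton, ← hj]
    ext r
    constructor
    · rintro ⟨_, rfl⟩
      exact Or.inr rfl
    · rintro (⟨_, h, _⟩ | h)
      · exact h.elim
      · exact ⟨(), h.symm⟩
  left := T.leftEnds_cover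
  right := T.rightEnds_cover
  resolving i hi := hi.elim
  subgraph _ _ _ _ := Set.mem_univ _
  nonempty := ⟨(), Set.mem_univ _⟩
  connected _ _ _ _ := Relation.ReflTransGen.refl
  disjoint := by
    rintro p ⟨⟨⟨e, f, hef, hp⟩, -⟩, -⟩ hpW x hx hxo
    have hx' : x ∈ (p : Set T.cover.E) := hx
    have he : e ∈ p := by have : e ∈ (p : Set T.cover.E) := by simp [hp]
                          exact this
    have hf : f ∈ p := by have : f ∈ (p : Set T.cover.E) := by simp [hp]
                          exact this
    have : Odd (T.cover.weight e) := by
      rw [hp] at hx'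
      rcases hx' with rfl | rfl
      · exact hxo
      · rw [hef.2.2.2]; exact hxo
    rcases hW e f hef this with h | h
    · exact hpW e he h
    · exact hpW f hf h
  contractible e he := (T.not_isContractible z e he).elim
  odd e he h := (Nat.not_even_iff_odd.2 he h).elim
  tails e he := ⟨{e}, rfl, T.cover.isTailAt_end (table_is_end T.p e) (fun _ _ => Set.mem_univ _)
    (Nat.not_odd_iff_even.1 he)⟩

end Tripod

/-! ### Covers with two vertices -/

/-- Combinatorial data of a cover with two vertices and one inner edge `0` from the first to the
second.  The edge `1` is a left end at the first vertex and `4` a right end at the second one; the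
other edges at these vertices are `2` and `3`, which are left ends if `p`, respectively `q`, holds
and right ends otherwise. -/
structure Dumbbell where
  p : Bool
  q : Bool
  w : Fin 5 → ℕ
  w_pos : ∀ e, 0 < w e
  r : Bool → ℝ
  r_lt : r false < r true
  bal₀ : w 1 + (if p then w 2 else 0) = w 0 + if p then 0 else w 2
  bal₁ : w 0 + (if q then w 3 else 0) = w 4 + if q then 0 else w 3

namespace Dumbbell

variable (T : Dumbbell)

/-- The starting points of the edges. -/
def srcTable (p q : Bool) : Fin 5 → Option Bool :=
  ![some false, none, if p then none else some false, if q then none else some true, some true]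

/-- The end points of the edges. -/
def tgtTable (p q : Bool) : Fin 5 → Option Bool :=
  ![some true, some false, if p then some false else none, if q then some true else none, none]

theorem table_incident : ∀ p q e, srcTable p q e ≠ none ∨ tgtTable p q e ≠ none := by decide

theorem table_is_end : ∀ p q e, e ≠ 0 → srcTable p q e = none ∨ tgtTable p q e = none := by decide

theorem table_trivalent : ∀ p q v, (Finset.univ.filter fun e => tgtTable p q e = some v).card +
    (Finset.univ.filter fun e => srcTable p q e = some v).card = 3 := by decide

theorem table_parallel_in : ∀ q e f, e ≠ f → srcTable true q e = srcTable true q f →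
    tgtTable true q e = tgtTable true q f → (e = 3 ∨ e = 4 ∨ f = 3 ∨ f = 4) →
    e = 3 ∨ f = 3 := by decide

theorem table_parallel_out : ∀ e f, e ≠ f → srcTable false false e = srcTable false false f →
    tgtTable false false e = tgtTable false false f → e ≠ 1 ∧ e ≠ 2 := by decide

theorem table_touch_in : ∀ q e v, e = 3 ∨ e = 4 →
    srcTable true q e = some v ∨ tgtTable true q e = some v → v = true := by decide

theorem table_touch_out : ∀ q e v, e = 1 ∨ e = 2 →
    srcTable false q e = some v ∨ tgtTable false q e = some v → v = false := by decide

/-- The cover with two vertices. -/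
noncomputable def cover : TropicalCover :=
  ofNet Bool (Fin 5) (srcTable T.p T.q) (tgtTable T.p T.q) T.w T.r ⟨true⟩
    (table_incident T.p T.q)
    (by
      intro u v
      cases u <;> cases v
      · exact Relation.ReflTransGen.refl
      · exact Relation.ReflTransGen.single ⟨0, Or.inl ⟨rfl, rfl⟩⟩
      · exact Relation.ReflTransGen.single ⟨0, Or.inr ⟨rfl, rfl⟩⟩
      · exact Relation.ReflTransGen.refl)
    (by
      intro v
      rw [Set.ncard_eq_toFinset_card', Set.ncard_eq_toFinset_card', Set.toFinset_ofPred,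
        Set.toFinset_ofPred]
      exact table_trivalent T.p T.q v)
    T.w_pos
    (by
      intro e u v hu hv
      by_cases he : e = 0
      · subst he
        cases hu; cases hv
        exact T.r_lt
      · rcases table_is_end T.p T.q e he with h | h
        · exact (Option.some_ne_none _ (hu.symm.trans h)).elim
        · exact (Option.some_ne_none _ (hv.symm.trans h)).elim)
    (by
      intro v
      obtain ⟨p, q, w, hw, r, hr, h0, h1⟩ := T
      cases p <;> cases q <;> cases v <;>
        simp only [Bool.false_eq_true, if_false, if_true] at h0 h1 <;>
        simp [srcTable, tgtTable, Finset.sum_filter, Fin.sum_univ_five] <;> omega)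

theorem leftEnds_cover : T.cover.leftEnds =
    T.w 1 ::ₘ ((if T.p then {T.w 2} else 0) + if T.q then {T.w 3} else 0) := by
  refine (Fin.sum_univ_five _).trans ?_
  change (if srcTable T.p T.q 0 = none then ({T.w 0} : Multiset ℕ) else 0) +
    (if srcTable T.p T.q 1 = none then ({T.w 1} : Multiset ℕ) else 0) +
    (if srcTable T.p T.q 2 = none then ({T.w 2} : Multiset ℕ) else 0) +
    (if srcTable T.p T.q 3 = none then ({T.w 3} : Multiset ℕ) else 0) +
    (if srcTable T.p T.q 4 = none then ({T.w 4} : Multiset ℕ) else 0) = _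
  cases h : T.p <;> cases h' : T.q <;> simp [srcTable]

theorem rightEnds_cover : T.cover.rightEnds =
    T.w 4 ::ₘ ((if T.p then 0 else {T.w 2}) + if T.q then 0 else {T.w 3}) := by
  refine (Fin.sum_univ_five _).trans ?_
  change (if tgtTable T.p T.q 0 = none then ({T.w 0} : Multiset ℕ) else 0) +
    (if tgtTable T.p T.q 1 = none then ({T.w 1} : Multiset ℕ) else 0) +
    (if tgtTable T.p T.q 2 = none then ({T.w 2} : Multiset ℕ) else 0) +
    (if tgtTable T.p T.q 3 = none then ({T.w 3} : Multiset ℕ) else 0) +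
    (if tgtTable T.p T.q 4 = none then ({T.w 4} : Multiset ℕ) else 0) = _
  cases h : T.p <;> cases h' : T.q <;>
    simp [tgtTable, add_comm, ← Multiset.singleton_add]

theorem is_end (e : Fin 5) (he : e ≠ 0) :
    srcTable T.p T.q e = none ∨ tgtTable T.p T.q e = none := table_is_end _ _ e he

theorem genus : T.cover.HasGenus 0 := by
  have h : {e | T.cover.IsInner e} = {(0 : Fin 5)} := by
    ext e
    simp only [Set.mem_ofPred_eq]
    constructor
    · rintro ⟨h1, h2⟩
      by_contra h
      exact (T.is_end e h).elim h1 h2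
    · rintro rfl
      exact ⟨Option.some_ne_none _, Option.some_ne_none _⟩
  have h' : Fintype.card T.cover.V = 2 := Fintype.card_bool
  rw [HasGenus, h, h']
  exact congrArg (· + 1) (Set.ncard_singleton (0 : Fin 5))

theorem range_pos : Set.range T.cover.pos = {T.r false, T.r true} := by
  ext r
  constructor
  · rintro ⟨v, rfl⟩
    cases v
    · exact Or.inl rfl
    · exact Or.inr rfl
  · rintro (rfl | rfl)
    · exact ⟨false, rfl⟩
    · exact ⟨true, rfl⟩

theorem eq_zero_of_isContractible {s t : ℕ} (z : BranchDistribution s t) {e : T.cover.E}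
    (h : T.cover.IsContractible z e) : e = (0 : Fin 5) := by
  obtain ⟨i, u, v, hu, hv, -⟩ := h
  by_contra he
  rcases T.is_end e he with h | h
  · exact Option.some_ne_none _ (hu.symm.trans h)
  · exact Option.some_ne_none _ (hv.symm.trans h)

/-- A cover with two vertices over a pair of points. -/
theorem block_pair {s t : ℕ} (z : BranchDistribution s t) (i : Fin s)
    (h0 : T.r false = (z.x i).1) (h1 : T.r true = (z.x i).2)
    (hp : T.cover.PairPattern false true) :
    Block z T.cover ∅ Set.univ {e | e = (0 : Fin 5) ∨ Odd (T.cover.weight e)} {i} ∅ 0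
      (T.w 1 ::ₘ ((if T.p then {T.w 2} else 0) + if T.q then {T.w 3} else 0))
      (T.w 4 ::ₘ ((if T.p then 0 else {T.w 2}) + if T.q then 0 else {T.w 3})) := by
  have hcon : T.cover.IsContractible z (0 : Fin 5) := ⟨i, false, true, rfl, rfl, h0, h1⟩
  have htouch : ∀ v : T.cover.V, T.cover.Touches (0 : Fin 5) v := by
    intro v
    cases v
    · exact Or.inl rfl
    · exact Or.inr rfl
  refine ⟨T.genus, ?_, T.leftEnds_cover, T.rightEnds_cover, ?_, fun _ _ _ _ => Set.mem_univ _,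
    ⟨true, Set.mem_univ _⟩, ?_, ?_, ?_, ?_, ?_⟩
  · rw [T.range_pos, h0, h1, BranchDistribution.points]
    ext r
    simp
  · rintro _ rfl
    exact ⟨false, true, h0, h1, hp⟩
  · intro u _ v _
    exact Relation.ReflTransGen.single ⟨(0 : Fin 5), Or.inl rfl, htouch u, htouch v⟩
  -- Every edge touches an endpoint of the contractible edge `0`, so there are no pairs in `Sym2` at
  -- all.
  · rintro p ⟨-, hadj⟩ - e he -
    obtain ⟨v, hv⟩ := T.cover.exists_touches e
    exact hadj ⟨e, he, (0 : Fin 5), v, hcon, hv, htouch v⟩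
  · exact fun e he => Or.inl (T.eq_zero_of_isContractible z he)
  · rintro e (rfl | he) h
    · exact hcon
    · exact (Nat.not_even_iff_odd.2 he h).elim
  · intro e he
    refine ⟨{e}, rfl, T.cover.isTailAt_end (T.is_end e fun h => he (Or.inl h))
      (fun _ _ => Set.mem_univ _) (Nat.not_odd_iff_even.1 fun h => he (Or.inr h))⟩

/-- The only inner edge starts over a single point, and single points never belong to a pair. -/
theorem not_isContractible_of_y {s t : ℕ} (z : BranchDistribution s t) {j : Fin t}
    (h0 : T.r false = z.y j) (e : T.cover.E) : ¬ T.cover.IsContractible z e := by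
  intro h
  cases T.eq_zero_of_isContractible z h
  obtain ⟨i, u, v, hu, hv, pu, pv⟩ := h
  cases hu
  have h2 : z.y j = (z.x i).1 := h0.symm.trans pu
  exact z.sep i j (z.mem_pair (Or.inl h2))

/-- A cover with two vertices over single points, where a fork of left ends is attached to the
core. -/
theorem block_fork_in {s t : ℕ} (z : BranchDistribution s t) {j j' : Fin t}
    (h0 : T.r false = z.y j) (h1 : T.r true = z.y j') (hp : T.p = true) (hw : T.w 1 = T.w 2)
    (h3 : Odd (T.w 3)) (h4 : Odd (T.w 4)) :
    Block z T.cover {(3 : Fin 5)} {true} {(3 : Fin 5), (4 : Fin 5)} ∅ {j, j'} 0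
      (T.w 1 ::ₘ ((if T.p then {T.w 2} else 0) + if T.q then {T.w 3} else 0))
      (T.w 4 ::ₘ ((if T.p then 0 else {T.w 2}) + if T.q then 0 else {T.w 3})) := by
  have hS : ∀ e : Fin 5, e = 3 ∨ e = 4 → ∀ v,
      srcTable T.p T.q e = some v ∨ tgtTable T.p T.q e = some v → v = true := by
    rw [hp]; exact fun e he v => table_touch_in _ e v he
  -- The whole first vertex lies outside the core: the edge `0` followed by the fork `1`, `2` is one
  -- tail hanging on the second vertex.
  have htail : T.cover.IsTailAt {true} {(0 : Fin 5), (1 : Fin 5), (2 : Fin 5)} := by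
    refine ⟨(0 : Fin 5), true, rfl, Or.inl ⟨rfl, IsTail.fork (C := T.cover) (0 : Fin 5) (1 : Fin 5) (2 : Fin 5) false
      Bool.false_ne_true rfl ?_ ?_ rfl ?_ ?_⟩⟩
    · change {e : Fin 5 | srcTable T.p T.q e = some false} = {0}
      rw [hp]
      exact Set.ext ((by decide : ∀ q e, srcTable true q e = some false ↔ e = 0) T.q)
    · change {e : Fin 5 | tgtTable T.p T.q e = some false} = {1, 2}
      rw [hp]
      exact Set.ext ((by decide : ∀ q e, tgtTable true q e = some false ↔ e = 1 ∨ e = 2) T.q)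
    · change srcTable T.p T.q 2 = none
      rw [hp]; rfl
    · refine ⟨(by decide : (1 : Fin 5) ≠ 2), ?_, ?_, hw⟩
      · change srcTable T.p T.q 1 = srcTable T.p T.q 2
        rw [hp]; rfl
      · change tgtTable T.p T.q 1 = tgtTable T.p T.q 2
        rw [hp]; rfl
  refine ⟨T.genus, ?_, T.leftEnds_cover, T.rightEnds_cover, fun i hi => hi.elim,
    fun e he v hv => hS e he v hv, ⟨true, rfl⟩, ?_, ?_, ?_, ?_, ?_⟩
  · rw [T.range_pos, h0, h1, BranchDistribution.points]
    simp [Set.image_pair]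
  · rintro u rfl v rfl
    exact Relation.ReflTransGen.refl
  · rintro p ⟨⟨⟨e, f, hef, hpe⟩, -⟩, -⟩ hpW x hx hxo
    have he : e ∈ p := hpe.symm.subset (Or.inl rfl)
    have hf : f ∈ p := hpe.symm.subset (Or.inr rfl)
    have hx' : x = e ∨ x = f := hpe.subset hx
    have h1 : srcTable T.p T.q e = srcTable T.p T.q f := hef.2.1
    have h2 : tgtTable T.p T.q e = tgtTable T.p T.q f := hef.2.2.1
    rw [hp] at h1 h2
    have hxo' : x = (3 : Fin 5) ∨ x = (4 : Fin 5) := hxo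
    have h3 : e = (3 : Fin 5) ∨ e = (4 : Fin 5) ∨ f = (3 : Fin 5) ∨ f = (4 : Fin 5) := by
      rcases hx' with rfl | rfl
      · exact hxo'.elim Or.inl fun h => Or.inr (Or.inl h)
      · exact Or.inr (Or.inr hxo')
    rcases table_parallel_in T.q e f hef.1 h1 h2 h3 with h | h
    · exact hpW e he h
    · exact hpW f hf h
  · exact fun e he => (T.not_isContractible_of_y z h0 e he).elim
  · rintro e (rfl | rfl) h
    · exact (Nat.not_even_iff_odd.2 h3 h).elim
    · exact (Nat.not_even_iff_odd.2 h4 h).elim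
  · intro e he
    refine ⟨_, ?_, htail⟩
    revert he
    have : ∀ e : Fin 5, e ∉ ({3, 4} : Set (Fin 5)) → e ∈ ({0, 1, 2} : Set (Fin 5)) := by
      simp only [Set.mem_insert_iff, Set.mem_singleton_iff]
      decide
    exact this e

/-- A cover with two vertices over single points, where a fork of right ends is attached to the
core. -/
theorem block_fork_out {s t : ℕ} (z : BranchDistribution s t) {j j' : Fin t}
    (h0 : T.r false = z.y j) (h1 : T.r true = z.y j') (hp : T.p = false) (hq : T.q = false)
    (hw : T.w 3 = T.w 4) (h3 : Odd (T.w 1)) (h4 : Odd (T.w 2)) :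
    Block z T.cover ∅ {false} {(1 : Fin 5), (2 : Fin 5)} ∅ {j, j'} 0
      (T.w 1 ::ₘ ((if T.p then {T.w 2} else 0) + if T.q then {T.w 3} else 0))
      (T.w 4 ::ₘ ((if T.p then 0 else {T.w 2}) + if T.q then 0 else {T.w 3})) := by
  have hS : ∀ e : Fin 5, e = 1 ∨ e = 2 → ∀ v,
      srcTable T.p T.q e = some v ∨ tgtTable T.p T.q e = some v → v = false := by
    rw [hp]; exact fun e he v => table_touch_out _ e v he
  -- Mirror image: the tail is the edge `0` followed by the fork `3`, `4` of right ends.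
  have htail : T.cover.IsTailAt {false} {(0 : Fin 5), (3 : Fin 5), (4 : Fin 5)} := by
    refine ⟨(0 : Fin 5), false, rfl, Or.inr ⟨rfl, IsTail.fork (C := T.cover) (0 : Fin 5) (3 : Fin 5) (4 : Fin 5) true
      Bool.false_ne_true.symm rfl ?_ ?_ ?_ rfl ?_⟩⟩
    · change {e : Fin 5 | tgtTable T.p T.q e = some true} = {0}
      rw [hp, hq]
      exact Set.ext (by decide : ∀ e, tgtTable false false e = some true ↔ e = 0)
    · change {e : Fin 5 | srcTable T.p T.q e = some true} = {3, 4}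
      rw [hp, hq]
      exact Set.ext (by decide : ∀ e, srcTable false false e = some true ↔ e = 3 ∨ e = 4)
    · change tgtTable T.p T.q 3 = none
      rw [hq]; rfl
    · refine ⟨(by decide : (3 : Fin 5) ≠ 4), ?_, ?_, hw⟩
      · change srcTable T.p T.q 3 = srcTable T.p T.q 4
        rw [hq]; rfl
      · change tgtTable T.p T.q 3 = tgtTable T.p T.q 4
        rw [hq]; rfl
  refine ⟨T.genus, ?_, T.leftEnds_cover, T.rightEnds_cover, fun i hi => hi.elim,
    fun e he v hv => hS e he v hv, ⟨false, rfl⟩, ?_, ?_, ?_, ?_, ?_⟩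
  · rw [T.range_pos, h0, h1, BranchDistribution.points]
    simp [Set.image_pair]
  · rintro u rfl v rfl
    exact Relation.ReflTransGen.refl
  · rintro p ⟨⟨⟨e, f, hef, hpe⟩, -⟩, -⟩ - x hx hxo
    have hx' : x = e ∨ x = f := hpe.subset hx
    have hxo' : x = (1 : Fin 5) ∨ x = (2 : Fin 5) := hxo
    have key : ∀ e f, T.cover.Parallel e f → e ≠ (1 : Fin 5) ∧ e ≠ (2 : Fin 5) := by
      intro e f hef
      have h1 : srcTable T.p T.q e = srcTable T.p T.q f := hef.2.1
      have h2 : tgtTable T.p T.q e = tgtTable T.p T.q f := hef.2.2.1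
      rw [hp, hq] at h1 h2
      exact table_parallel_out e f hef.1 h1 h2
    rcases hx' with rfl | rfl
    · exact hxo'.elim (key _ f hef).1 (key _ f hef).2
    · exact hxo'.elim (key _ e hef.symm).1 (key _ e hef.symm).2
  · exact fun e he => (T.not_isContractible_of_y z h0 e he).elim
  · rintro e (rfl | rfl) h
    · exact (Nat.not_even_iff_odd.2 h3 h).elim
    · exact (Nat.not_even_iff_odd.2 h4 h).elim
  · intro e he
    refine ⟨_, ?_, htail⟩
    revert he
    have : ∀ e : Fin 5, e ∉ ({1, 2} : Set (Fin 5)) → e ∈ ({0, 3, 4} : Set (Fin 5)) := by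
      simp only [Set.mem_insert_iff, Set.mem_singleton_iff]
      decide
    exact this e

theorem pairJoin (hp : T.p = true) (hq : T.q = true) (hw : T.w 1 = T.w 2) :
    T.cover.PairJoin false true := by
  obtain ⟨p, q, w, hw', r, hr, h0, h1⟩ := T
  cases hp; cases hq
  refine ⟨(1 : Fin 5), (2 : Fin 5), (0 : Fin 5), (3 : Fin 5), (4 : Fin 5),
    ⟨(by decide : (1 : Fin 5) ≠ 2), rfl, rfl, hw⟩, (by decide : (0 : Fin 5) ≠ 3), ?_, ?_, ?_, ?_⟩
  · exact Set.ext (by decide : ∀ e, tgtTable true true e = some false ↔ e = 1 ∨ e = 2)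
  · exact Set.ext (by decide : ∀ e, srcTable true true e = some false ↔ e = 0)
  · exact Set.ext (by decide : ∀ e, tgtTable true true e = some true ↔ e = 0 ∨ e = 3)
  · exact Set.ext (by decide : ∀ e, srcTable true true e = some true ↔ e = 4)

theorem pairSplit (hp : T.p = false) (hq : T.q = false) (hw : T.w 3 = T.w 4) :
    T.cover.PairSplit false true := by
  obtain ⟨p, q, w, hw', r, hr, h0, h1⟩ := T
  cases hp; cases hq
  refine ⟨(3 : Fin 5), (4 : Fin 5), (0 : Fin 5), (2 : Fin 5), (1 : Fin 5),
    ⟨(by decide : (3 : Fin 5) ≠ 4), rfl, rfl, hw⟩, (by decide : (0 : Fin 5) ≠ 2), ?_, ?_, ?_, ?_⟩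
  · exact Set.ext (by decide : ∀ e, tgtTable false false e = some false ↔ e = 1)
  · exact Set.ext (by decide : ∀ e, srcTable false false e = some false ↔ e = 0 ∨ e = 2)
  · exact Set.ext (by decide : ∀ e, tgtTable false false e = some true ↔ e = 0)
  · exact Set.ext (by decide : ∀ e, srcTable false false e = some true ↔ e = 3 ∨ e = 4)

theorem pairExchange (hp : T.p = false) (hq : T.q = true) :
    T.cover.PairExchange false true (1 : Fin 5) (2 : Fin 5) (0 : Fin 5) (3 : Fin 5)
      (4 : Fin 5) := by
  obtain ⟨p, q, w, hw', r, hr, h0, h1⟩ := T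
  cases hp; cases hq
  refine ⟨(by decide : (2 : Fin 5) ≠ 0), (by decide : (3 : Fin 5) ≠ 0),
    (by decide : (3 : Fin 5) ≠ 2), ?_, ?_, ?_, ?_⟩
  · exact Set.ext (by decide : ∀ e, tgtTable false true e = some false ↔ e = 1)
  · exact Set.ext (by decide : ∀ e, srcTable false true e = some false ↔ e = 2 ∨ e = 0)
  · exact Set.ext (by decide : ∀ e, tgtTable false true e = some true ↔ e = 0 ∨ e = 3)
  · exact Set.ext (by decide : ∀ e, srcTable false true e = some true ↔ e = 4)

end Dumbbell

end TropicalCover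

/-! ### Gluing over separated sets of branch points -/

namespace TropicalCover

variable {s t : ℕ} {z : BranchDistribution s t}

/-- Gluing data for covers over separated sets of points. -/
def Gluing.ofLt {A B : TropicalCover} (l : A.E) (r : B.E) (hl : A.tgt l = none)
    (hr : B.src r = none) (hw : A.weight l = B.weight r) (h : ∀ u v, A.pos u < B.pos v) :
    Gluing A B :=
  ⟨l, r, hl, hr, hw, fun u v _ _ => h u v, by
    rw [Set.disjoint_left]
    rintro _ ⟨u, rfl⟩ ⟨v, hv⟩
    exact (h u v).ne hv.symm⟩

theorem lt_of_range {A B : TropicalCover} {P Q : Set ℝ} (hA : Set.range A.pos = P)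
    (hB : Set.range B.pos = Q) (h : ∀ r ∈ P, ∀ r' ∈ Q, r < r') (u : A.V) (v : B.V) :
    A.pos u < B.pos v := h _ (hA ▸ Set.mem_range_self u) _ (hB ▸ Set.mem_range_self v)

theorem ne_of_src_tgt {C : TropicalCover} {e f : C.E} (he : C.src e = none) (hf : C.tgt f = none) :
    e ≠ f := by
  rintro rfl
  exact (C.incident e).elim (fun h => h he) fun h => h hf

/-! ### Towers over the pairs of points -/

/-- There is a cover over the pairs with index at least `n` which contains `A`, and which has an odd
left end of weight `w` in its core.  `L` and `R` are the weights of the other ends. -/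
def LeftTower (z : BranchDistribution s t) (A : TropicalCover) (g n w : ℕ) (L R : Multiset ℕ) :
    Prop :=
  Odd w ∧ ∃ (C : TropicalCover) (SV : Set C.V) (SE : Set C.E) (e : C.E),
    Block z C ∅ SV SE {i | n ≤ i.val} ∅ g (w ::ₘ L) R ∧ e ∈ SE ∧ C.src e = none ∧
      C.weight e = w ∧ (∀ f, ¬ C.Parallel e f) ∧ Nonempty (Emb A C)

theorem points_lt_of_x {I I' : Set (Fin s)} (h : ∀ i ∈ I, ∀ i' ∈ I', i < i') :
    ∀ r ∈ z.points I ∅, ∀ r' ∈ z.points I' ∅, r < r' := by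
  rintro r (⟨i, hi, hr⟩ | hr) r' (⟨i', hi', hr'⟩ | hr')
  · have h1 := z.x_mono i i' (h i hi i' hi')
    have h2 := (z.mem_pair hr).2
    have h3 := (z.mem_pair hr').1
    linarith
  · simp at hr'
  · simp at hr
  · simp at hr

theorem points_lt_of_y {J J' : Set (Fin t)} (h : ∀ i ∈ J, ∀ i' ∈ J', i < i') :
    ∀ r ∈ z.points ∅ J, ∀ r' ∈ z.points ∅ J', r < r' := by
  rintro r (⟨i, hi, hr⟩ | ⟨j, hj, rfl⟩) r' (⟨i', hi', hr'⟩ | ⟨j', hj', rfl⟩)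
  · exact hi.elim
  · exact hi.elim
  · exact hi'.elim
  · exact z.y_mono (h j hj j' hj')

/-- Towers over the pairs grow to the left, one pair at a time. The new outer end `e` must have no
parallel edge, so that gluing at it in the next step does not spoil a pattern over a pair. -/
theorem LeftTower.attach {A : TropicalCover} {g n w w' : ℕ} {L R L' R' : Multiset ℕ}
    (h : LeftTower z A g (n + 1) w L R) (i : Fin s) (hi : i.val = n) (hw' : Odd w')
    {D : TropicalCover} {SV : Set D.V} {SE : Set D.E}
    (hD : Block z D ∅ SV SE {i} ∅ 0 (w' ::ₘ L') (w ::ₘ R')) (l e : D.E) (hl : l ∈ SE)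
    (he : e ∈ SE) (hlt : D.tgt l = none) (hes : D.src e = none) (hlw : D.weight l = w)
    (hew : D.weight e = w') (hlp : ∀ f, ¬ D.Parallel l f) (hep : ∀ f, ¬ D.Parallel e f) :
    LeftTower z A g n w' (L' + L) (R' + R) := by
  obtain ⟨hw, C, SV', SE', r, hC, hr, hrs, hrw, hrp, ⟨j⟩⟩ := h
  have hlt' : ∀ k ∈ ({i} : Set (Fin s)), ∀ k' ∈ {k : Fin s | n + 1 ≤ k.val}, k < k' := by
    rintro k rfl k' hk'
    have : n + 1 ≤ k'.val := hk'
    exact Fin.lt_def.2 (by omega)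
  let G := Gluing.ofLt l r hlt hrs (hlw.trans hrw.symm)
    (lt_of_range hD.image hC.image (points_lt_of_x hlt'))
  have hne : e ≠ G.l := ne_of_src_tgt hes hlt
  have hI : ({i} : Set (Fin s)) ∪ {k | n + 1 ≤ k.val} = {k | n ≤ k.val} := by
    ext k
    simp only [Set.mem_union, Set.mem_singleton_iff, Set.mem_ofPred_eq, Fin.ext_iff]
    omega
  have hdis : Disjoint ({i} : Set (Fin s)) {k | n + 1 ≤ k.val} := by
    rw [Set.disjoint_left]
    intro k hk hk'
    exact (hlt' k hk k hk').ne rfl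
  have key := Block.join G (R := R') (L' := L) (by rw [show D.weight G.l = w from hlw]; exact hD)
    (by rw [show C.weight G.r = w from hrw]; exact hC) (Set.empty_subset _) (Set.empty_subset _)
    hl hr (by rw [show D.weight G.l = w from hlw]; exact hw) (Or.inr hlp) (Or.inr hrp) hdis
  rw [hI, Set.union_empty, zero_add, Multiset.cons_add] at key
  refine ⟨hw', G.join, _, _, G.embl.onE e, key, Or.inl ⟨e, he, rfl⟩, G.keeps_embl.src e hne hes,
    (G.embl.weight_eq e).trans hew, fun f hf => ?_, ⟨j.trans G.embr⟩⟩
  obtain ⟨b, -, hb⟩ := G.keeps_embl.exists_parallel hne hf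
  exact hep b hb

namespace Dumbbell

variable (T : Dumbbell)

theorem table_not_parallel_join : ∀ e f, (e = 3 ∨ e = 4) → e ≠ f →
    srcTable true true e = srcTable true true f → tgtTable true true e ≠ tgtTable true true f := by
  decide

theorem table_not_parallel_split : ∀ e f, (e = 1 ∨ e = 2) → e ≠ f →
    srcTable false false e = srcTable false false f →
    tgtTable false false e ≠ tgtTable false false f := by
  decide

theorem table_not_parallel_exchange : ∀ e f, e ≠ f →
    srcTable false true e = srcTable false true f →
    tgtTable false true e ≠ tgtTable false true f := by
  decide

end Dumbbell

/-- Two left ends `k` merge into an even contractible edge, which joins the main edge: the weight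
grows by `2 * k` from left to right. -/
theorem LeftTower.join_pair {A : TropicalCover} {g n w k : ℕ} {L R : Multiset ℕ}
    (h : LeftTower z A g (n + 1) (w + 2 * k) L R) (hn : n < s) (hk : 0 < k) (hw : 0 < w) :
    LeftTower z A g n w (k ::ₘ k ::ₘ L) R := by
  have hodd : Odd w := by
    obtain ⟨r, hr⟩ := h.1
    exact ⟨r - k, by omega⟩
  let T : Dumbbell :=
    { p := true, q := true, w := ![2 * k, k, k, w, w + 2 * k]
      w_pos := by intro e; fin_cases e <;> simp [hk, hw]
      r := fun b => if b then (z.x ⟨n, hn⟩).2 else (z.x ⟨n, hn⟩).1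
      r_lt := z.x_lt _
      bal₀ := (by omega : k + k = 2 * k + 0)
      bal₁ := (by omega : 2 * k + w = w + 2 * k + 0) }
  have hb := T.block_pair z ⟨n, hn⟩ rfl rfl (Or.inl (T.pairJoin rfl rfl rfl))
  have hL : T.w 1 ::ₘ ((if T.p then {T.w 2} else 0) + if T.q then {T.w 3} else 0) =
      w ::ₘ ({k, k} : Multiset ℕ) := by
    change k ::ₘ (({k} : Multiset ℕ) + {w}) = w ::ₘ ({k, k} : Multiset ℕ)
    simp only [← Multiset.singleton_add, Multiset.insert_eq_cons]
    abel
  rw [hL] at hb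
  have key := h.attach (R' := 0) ⟨n, hn⟩ rfl hodd hb (4 : Fin 5) (3 : Fin 5)
    (Or.inr h.1) (Or.inr hodd) rfl rfl rfl rfl
    (fun f hf => Dumbbell.table_not_parallel_join 4 f (Or.inr rfl) hf.1 hf.2.1 hf.2.2.1)
    (fun f hf => Dumbbell.table_not_parallel_join 3 f (Or.inl rfl) hf.1 hf.2.1 hf.2.2.1)
  simpa using key

/-- The reflected picture: an even contractible edge leaves the main edge and splits into two right
ends `k`. -/
theorem LeftTower.split_pair {A : TropicalCover} {g n w k : ℕ} {L R : Multiset ℕ}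
    (h : LeftTower z A g (n + 1) w L R) (hn : n < s) (hk : 0 < k) :
    LeftTower z A g n (w + 2 * k) L (k ::ₘ k ::ₘ R) := by
  have hodd : Odd (w + 2 * k) := by
    obtain ⟨r, hr⟩ := h.1
    exact ⟨r + k, by omega⟩
  have hw : 0 < w := h.1.pos
  let T : Dumbbell :=
    { p := false, q := false, w := ![2 * k, w + 2 * k, w, k, k]
      w_pos := by intro e; fin_cases e <;> simp [hk, hw]
      r := fun b => if b then (z.x ⟨n, hn⟩).2 else (z.x ⟨n, hn⟩).1
      r_lt := z.x_lt _
      bal₀ := (by omega : w + 2 * k + 0 = 2 * k + w)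
      bal₁ := (by omega : 2 * k + 0 = k + k) }
  have hb := T.block_pair z ⟨n, hn⟩ rfl rfl (Or.inr (Or.inl (T.pairSplit rfl rfl rfl)))
  have hR : T.w 4 ::ₘ ((if T.p then 0 else {T.w 2}) + if T.q then 0 else {T.w 3}) =
      w ::ₘ ({k, k} : Multiset ℕ) := by
    change k ::ₘ (({w} : Multiset ℕ) + {k}) = w ::ₘ ({k, k} : Multiset ℕ)
    simp only [← Multiset.singleton_add, Multiset.insert_eq_cons]
    abel
  rw [hR] at hb
  have key := h.attach (L' := 0) ⟨n, hn⟩ rfl hodd hb (2 : Fin 5) (1 : Fin 5)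
    (Or.inr h.1) (Or.inr hodd) rfl rfl rfl rfl
    (fun f hf => Dumbbell.table_not_parallel_split 2 f (Or.inr rfl) hf.1 hf.2.1 hf.2.2.1)
    (fun f hf => Dumbbell.table_not_parallel_split 1 f (Or.inl rfl) hf.1 hf.2.1 hf.2.2.1)
  simpa using key

/-- The cover over a pair of points where `f + c` splits into `c` and `f`, and `f` is joined
with `b`. -/
noncomputable def exchange (z : BranchDistribution s t) (i : Fin s) (b c f : ℕ) (hb : 0 < b)
    (hc : 0 < c) (hf : 0 < f) : Dumbbell where
  p := false
  q := true
  w := ![f, f + c, c, b, f + b]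
  w_pos := by intro e; fin_cases e <;> simp [hb, hc, hf]
  r := fun b => if b then (z.x i).2 else (z.x i).1
  r_lt := z.x_lt _
  bal₀ := rfl
  bal₁ := rfl

theorem block_exchange (z : BranchDistribution s t) (i : Fin s) (b c f : ℕ) (hb : 0 < b)
    (hc : 0 < c) (hf : 0 < f) :
    Block z (exchange z i b c f hb hc hf).cover ∅ Set.univ
      {e | e = (0 : Fin 5) ∨ Odd ((exchange z i b c f hb hc hf).cover.weight e)} {i} ∅ 0
      ((f + c) ::ₘ {b}) ((f + b) ::ₘ {c}) := by
  have := (exchange z i b c f hb hc hf).block_pair z i rfl rfl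
    (Or.inr (Or.inr (Or.inl ⟨_, _, _, _, _, (exchange z i b c f hb hc hf).pairExchange rfl rfl⟩)))
  exact this

/-- The main edge gives off a right end `c` and takes in a left end `b`, while the contractible edge
`f` carries the rest. The parities of `b` and `c` agree, so the main edge stays odd. -/
theorem LeftTower.exchange_pair {A : TropicalCover} {g n b c f : ℕ} {L R : Multiset ℕ}
    (h : LeftTower z A g (n + 1) (f + b) L R) (hn : n < s) (hb : Odd b) (hc : Odd c) (hf : 0 < f) :
    LeftTower z A g n (f + c) (b ::ₘ L) (c ::ₘ R) := by
  have hodd : Odd (f + c) := by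
    obtain ⟨r, hr⟩ := h.1
    obtain ⟨p, hp⟩ := hb
    obtain ⟨q, hq⟩ := hc
    exact ⟨r - p + q, by omega⟩
  have key := h.attach ⟨n, hn⟩ rfl hodd (block_exchange z ⟨n, hn⟩ b c f hb.pos hc.pos hf)
    (4 : Fin 5) (1 : Fin 5)
    (Or.inr h.1) (Or.inr hodd) rfl rfl rfl rfl
    (fun f hf => Dumbbell.table_not_parallel_exchange 4 f hf.1 hf.2.1 hf.2.2.1)
    (fun f hf => Dumbbell.table_not_parallel_exchange 1 f hf.1 hf.2.1 hf.2.2.1)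
  simpa using key

theorem LeftTower.splits {A : TropicalCover} {g : ℕ} (M : Multiset ℕ) : ∀ {n w : ℕ}
    {L R : Multiset ℕ}, LeftTower z A g (n + M.card) w L R → n + M.card ≤ s → (∀ k ∈ M, 0 < k) →
    LeftTower z A g n (w + 2 * M.sum) L (M + M + R) := by
  induction M using Multiset.induction with
  | empty => intro n w L R h _ _; simpa using h
  | cons k M ih =>
    intro n w L R h hn hM
    rw [Multiset.card_cons] at h hn
    have h1 := ih (n := n + 1) (by rwa [show n + 1 + M.card = n + (M.card + 1) by ring]) (by omega)
      (fun x hx => hM x (Multiset.mem_cons_of_mem hx))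
    have h2 := h1.split_pair (by omega) (hM k (Multiset.mem_cons_self k M))
    convert h2 using 1
    · rw [Multiset.sum_cons]; ring
    · simp only [← Multiset.singleton_add]; abel

theorem LeftTower.joins {A : TropicalCover} {g : ℕ} (M : Multiset ℕ) : ∀ {n w : ℕ}
    {L R : Multiset ℕ}, LeftTower z A g (n + M.card) (w + 2 * M.sum) L R → n + M.card ≤ s →
    (∀ k ∈ M, 0 < k) → 0 < w → LeftTower z A g n w (M + M + L) R := by
  induction M using Multiset.induction with
  | empty => intro n w L R h _ _ _; simpa using h
  | cons k M ih =>
    intro n w L R h hn hM hw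
    rw [Multiset.card_cons] at h hn
    rw [Multiset.sum_cons] at h
    have h1 := ih (n := n + 1) (w := w + 2 * k)
      (by convert h using 1 <;> ring) (by omega)
      (fun x hx => hM x (Multiset.mem_cons_of_mem hx)) (by omega)
    have h2 := h1.join_pair (by omega) (hM k (Multiset.mem_cons_self k M)) hw
    convert h2 using 1
    simp only [← Multiset.singleton_add]; abel

/-- Each odd right end is produced by an exchange against a left end of weight 1. The bound `2 ≤ w`
keeps the contractible edges at positive weight. -/
theorem LeftTower.emit {A : TropicalCover} {g : ℕ} (M : Multiset ℕ) : ∀ {n w w' : ℕ}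
    {L R : Multiset ℕ}, LeftTower z A g (n + M.card) w L R → n + M.card ≤ s →
    (∀ k ∈ M, Odd k) → 2 ≤ w → w' + M.card = w + M.sum →
    LeftTower z A g n w' (Multiset.replicate M.card 1 + L) (M + R) := by
  induction M using Multiset.induction with
  | empty =>
    intro n w w' L R h _ _ _ hw
    simp only [Multiset.card_zero, Multiset.sum_zero, add_zero] at hw
    subst hw
    simpa using h
  | cons k M ih =>
    intro n w w' L R h hn hM hw hw'
    rw [Multiset.card_cons] at h hn hw'
    rw [Multiset.sum_cons] at hw'
    have hk := (hM k (Multiset.mem_cons_self k M)).pos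
    have hle : M.card ≤ M.sum := by
      have := Multiset.card_nsmul_le_sum (s := M) (a := 1)
        (fun x hx => (hM x (Multiset.mem_cons_of_mem hx)).pos)
      simpa using this
    -- The contractible edge gets weight `w' - k`, so the weight behind the exchange is one more. By
    -- `hle` and `2 ≤ w` the subtraction is exact and its value is positive.
    have h1 := ih (n := n + 1) (w' := (w' - k) + 1)
      (by convert h using 1; ring) (by omega)
      (fun x hx => hM x (Multiset.mem_cons_of_mem hx)) hw (by omega)
    have h2 := h1.exchange_pair (by omega) odd_one (hM k (Multiset.mem_cons_self k M)) (by omega)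
    convert h2 using 1
    · omega
    · rw [Multiset.card_cons, Multiset.replicate_succ, Multiset.cons_add]
    · rw [Multiset.cons_add]

/-- Dual to `emit`: each odd left end is taken in against a right end of weight 1. Here the smallest
main edge is the leftmost one, so the bound is imposed on `w'`. -/
theorem LeftTower.absorb {A : TropicalCover} {g : ℕ} (M : Multiset ℕ) : ∀ {n w w' : ℕ}
    {L R : Multiset ℕ}, LeftTower z A g (n + M.card) w L R → n + M.card ≤ s →
    (∀ k ∈ M, Odd k) → 2 ≤ w' → w' + M.sum = w + M.card →
    LeftTower z A g n w' (M + L) (Multiset.replicate M.card 1 + R) := by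
  induction M using Multiset.induction with
  | empty =>
    intro n w w' L R h _ _ _ hw
    simp only [Multiset.card_zero, Multiset.sum_zero, add_zero] at hw
    subst hw
    simpa using h
  | cons k M ih =>
    intro n w w' L R h hn hM hw hw'
    rw [Multiset.card_cons] at h hn hw'
    rw [Multiset.sum_cons] at hw'
    have hk := (hM k (Multiset.mem_cons_self k M)).pos
    -- The contractible edge gets weight `w' - 1`, and the main edge behind the exchange carries `k`
    -- more.
    have h1 := ih (n := n + 1) (w' := (w' - 1) + k)
      (by convert h using 1; ring) (by omega)
      (fun x hx => hM x (Multiset.mem_cons_of_mem hx)) (by omega) (by omega)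
    have h2 := h1.exchange_pair (by omega) (hM k (Multiset.mem_cons_self k M)) odd_one (by omega)
    convert h2 using 1
    · omega
    · rw [Multiset.cons_add]
    · rw [Multiset.card_cons, Multiset.replicate_succ, Multiset.cons_add]

/-- There is a cover over all pairs which contains `A`, with a local picture over the first pair
as required for a properly mixed cover, whose outgoing edge is an end of weight `w`. -/
def PairSide (z : BranchDistribution s t) (A : TropicalCover) (g w : ℕ) (L R : Multiset ℕ) :
    Prop :=
  ∃ (C : TropicalCover) (SV : Set C.V) (SE : Set C.E) (i : Fin s) (v' v : C.V) (a k f b d : C.E),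
    Block z C ∅ SV SE Set.univ ∅ g L (w ::ₘ R) ∧ d ∈ SE ∧ C.tgt d = none ∧ C.weight d = w ∧
      Odd w ∧ (∀ f, ¬ C.Parallel d f) ∧ i.val = 0 ∧ C.pos v' = (z.x i).1 ∧ C.pos v = (z.x i).2 ∧
      C.PairExchange v' v a k f b d ∧ Even (C.weight f) ∧ Odd (C.weight k) ∧ C.src a = none ∧
      C.src b = none ∧ Odd (C.weight a) ∧ C.weight a = C.weight b ∧ Nonempty (Emb A C)

/-- Over the first pair an end `o = f + 1` splits into an edge of weight 1, which continues into the
tower, and the even edge `f`; this edge merges with the second end `o` into the characteristic edge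
of weight `f + o`. -/
theorem LeftTower.pairSide {A : TropicalCover} {g o f : ℕ} {L R : Multiset ℕ}
    (h : LeftTower z A g 1 1 L R) (hs : 0 < s) (ho : Odd o) (hf : 0 < f) (hfo : f + 1 = o) :
    PairSide z A g (f + o) (o ::ₘ o ::ₘ L) R := by
  obtain ⟨-, C, SV', SE', r, hC, hr, hrs, hrw, hrp, ⟨j⟩⟩ := h
  have hlt' : ∀ k ∈ ({⟨0, hs⟩} : Set (Fin s)), ∀ k' ∈ {k : Fin s | 1 ≤ k.val}, k < k' := by
    rintro k rfl k' hk'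
    exact Fin.lt_def.2 hk'
  have hev : Even f := by
    obtain ⟨r, hr⟩ := ho
    exact ⟨r, by omega⟩
  have hw : Odd (f + o) := hev.add_odd ho
  have hD := block_exchange z ⟨0, hs⟩ o 1 f ho.pos one_pos hf
  set T := exchange z ⟨0, hs⟩ o 1 f ho.pos one_pos hf with hT
  let G : Gluing T.cover C := Gluing.ofLt (2 : Fin 5) r rfl hrs hrw.symm
    (lt_of_range hD.image hC.image (points_lt_of_x hlt'))
  have hdis : Disjoint ({⟨0, hs⟩} : Set (Fin s)) {k | 1 ≤ k.val} := by
    rw [Set.disjoint_left]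
    intro k hk hk'
    exact (hlt' k hk k hk').ne rfl
  have hI : ({⟨0, hs⟩} : Set (Fin s)) ∪ {k | 1 ≤ k.val} = Set.univ := by
    ext k
    simp only [Set.mem_union, Set.mem_singleton_iff, Set.mem_ofPred_eq, Fin.ext_iff, Set.mem_univ,
      iff_true]
    omega
  have key := Block.join G (R := {f + o}) (L' := L) (R' := R) (J := ∅) (J' := ∅)
    (by
      have : T.cover.weight G.l ::ₘ ({f + o} : Multiset ℕ) = (f + o) ::ₘ {1} :=
        Multiset.cons_swap _ _ 0
      rw [this]; exact hD)
    (by rw [show C.weight G.r = 1 from hrw]; exact hC) (Set.empty_subset _) (Set.empty_subset _)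
    (Or.inr odd_one) hr odd_one
    (Or.inr fun f hf => Dumbbell.table_not_parallel_exchange 2 f hf.1 hf.2.1 hf.2.2.1)
    (Or.inr hrp) hdis
  rw [hI, Set.union_empty, zero_add, Multiset.singleton_add, hfo, Multiset.cons_add,
    Multiset.singleton_add] at key
  have hne : ∀ k : Fin 5, k ≠ 2 → (k : T.cover.E) ≠ G.l := fun k hk => hk
  refine ⟨G.join, _, _, ⟨0, hs⟩, G.embl.onV false, G.embl.onV true, _, _, _, _,
    G.embl.onE (4 : Fin 5), key, Or.inl ⟨(4 : Fin 5), Or.inr hw, rfl⟩, ?_, rfl, hw, ?_, rfl, rfl,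
    rfl, G.embl.pairExchange (T.pairExchange rfl rfl), hev, odd_one, ?_, ?_, ?_, ?_,
    ⟨j.trans G.embr⟩⟩
  · exact G.keeps_embl.tgt (4 : Fin 5) (hne 4 (by decide)) rfl
  · intro f hf
    obtain ⟨b, -, hb⟩ := G.keeps_embl.exists_parallel (hne 4 (by decide)) hf
    exact Dumbbell.table_not_parallel_exchange 4 b hb.1 hb.2.1 hb.2.2.1
  · exact G.keeps_embl.src (1 : Fin 5) (hne 1 (by decide)) rfl
  · exact G.keeps_embl.src (3 : Fin 5) (hne 3 (by decide)) rfl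
  · change Odd (f + 1)
    rwa [hfo]
  · exact hfo

/-! ### Towers over the single points -/

/-- There is a cover over the single points with index less than `n` which contains `B`, and which
has an odd right end of weight `w` in its core.  `L` and `R` are the weights of the other ends. -/
def RightTower (z : BranchDistribution s t) (B : TropicalCover) (g n w : ℕ) (L R : Multiset ℕ) :
    Prop :=
  Odd w ∧ ∃ (C : TropicalCover) (SV : Set C.V) (SE : Set C.E) (e : C.E),
    Block z C ∅ SV SE ∅ {j | j.val < n} g L (w ::ₘ R) ∧ e ∈ SE ∧ C.tgt e = none ∧
      C.weight e = w ∧ Nonempty (Emb B C)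

/-- Towers over the single points grow to the right. There are no patterns over pairs to protect
here, so the glued ends may belong to a symmetric fork, as long as the new piece allows for it by `W
⊆ {r}`. -/
theorem RightTower.attach {B : TropicalCover} {g n n' w w' : ℕ} {L R L' R' : Multiset ℕ}
    (h : RightTower z B g n w L R) (J : Set (Fin t)) (hJ : ∀ j, j ∈ J ↔ n ≤ j.val ∧ j.val < n')
    (hn : n ≤ n') (hw' : Odd w') {D : TropicalCover} {W : Set D.E} {SV : Set D.V} {SE : Set D.E}
    (hD : Block z D W SV SE ∅ J 0 (w ::ₘ L') (w' ::ₘ R')) (r e : D.E) (hW : W ⊆ {r})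
    (hr : r ∈ SE) (he : e ∈ SE) (hrt : D.src r = none) (het : D.tgt e = none)
    (hrw : D.weight r = w) (hew : D.weight e = w') :
    RightTower z B g n' w' (L' + L) (R' + R) := by
  obtain ⟨hw, C, SV', SE', l, hC, hl, hlt, hlw, ⟨i⟩⟩ := h
  have hlt' : ∀ k ∈ {k : Fin t | k.val < n}, ∀ k' ∈ J, k < k' := by
    intro k hk k' hk'
    exact Fin.lt_def.2 (lt_of_lt_of_le hk ((hJ k').1 hk').1)
  let G := Gluing.ofLt l r hlt hrt (hlw.trans hrw.symm)
    (lt_of_range hC.image hD.image (points_lt_of_y hlt'))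
  have hne : e ≠ G.r := (ne_of_src_tgt hrt het).symm
  have hI : {k : Fin t | k.val < n} ∪ J = {k | k.val < n'} := by
    ext k
    simp only [Set.mem_union, Set.mem_ofPred_eq, hJ]
    omega
  have key := Block.join G (R := R) (L' := L') (by rw [show C.weight G.l = w from hlw]; exact hC)
    (by rw [show D.weight G.r = w from hrw]; exact hD) (Set.empty_subset _) hW
    hl hr (by rw [show C.weight G.l = w from hlw]; exact hw) (Or.inl rfl) (Or.inl rfl)
    (Set.disjoint_empty _)
  rw [hI, Set.union_empty, add_zero, Multiset.add_cons, add_comm L, add_comm R] at key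
  exact ⟨hw', G.join, _, _, G.embr.onE e, key, Or.inr ⟨e, he, rfl⟩, G.keeps_embr.tgt e hne het,
    (G.embr.weight_eq e).trans hew, ⟨i.trans G.embl⟩⟩

/-- One vertex: the odd main edge takes in an even left end, which is a tail. -/
theorem RightTower.join_even {B : TropicalCover} {g n w k : ℕ} {L R : Multiset ℕ}
    (h : RightTower z B g n w L R) (hn : n < t) (hk : 0 < k) (hk' : Even k) :
    RightTower z B g (n + 1) (w + k) (k ::ₘ L) R := by
  have hw : 0 < w := h.1.pos
  have hodd : Odd (w + k) := h.1.add_even hk'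
  let T : Tripod :=
    { p := true, w := ![k, w, w + k]
      w_pos := by intro e; fin_cases e <;> simp [hk, hw]
      r := z.y ⟨n, hn⟩
      bal := (by omega : k + w = w + k + 0) }
  have hb := T.block z {(1 : Fin 3)} ⟨n, hn⟩ rfl
    (fun e f hef _ => Tripod.table_parallel _ e f hef.1 hef.2.1 hef.2.2.1)
  have hL : T.w 0 ::ₘ (if T.p then {T.w 1} else 0) = w ::ₘ ({k} : Multiset ℕ) :=
    Multiset.cons_swap _ _ 0
  rw [hL] at hb
  have key := h.attach (n' := n + 1) {⟨n, hn⟩}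
    (fun j => by rw [Set.mem_singleton_iff, Fin.ext_iff]; simp only; omega) (by omega)
    hodd (D := T.cover) (R' := 0) hb (1 : Fin 3) (2 : Fin 3) subset_rfl h.1 hodd rfl rfl rfl rfl
  simpa using key

theorem RightTower.split_even {B : TropicalCover} {g n w k : ℕ} {L R : Multiset ℕ}
    (h : RightTower z B g n (w + k) L R) (hn : n < t) (hk : 0 < k) (hw : 0 < w) (hk' : Even k) :
    RightTower z B g (n + 1) w L (k ::ₘ R) := by
  have hodd : Odd w := by
    obtain ⟨r, hr⟩ := h.1
    obtain ⟨q, hq⟩ := hk'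
    exact ⟨r - q, by omega⟩
  let T : Tripod :=
    { p := false, w := ![w + k, k, w]
      w_pos := by intro e; fin_cases e <;> simp [hk, hw]
      r := z.y ⟨n, hn⟩
      bal := (by omega : w + k + 0 = w + k) }
  have hwk : w ≠ k := fun h => (Nat.not_even_iff_odd.2 hodd) (h ▸ hk')
  -- Two parallel edges would include the edge `1`, whose weight `k` is even; so there is no odd
  -- symmetric fork.
  have hb := T.block z ∅ ⟨n, hn⟩ rfl (by
    intro e f hef ho
    exfalso
    have h1 : Odd (T.w e) := ho
    have h2 : T.w e = T.w f := hef.2.2.2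
    rcases Tripod.table_parallel _ e f hef.1 hef.2.1 hef.2.2.1 with rfl | rfl
    · exact (Nat.not_even_iff_odd.2 h1) hk'
    · rw [h2] at h1
      exact (Nat.not_even_iff_odd.2 h1) hk')
  have key := h.attach (n' := n + 1) (L' := 0) (R' := {k}) {⟨n, hn⟩}
    (fun j => by rw [Set.mem_singleton_iff, Fin.ext_iff]; simp only; omega) (by omega)
    hodd hb (0 : Fin 3) (2 : Fin 3) (Set.empty_subset _) h.1 hodd rfl rfl rfl rfl
  simpa using key

theorem mem_pair_iff {n : ℕ} (hn : n + 1 < t) (j : Fin t) :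
    j ∈ ({⟨n, by omega⟩, ⟨n + 1, hn⟩} : Set (Fin t)) ↔ n ≤ j.val ∧ j.val < n + 2 := by
  simp only [Set.mem_insert_iff, Set.mem_singleton_iff, Fin.ext_iff]
  omega

/-- Uses two points: two left ends of weight 1 merge, and the resulting even edge of weight 2 joins
the main edge. Edge and fork together form one tail. -/
theorem RightTower.fork_in {B : TropicalCover} {g n w : ℕ} {L R : Multiset ℕ}
    (h : RightTower z B g n w L R) (hn : n + 1 < t) :
    RightTower z B g (n + 2) (w + 2) (1 ::ₘ 1 ::ₘ L) R := by
  have hw : 0 < w := h.1.pos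
  have hodd : Odd (w + 2) := h.1.add_even even_two
  let T : Dumbbell :=
    { p := true, q := true, w := ![2, 1, 1, w, w + 2]
      w_pos := by intro e; fin_cases e <;> simp [hw]
      r := fun b => if b then z.y ⟨n + 1, hn⟩ else z.y ⟨n, by omega⟩
      r_lt := z.y_mono (Fin.lt_def.2 (Nat.lt_succ_self n))
      bal₀ := rfl
      bal₁ := (by omega : 2 + w = w + 2 + 0) }
  have hb := T.block_fork_in z (j := ⟨n, by omega⟩) (j' := ⟨n + 1, hn⟩) rfl rfl rfl rfl h.1 hodd
  have hL : T.w 1 ::ₘ ((if T.p then {T.w 2} else 0) + if T.q then {T.w 3} else 0) =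
      w ::ₘ ({1, 1} : Multiset ℕ) := by
    change 1 ::ₘ (({1} : Multiset ℕ) + {w}) = w ::ₘ ({1, 1} : Multiset ℕ)
    simp only [← Multiset.singleton_add, Multiset.insert_eq_cons]
    abel
  rw [hL] at hb
  have key := h.attach (n' := n + 2) (R' := 0) _ (mem_pair_iff hn) (by omega)
    hodd hb (3 : Fin 5) (4 : Fin 5) subset_rfl (Or.inl rfl) (Or.inr rfl) rfl rfl rfl rfl
  simpa using key

theorem RightTower.fork_out {B : TropicalCover} {g n w : ℕ} {L R : Multiset ℕ}
    (h : RightTower z B g n (w + 2) L R) (hn : n + 1 < t) :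
    RightTower z B g (n + 2) w L (1 ::ₘ 1 ::ₘ R) := by
  have hodd : Odd w := by
    obtain ⟨r, hr⟩ := h.1
    exact ⟨r - 1, by omega⟩
  have hw : 0 < w := hodd.pos
  let T : Dumbbell :=
    { p := false, q := false, w := ![2, w + 2, w, 1, 1]
      w_pos := by intro e; fin_cases e <;> simp [hw]
      r := fun b => if b then z.y ⟨n + 1, hn⟩ else z.y ⟨n, by omega⟩
      r_lt := z.y_mono (Fin.lt_def.2 (Nat.lt_succ_self n))
      bal₀ := (by omega : w + 2 + 0 = 2 + w)
      bal₁ := rfl }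
  have hb := T.block_fork_out z (j := ⟨n, by omega⟩) (j' := ⟨n + 1, hn⟩) rfl rfl rfl rfl rfl h.1
    hodd
  have hR : T.w 4 ::ₘ ((if T.p then 0 else {T.w 2}) + if T.q then 0 else {T.w 3}) =
      w ::ₘ ({1, 1} : Multiset ℕ) := by
    change 1 ::ₘ (({w} : Multiset ℕ) + {1}) = w ::ₘ ({1, 1} : Multiset ℕ)
    simp only [← Multiset.singleton_add, Multiset.insert_eq_cons]
    abel
  rw [hR] at hb
  have key := h.attach (n' := n + 2) (L' := 0) _ (mem_pair_iff hn) (by omega)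
    hodd hb (1 : Fin 5) (2 : Fin 5) (Set.empty_subset _) (Or.inl rfl) (Or.inr rfl) rfl rfl rfl rfl
  simpa using key

theorem RightTower.joins {B : TropicalCover} {g : ℕ} (M : Multiset ℕ) : ∀ {n w : ℕ}
    {L R : Multiset ℕ}, RightTower z B g n w L R → n + M.card ≤ t → (∀ k ∈ M, 0 < k ∧ Even k) →
    RightTower z B g (n + M.card) (w + M.sum) (M + L) R := by
  induction M using Multiset.induction with
  | empty => intro n w L R h _ _; simpa using h
  | cons k M ih =>
    intro n w L R h hn hM
    rw [Multiset.card_cons] at hn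
    have hk := hM k (Multiset.mem_cons_self k M)
    have h1 := ih (h.join_even (by omega) hk.1 hk.2) (by omega)
      (fun x hx => hM x (Multiset.mem_cons_of_mem hx))
    convert h1 using 1
    · rw [Multiset.card_cons]; ring
    · rw [Multiset.sum_cons]; ring
    · simp only [← Multiset.singleton_add]; abel

theorem RightTower.splits {B : TropicalCover} {g : ℕ} (M : Multiset ℕ) : ∀ {n w : ℕ}
    {L R : Multiset ℕ}, RightTower z B g n (w + M.sum) L R → n + M.card ≤ t →
    (∀ k ∈ M, 0 < k ∧ Even k) → 0 < w → RightTower z B g (n + M.card) w L (M + R) := by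
  induction M using Multiset.induction with
  | empty => intro n w L R h _ _ _; simpa using h
  | cons k M ih =>
    intro n w L R h hn hM hw
    rw [Multiset.card_cons] at hn
    rw [Multiset.sum_cons] at h
    have hk := hM k (Multiset.mem_cons_self k M)
    have h0 : RightTower z B g n ((w + M.sum) + k) L R := by convert h using 1; ring
    have h1 := ih (h0.split_even (by omega) hk.1 (by omega) hk.2) (by omega)
      (fun x hx => hM x (Multiset.mem_cons_of_mem hx)) hw
    convert h1 using 1
    · rw [Multiset.card_cons]; ring
    · simp only [← Multiset.singleton_add]; abel

theorem RightTower.forks_in {B : TropicalCover} {g : ℕ} (c : ℕ) : ∀ {n w : ℕ}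
    {L R : Multiset ℕ}, RightTower z B g n w L R → n + 2 * c ≤ t →
    RightTower z B g (n + 2 * c) (w + 2 * c) (Multiset.replicate (2 * c) 1 + L) R := by
  induction c with
  | zero => intro n w L R h _; simpa using h
  | succ c ih =>
    intro n w L R h hn
    have h1 := ih (h.fork_in (by omega)) (by omega)
    convert h1 using 1
    · ring
    · ring
    · rw [show 2 * (c + 1) = 2 * c + 1 + 1 by ring, Multiset.replicate_succ,
        Multiset.replicate_succ]
      simp only [← Multiset.singleton_add]; abel

theorem RightTower.forks_out {B : TropicalCover} {g : ℕ} (c : ℕ) : ∀ {n w : ℕ}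
    {L R : Multiset ℕ}, RightTower z B g n (w + 2 * c) L R → n + 2 * c ≤ t →
    RightTower z B g (n + 2 * c) w L (Multiset.replicate (2 * c) 1 + R) := by
  induction c with
  | zero => intro n w L R h _; simpa using h
  | succ c ih =>
    intro n w L R h hn
    have h0 : RightTower z B g n (w + 2 * c + 2) L R := by
      convert h using 1; ring
    have h1 := ih (h0.fork_out (by omega)) (by omega)
    convert h1 using 1
    · ring
    · rw [show 2 * (c + 1) = 2 * c + 1 + 1 by ring, Multiset.replicate_succ,
        Multiset.replicate_succ]
      simp only [← Multiset.singleton_add]; abel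

/-- There is a cover over all single points which contains `B` and has two odd edges which enter the
vertex over the last point, one of which is a left end of weight `w`. -/
def PointSide (z : BranchDistribution s t) (B : TropicalCover) (g w : ℕ) (L R : Multiset ℕ) :
    Prop :=
  ∃ (C : TropicalCover) (SV : Set C.V) (SE : Set C.E) (j : Fin t) (v : C.V) (p q : C.E),
    Block z C ∅ SV SE ∅ Set.univ g (w ::ₘ L) R ∧ q ∈ SE ∧ C.src q = none ∧ C.tgt q = some v ∧
      C.weight q = w ∧ j.val + 1 = t ∧ C.pos v = z.y j ∧ p ≠ q ∧ C.inE v = {p, q} ∧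
      Odd (C.weight p) ∧ Nonempty (Emb B C)

/-- The last vertex has two odd incoming edges: the end of the tower and an end of weight `w'`,
which is to become the characteristic edge. The outgoing edge is even and forms a tail. -/
theorem RightTower.pointSide {B : TropicalCover} {g n w w' : ℕ} {L R : Multiset ℕ}
    (h : RightTower z B g n w L R) (hn : n + 1 = t) (hw' : Odd w') :
    PointSide z B g w' L ((w + w') ::ₘ R) := by
  obtain ⟨hw, C, SV', SE', l, hC, hl, hlt, hlw, ⟨i⟩⟩ := h
  let T : Tripod :=
    { p := true, w := ![w', w, w + w']
      w_pos := by intro e; fin_cases e <;> simp [hw'.pos, hw.pos]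
      r := z.y ⟨n, by omega⟩
      bal := (by omega : w' + w = w + w' + 0) }
  -- If `w = w'`, the two incoming ends form a symmetric fork until the edge `1` is glued to the
  -- tower.
  have hD := T.block z {(1 : Fin 3)} ⟨n, by omega⟩ rfl
    (fun e f hef _ => Tripod.table_parallel _ e f hef.1 hef.2.1 hef.2.2.1)
  have hL : T.w 0 ::ₘ (if T.p then {T.w 1} else 0) = w ::ₘ ({w'} : Multiset ℕ) :=
    Multiset.cons_swap _ _ 0
  have hR : T.w 2 ::ₘ (if T.p then 0 else {T.w 1}) = {w + w'} := rfl
  rw [hL, hR] at hD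
  have hlt' : ∀ k ∈ {k : Fin t | k.val < n}, ∀ k' ∈ ({⟨n, by omega⟩} : Set (Fin t)), k < k' := by
    rintro k hk k' rfl
    exact Fin.lt_def.2 hk
  let G : Gluing C T.cover := Gluing.ofLt l (1 : Fin 3) hlt rfl hlw
    (lt_of_range hC.image hD.image (points_lt_of_y hlt'))
  have hI : {k : Fin t | k.val < n} ∪ {⟨n, by omega⟩} = Set.univ := by
    ext k
    simp only [Set.mem_union, Set.mem_ofPred_eq, Set.mem_singleton_iff, Fin.ext_iff, Set.mem_univ,
      iff_true]
    omega
  have key := Block.join G (R := R) (L' := {w'})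
    (by rw [show C.weight G.l = w from hlw]; exact hC)
    hD (Set.empty_subset _) subset_rfl
    hl hw (by rw [show C.weight G.l = w from hlw]; exact hw) (Or.inl rfl) (Or.inl rfl)
    (Set.disjoint_empty _)
  rw [hI, Set.union_empty, add_zero, add_comm L, Multiset.singleton_add, add_comm R,
    Multiset.singleton_add] at key
  have hne : ((0 : Fin 3) : T.cover.E) ≠ G.r := (by decide : (0 : Fin 3) ≠ 1)
  have hin : T.cover.inE () = {(1 : Fin 3), (0 : Fin 3)} :=
    Set.ext (by decide : ∀ e, Tripod.tgtTable true e = some () ↔ e = 1 ∨ e = 0)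
  refine ⟨G.join, _, _, ⟨n, by omega⟩, G.embr.onV (), G.embr.onE (1 : Fin 3),
    G.embr.onE (0 : Fin 3), key, Or.inr ⟨(0 : Fin 3), hw', rfl⟩, G.keeps_embr.src _ hne rfl,
    G.embr.tgt_onE.2 rfl, (G.embr.weight_eq _).trans rfl, hn, rfl,
    G.embr.injE.ne hne.symm, ?_, ?_, ⟨i.trans G.embl⟩⟩
  · exact (G.embr.inE_onV _).trans ((congrArg _ hin).trans (Set.image_pair _ _ _))
  · exact (congrArg Odd (G.embr.weight_eq (1 : Fin 3))).mpr hw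

/-- A block over single points with an odd left end of weight one in its core is the beginning of a
tower over the single points. -/
theorem Block.rightTower {B : TropicalCover} {g n : ℕ} {L R : Multiset ℕ} {SV : Set B.V}
    {SE : Set B.E} (hB : Block z B ∅ SV SE ∅ {j | 2 ≤ j.val ∧ j.val < n} g (1 ::ₘ L) R) (r : B.E)
    (hr : r ∈ SE) (hrs : B.src r = none) (hrw : B.weight r = 1) (hn : 2 ≤ n) (ht : n ≤ t) :
    RightTower z B g n 1 (1 ::ₘ 1 ::ₘ L) R := by
  -- The edge `0` has weight 2 and splits into the right ends `3` and `4` of weight 1. They form a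
  -- symmetric fork until `3` is glued to `B`; then `4` is the end from which the tower continues,
  -- and it bypasses `B`.
  let T : Dumbbell :=
    { p := true, q := false, w := ![2, 1, 1, 1, 1]
      w_pos := by intro e; fin_cases e <;> simp
      r := fun b => if b then z.y ⟨0 + 1, by omega⟩ else z.y ⟨0, by omega⟩
      r_lt := z.y_mono (Fin.lt_def.2 (Nat.lt_succ_self _))
      bal₀ := rfl
      bal₁ := rfl }
  have hD := T.block_fork_in z (j := ⟨0, by omega⟩) (j' := ⟨0 + 1, by omega⟩) rfl rfl rfl rfl
    odd_one odd_one
  have hL : T.w 1 ::ₘ ((if T.p then {T.w 2} else 0) + if T.q then {T.w 3} else 0) =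
      1 ::ₘ {1} := rfl
  have hR : T.w 4 ::ₘ ((if T.p then 0 else {T.w 2}) + if T.q then 0 else {T.w 3}) =
      1 ::ₘ {1} := rfl
  rw [hL, hR] at hD
  have hJ := mem_pair_iff (t := t) (n := 0) (by omega)
  have hlt' : ∀ k ∈ ({⟨0, by omega⟩, ⟨0 + 1, by omega⟩} : Set (Fin t)),
      ∀ k' ∈ {j : Fin t | 2 ≤ j.val ∧ j.val < n}, k < k' := by
    rintro k hk k' hk'
    have h1 := (hJ k).1 hk
    have h2 : 2 ≤ k'.val := hk'.1
    exact Fin.lt_def.2 (by omega)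
  let G : Gluing T.cover B := Gluing.ofLt (3 : Fin 5) r rfl hrs hrw.symm
    (lt_of_range hD.image hB.image (points_lt_of_y hlt'))
  have hI : ({⟨0, by omega⟩, ⟨0 + 1, by omega⟩} : Set (Fin t)) ∪
      {j | 2 ≤ j.val ∧ j.val < n} = {j | j.val < n} := by
    ext k
    rw [Set.mem_union, hJ]
    simp only [Set.mem_ofPred_eq]
    omega
  have key := Block.join G (R := {1}) (L' := L) hD
    (by rw [show B.weight G.r = 1 from hrw]; exact hB) subset_rfl (Set.empty_subset _)
    (Or.inl rfl) hr odd_one (Or.inl rfl) (Or.inl rfl) (Set.disjoint_empty _)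
  rw [hI, Set.union_empty, zero_add, Multiset.singleton_add, Multiset.cons_add,
    Multiset.singleton_add] at key
  have hne : ((4 : Fin 5) : T.cover.E) ≠ G.l := (by decide : (4 : Fin 5) ≠ 3)
  refine ⟨odd_one, G.join, _, _, G.embl.onE (4 : Fin 5), key, Or.inl ⟨(4 : Fin 5), Or.inr rfl, rfl⟩,
    G.keeps_embl.tgt _ hne rfl, rfl, ⟨G.embr⟩⟩

end TropicalCover

namespace TropicalCover

variable {s t s' t' : ℕ} {z : BranchDistribution s t} {z' : BranchDistribution s' t'}

/-! ### Moving the branch points -/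

/-- The cover with the same source and other images of the vertices. -/
noncomputable def repos (C : TropicalCover) (pos' : C.V → ℝ)
    (h : ∀ u v, C.pos u < C.pos v → pos' u < pos' v) : TropicalCover :=
  ofNet C.V C.E C.src C.tgt C.weight pos' C.nonempty C.incident C.connected C.trivalent
    C.weight_pos (fun _ u v hu hv => h u v (C.pos_lt hu hv)) C.balanced

theorem isTail_repos {C : TropicalCover} {pos' : C.V → ℝ}
    {h : ∀ u v, C.pos u < C.pos v → pos' u < pos' v} {n f : C.E → Option C.V} {SV : Set C.V}
    {r : C.E} {T : Set C.E} (hT : C.IsTail n f SV r T) : (C.repos pos' h).IsTail n f SV r T := by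
  induction hT with
  | single r h1 h2 => exact IsTail.single (C := C.repos pos' h) r h1 h2
  | fork r a b v h1 h2 h3 h4 h5 h6 h7 =>
    exact IsTail.fork (C := C.repos pos' h) r a b v h1 h2 h3 h4 h5 h6 h7
  | cycle r a b r' v u T h1 h2 h3 h4 h5 h6 h7 h8 h9 _ ih =>
    exact IsTail.cycle (C := C.repos pos' h) r a b r' v u T h1 h2 h3 h4 h5 h6 h7 h8 h9 ih

/-- `ψ` maps the points of `z'` to points of `z`, in an order preserving way. -/
structure PointMap (z' : BranchDistribution s' t') (z : BranchDistribution s t)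
    (σ : Fin s' → Fin s) (τ : Fin t' → Fin t) (ψ : ℝ → ℝ) : Prop where
  inj : Function.Injective σ
  fst : ∀ i, ψ (z'.x i).1 = (z.x (σ i)).1
  snd : ∀ i, ψ (z'.x i).2 = (z.x (σ i)).2
  pt : ∀ j, ψ (z'.y j) = z.y (τ j)
  mono : ∀ r ∈ z'.xPoints ∪ z'.yPoints, ∀ r' ∈ z'.xPoints ∪ z'.yPoints, r < r' → ψ r < ψ r'

/-- The pairs may be spread out in `z`, with other points in between; only their order matters. -/
theorem exists_pointMap_x (z' : BranchDistribution s' 0) (z : BranchDistribution s t)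
    (σ : Fin s' → Fin s) (hσ : StrictMono σ) : ∃ ψ, PointMap z' z σ Fin.elim0 ψ := by
  classical
  -- The value 0 away from the branch points is irrelevant: vertices lie over branch points only.
  let ψ : ℝ → ℝ := fun r =>
    if h : ∃ i, r = (z'.x i).1 then (z.x (σ h.choose)).1 else
      if h : ∃ i, r = (z'.x i).2 then (z.x (σ h.choose)).2 else 0
  have h1 : ∀ i, ψ (z'.x i).1 = (z.x (σ i)).1 := by
    intro i
    have h : ∃ k, (z'.x i).1 = (z'.x k).1 := ⟨i, rfl⟩
    simp only [ψ, dif_pos h]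
    rw [z'.x_index_unique (z'.mem_pair (Or.inl rfl)) (z'.mem_pair (Or.inl rfl)) h.choose_spec.symm]
  have h2 : ∀ i, ψ (z'.x i).2 = (z.x (σ i)).2 := by
    intro i
    have h' : ¬ ∃ k, (z'.x i).2 = (z'.x k).1 := by
      rintro ⟨k, hk⟩
      have := z'.x_index_unique (z'.mem_pair (Or.inr rfl)) (z'.mem_pair (Or.inl rfl)) hk
      subst this
      exact (z'.x_lt i).ne' hk
    have h : ∃ k, (z'.x i).2 = (z'.x k).2 := ⟨i, rfl⟩
    simp only [ψ, dif_pos h, dif_neg h']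
    rw [z'.x_index_unique (z'.mem_pair (Or.inr rfl)) (z'.mem_pair (Or.inr rfl)) h.choose_spec.symm]
  refine ⟨ψ, hσ.injective, h1, h2, fun j => j.elim0, ?_⟩
  rintro r (⟨i, hr⟩ | ⟨j, -⟩) r' (⟨i', hr'⟩ | ⟨j, -⟩) hlt
  · have hψ : ∀ r i, r = (z'.x i).1 ∨ r = (z'.x i).2 →
        ψ r = (z.x (σ i)).1 ∨ ψ r = (z.x (σ i)).2 := by
      rintro r i (rfl | rfl)
      · exact Or.inl (h1 i)
      · exact Or.inr (h2 i)
    rcases lt_trichotomy i i' with h | h | h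
    · have e1 := (z.mem_pair (hψ r i hr)).2
      have e2 := (z.mem_pair (hψ r' i' hr')).1
      have e3 := z.x_mono _ _ (hσ h)
      linarith
    · subst h
      have e := z'.x_lt i
      rcases hr with rfl | rfl <;> rcases hr' with rfl | rfl
      · exact absurd hlt (lt_irrefl _)
      · rw [h1, h2]; exact z.x_lt _
      · linarith
      · exact absurd hlt (lt_irrefl _)
    · have e1 := (z'.mem_pair hr).1
      have e2 := (z'.mem_pair hr').2
      have e3 := z'.x_mono _ _ h
      linarith
  · exact j.elim0
  · exact j.elim0
  · exact j.elim0

theorem exists_pointMap_y (z' : BranchDistribution 0 t') (z : BranchDistribution s t)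
    (τ : Fin t' → Fin t) (hτ : StrictMono τ) : ∃ ψ, PointMap z' z Fin.elim0 τ ψ := by
  classical
  let ψ : ℝ → ℝ := fun r => if h : ∃ i, r = z'.y i then z.y (τ h.choose) else 0
  have h1 : ∀ i, ψ (z'.y i) = z.y (τ i) := by
    intro i
    have h : ∃ k, z'.y i = z'.y k := ⟨i, rfl⟩
    simp only [ψ, dif_pos h]
    rw [← z'.y_mono.injective h.choose_spec]
  refine ⟨ψ, fun i => i.elim0, fun i => i.elim0, fun i => i.elim0, h1, ?_⟩
  rintro r (⟨i, -⟩ | ⟨j, rfl⟩) r' (⟨i, -⟩ | ⟨j', rfl⟩) hlt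
  · exact i.elim0
  · exact i.elim0
  · exact i.elim0
  · rw [h1, h1]
    exact z.y_mono (hτ (z'.y_mono.lt_iff_lt.1 hlt))

namespace PointMap

variable {σ : Fin s' → Fin s} {τ : Fin t' → Fin t} {ψ : ℝ → ℝ}

theorem injOn (hψ : PointMap z' z σ τ ψ) : Set.InjOn ψ (z'.xPoints ∪ z'.yPoints) := by
  intro r hr r' hr' h
  rcases lt_trichotomy r r' with hlt | hlt | hlt
  · exact absurd h (hψ.mono r hr r' hr' hlt).ne
  · exact hlt
  · exact absurd h (hψ.mono r' hr' r hr hlt).ne'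

theorem image_points (hψ : PointMap z' z σ τ ψ) :
    ψ '' (z'.xPoints ∪ z'.yPoints) = z.points (Set.range σ) (Set.range τ) := by
  ext r
  constructor
  · rintro ⟨_, ⟨i, rfl | rfl⟩ | ⟨j, rfl⟩, rfl⟩
    · exact Or.inl ⟨σ i, ⟨i, rfl⟩, Or.inl (hψ.fst i)⟩
    · exact Or.inl ⟨σ i, ⟨i, rfl⟩, Or.inr (hψ.snd i)⟩
    · exact Or.inr ⟨τ j, ⟨j, rfl⟩, (hψ.pt j).symm⟩
  · rintro (⟨_, ⟨i, rfl⟩, rfl | rfl⟩ | ⟨_, ⟨j, rfl⟩, rfl⟩)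
    · exact ⟨_, Or.inl ⟨i, Or.inl rfl⟩, hψ.fst i⟩
    · exact ⟨_, Or.inl ⟨i, Or.inr rfl⟩, hψ.snd i⟩
    · exact ⟨_, Or.inr ⟨j, rfl⟩, hψ.pt j⟩

/-- Lower points of pairs come only from lower points of pairs. With `eq_snd` and the injectivity of
`σ`, this shows that moving a cover creates no contractible edges. -/
theorem eq_fst (hψ : PointMap z' z σ τ ψ) {r : ℝ} (hr : r ∈ z'.xPoints ∪ z'.yPoints)
    {i : Fin s} (h : ψ r = (z.x i).1) :
    ∃ k, σ k = i ∧ r = (z'.x k).1 := by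
  rcases hr with ⟨k, rfl | rfl⟩ | ⟨j, rfl⟩
  · rw [hψ.fst] at h
    exact ⟨k, z.x_index_unique (z.mem_pair (Or.inl rfl)) (z.mem_pair (Or.inl rfl)) h, rfl⟩
  · rw [hψ.snd] at h
    have := z.x_index_unique (z.mem_pair (Or.inr rfl)) (z.mem_pair (Or.inl rfl)) h
    subst this
    exact absurd h (z.x_lt _).ne'
  · rw [hψ.pt] at h
    exact absurd (z.mem_pair (Or.inl h)) (z.sep _ _)

theorem eq_snd (hψ : PointMap z' z σ τ ψ) {r : ℝ} (hr : r ∈ z'.xPoints ∪ z'.yPoints)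
    {i : Fin s} (h : ψ r = (z.x i).2) :
    ∃ k, σ k = i ∧ r = (z'.x k).2 := by
  rcases hr with ⟨k, rfl | rfl⟩ | ⟨j, rfl⟩
  · rw [hψ.fst] at h
    have := z.x_index_unique (z.mem_pair (Or.inl rfl)) (z.mem_pair (Or.inr rfl)) h
    subst this
    exact absurd h (z.x_lt _).ne
  · rw [hψ.snd] at h
    exact ⟨k, z.x_index_unique (z.mem_pair (Or.inr rfl)) (z.mem_pair (Or.inr rfl)) h, rfl⟩
  · rw [hψ.pt] at h
    exact absurd (z.mem_pair (Or.inr h)) (z.sep _ _)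

end PointMap

section move

variable {σ : Fin s' → Fin s} {τ : Fin t' → Fin t} {ψ : ℝ → ℝ} (hψ : PointMap z' z σ τ ψ)
  {C : TropicalCover} {g : ℕ} {lam mu : Multiset ℕ}

theorem HasType.pos_mem (hC : C.HasType z' g lam mu) (v : C.V) :
    C.pos v ∈ z'.xPoints ∪ z'.yPoints := hC.image ▸ Set.mem_range_self v

/-- The cover moved to the points of `z`. -/
noncomputable def move (hψ : PointMap z' z σ τ ψ) (hC : C.HasType z' g lam mu) : TropicalCover :=
  C.repos (fun v => ψ (C.pos v))
    fun u v h => hψ.mono _ (hC.pos_mem u) _ (hC.pos_mem v) h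

theorem range_pos_move (hC : C.HasType z' g lam mu) :
    Set.range (move hψ hC).pos = z.points (Set.range σ) (Set.range τ) := by
  rw [← hψ.image_points, ← hC.image]
  exact Set.range_comp ψ C.pos

theorem isContractible_move (hC : C.HasType z' g lam mu) (e : C.E) :
    (move hψ hC).IsContractible z e ↔ C.IsContractible z' e := by
  constructor
  · rintro ⟨i, u, v, hu, hv, pu, pv⟩
    obtain ⟨k, hk, hk'⟩ := hψ.eq_fst (hC.pos_mem u) pu
    obtain ⟨l, hl, hl'⟩ := hψ.eq_snd (hC.pos_mem v) pv
    have : k = l := hψ.inj (hk.trans hl.symm)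
    subst this
    exact ⟨k, u, v, hu, hv, hk', hl'⟩
  · rintro ⟨i, u, v, hu, hv, pu, pv⟩
    refine ⟨σ i, u, v, hu, hv, ?_, ?_⟩
    · change ψ (C.pos u) = _
      rw [pu, hψ.fst]
    · change ψ (C.pos v) = _
      rw [pv, hψ.snd]

theorem nonempty_iso_of_move {D : TropicalCover} (hC : C.HasType z' g lam mu)
    (hD : D.HasType z' g lam mu) (f : Iso (move hψ hC) (move hψ hD)) : Nonempty (Iso C D) :=
  ⟨⟨f.onV, f.onE, f.src_eq, f.tgt_eq, f.weight_eq, fun v =>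
    hψ.injOn (hD.pos_mem _) (hC.pos_mem _) (f.pos_eq v)⟩⟩

theorem isTailAt_move (hC : C.HasType z' g lam mu) {SV : Set C.V} {T : Set C.E}
    (h : C.IsTailAt SV T) : (move hψ hC).IsTailAt SV T := by
  obtain ⟨r, v, hv, ⟨h1, h2⟩ | ⟨h1, h2⟩⟩ := h
  · exact ⟨r, v, hv, Or.inl ⟨h1, isTail_repos h2⟩⟩
  · exact ⟨r, v, hv, Or.inr ⟨h1, isTail_repos h2⟩⟩

/-- A zigzag cover moved to points of `z` is a block. -/
theorem IsZigzagCore.block_move {SV : Set C.V} {SE : Set C.E} (hC : C.HasType z' g lam mu)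
    (hr : C.IsResolving z') (hS : C.IsZigzagCore z' SV SE) :
    Block z (move hψ hC) ∅ SV SE (Set.range σ) (Set.range τ) g lam mu where
  genus := hC.genus
  image := range_pos_move hψ hC
  left := by
    classical
    rw [leftEnds, sum_ite_singleton]
    refine Eq.trans ?_ hC.left
    congr
  right := by
    classical
    rw [rightEnds, sum_ite_singleton]
    refine Eq.trans ?_ hC.right
    congr
  resolving := by
    rintro _ ⟨i, rfl⟩
    obtain ⟨u, v, hu, hv, h⟩ := hr i
    refine ⟨u, v, ?_, ?_, h⟩
    · change ψ (C.pos u) = _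
      rw [hu, hψ.fst]
    · change ψ (C.pos v) = _
      rw [hv, hψ.snd]
  subgraph := hS.subgraph
  nonempty := hS.nonempty
  connected := hS.connected
  disjoint := by
    rintro p ⟨⟨h1, h2⟩, h3⟩ - e he
    refine hS.disjoint p ⟨⟨h1, fun x hx hc => h2 x hx ((isContractible_move hψ hC x).2 hc)⟩, ?_⟩ e he
    rintro ⟨x, hx, f, v, hf, h⟩
    exact h3 ⟨x, hx, f, v, (isContractible_move hψ hC f).2 hf, h⟩
  contractible e he := hS.contractible e ((isContractible_move hψ hC e).1 he)
  odd e he h := (isContractible_move hψ hC e).2 (hS.odd e he h)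
  tails e he := by
    obtain ⟨T, hT, h⟩ := hS.tails e he
    exact ⟨T, hT, isTailAt_move hψ hC h⟩

end move

/-! ### Covers all of whose ends have weight one -/

theorem weight_of_src_none {C : TropicalCover} {g k : ℕ} {mu : Multiset ℕ}
    (hC : C.HasType z g (ones k) mu) {e : C.E} (h : C.src e = none) : C.weight e = 1 := by
  refine Multiset.eq_of_mem_replicate (n := k) ?_
  rw [← ones, ← hC.left]
  exact Multiset.mem_map_of_mem _ (Finset.mem_filter.2 ⟨Finset.mem_univ _, h⟩)

theorem weight_of_tgt_none {C : TropicalCover} {g k : ℕ} {lam : Multiset ℕ}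
    (hC : C.HasType z g lam (ones k)) {e : C.E} (h : C.tgt e = none) : C.weight e = 1 := by
  refine Multiset.eq_of_mem_replicate (n := k) ?_
  rw [← ones, ← hC.right]
  exact Multiset.mem_map_of_mem _ (Finset.mem_filter.2 ⟨Finset.mem_univ _, h⟩)

/-- A count: in genus 0 with `k` ends on either side there are `2 * k - 2 = 2 * s` vertices, exactly
as many as points, and every point is attained. -/
theorem pos_injective_of_pairs {z : BranchDistribution s 0} {C : TropicalCover} {k : ℕ}
    (hC : C.HasType z 0 (ones k) (ones k)) (hs : s + 1 = k) : Function.Injective C.pos := by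
  classical
  let pt : Fin s × Bool → ℝ := fun q => if q.2 then (z.x q.1).2 else (z.x q.1).1
  have hpt : Function.Injective pt := by
    have hmem : ∀ q, pt q = (z.x q.1).1 ∨ pt q = (z.x q.1).2 := by
      rintro ⟨i, b⟩
      cases b <;> simp [pt]
    rintro ⟨i, b⟩ ⟨i', b'⟩ h
    have := z.x_index_unique (z.mem_pair (hmem _)) (z.mem_pair (hmem _)) h
    simp only at this
    subst this
    have hlt := z.x_lt i
    cases b <;> cases b' <;> simp [pt] at h ⊢ <;> linarith
  have hcard : Fintype.card C.V = s * 2 := by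
    rw [hC.card.1]
    simp only [ones, Multiset.card_replicate]
    omega
  have him : Finset.univ.image C.pos = Finset.univ.image pt := by
    ext r
    have : r ∈ Set.range C.pos ↔ r ∈ Set.range pt := by
      rw [hC.image]
      constructor
      · rintro (⟨i, rfl | rfl⟩ | ⟨j, -⟩)
        · exact ⟨(i, false), rfl⟩
        · exact ⟨(i, true), rfl⟩
        · exact j.elim0
      · rintro ⟨⟨i, b⟩, rfl⟩
        cases b
        · exact Or.inl ⟨i, Or.inl rfl⟩
        · exact Or.inl ⟨i, Or.inr rfl⟩
    simpa using this
  have h2 : (Finset.univ.image C.pos).card = (Finset.univ : Finset C.V).card := by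
    rw [him, Finset.card_image_of_injective _ hpt, Finset.card_univ, Finset.card_univ, hcard,
      Fintype.card_prod, Fintype.card_fin, Fintype.card_bool]
  exact fun u v h => Finset.card_image_iff.1 h2 (Finset.mem_univ u) (Finset.mem_univ v) h

/-- A cover over pairs with ends of weight one has a left end in the core which belongs to no
fork. -/
theorem exists_left_end_of_pairs {z : BranchDistribution s 0} {C : TropicalCover} {k : ℕ}
    {SV : Set C.V} {SE : Set C.E} (hC : C.HasType z 0 (ones k) (ones k)) (hs : s + 1 = k)
    (hs' : 0 < s) (hr : C.IsResolving z) (hS : C.IsZigzagCore z SV SE) :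
    ∃ c ∈ SE, C.src c = none ∧ ∀ f, ¬ C.Parallel c f := by
  have hinj := pos_injective_of_pairs hC hs
  obtain ⟨u, v, hu, hv, hp⟩ := hr ⟨0, hs'⟩
  have hmin : ∀ r ∈ z.xPoints ∪ z.yPoints, r < (z.x ⟨0, hs'⟩).2 → r = (z.x ⟨0, hs'⟩).1 := by
    rintro r (⟨i, hi⟩ | ⟨j, -⟩) hlt
    · rcases Nat.eq_zero_or_pos i.val with h | h
      · have : i = ⟨0, hs'⟩ := Fin.ext h
        subst this
        rcases hi with rfl | rfl
        · rfl
        · exact absurd hlt (lt_irrefl _)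
      · have h1 := z.x_mono ⟨0, hs'⟩ i (Fin.lt_def.2 h)
        have h2 := (z.mem_pair hi).1
        linarith
    · exact j.elim0
  -- Below the upper point of the first pair there is only its lower point, and `u` is the only
  -- vertex over it.
  have hpast : ∀ e a w, C.src e = some a → C.tgt e = some w → C.pos w ≤ (z.x ⟨0, hs'⟩).2 →
      a = u := by
    intro e a w ha hw hle
    apply hinj
    rw [hu]
    exact hmin _ (hC.pos_mem a) (lt_of_lt_of_le (C.pos_lt ha hw) hle)
  have hin : ∀ e, C.tgt e = some u → C.src e = none := by
    intro e he
    by_contra h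
    obtain ⟨a, ha⟩ := Option.ne_none_iff_exists'.1 h
    have := hpast e a u ha he (hu ▸ (z.x_lt _).le)
    subst this
    exact lt_irrefl _ (C.pos_lt ha he)
  -- The edges entering the lowest vertex `u` are ends of weight 1, which cannot be the sum of two
  -- positive weights. So `u` does not split an edge, and only the joining pattern is left.
  have hone : ∀ a x y, C.inE u = {a} → C.outE u = {x, y} → x ≠ y → False := by
    intro a x y h1 h2 hxy
    have h3 := C.weight_of_split hxy h1 h2
    have h4 : C.weight a = 1 :=
      weight_of_src_none hC (hin a (h1.symm.subset (Set.mem_singleton a)))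
    have := C.weight_pos x
    have := C.weight_pos y
    omega
  rcases hp with ⟨a, b, f, c, d, h1, h2, h3, h4, h5, h6⟩ | ⟨a, b, f, c, d, h1, h2, h3, h4, h5, h6⟩ |
    ⟨a, c, f, b, d, h1, h2, h3, h4, h5, h6, h7⟩ | ⟨a, f, f', d, h1, h2, h3, h4, h5, h6⟩
  · have hfu : C.src f = some u := h4.symm.subset (Set.mem_singleton f)
    have hfv : C.tgt f = some v := h5.symm.subset (Or.inl rfl)
    have hcv : C.tgt c = some v := h5.symm.subset (Or.inr rfl)
    have hc : C.src c = none := by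
      by_contra h
      obtain ⟨w, hw⟩ := Option.ne_none_iff_exists'.1 h
      have := hpast c w v hw hcv hv.le
      subst this
      exact h2 (h4.subset hw).symm
    have hfS : f ∈ SE := hS.contractible f ⟨_, u, v, hfu, hfv, hu, hv⟩
    have hvS : v ∈ SV := hS.subgraph f hfS v (Or.inr hfv)
    -- The vertex `v` is in the core because the contractible edge `f` is. An odd end at a core
    -- vertex lies in no tail, so `c` is in the core. The only other edge entering `v` is `f`, which
    -- starts at `u`, so `c` has no partner.
    refine ⟨c, ?_, hc, ?_⟩
    · by_contra hcS
      obtain ⟨T, hcT, hT⟩ := hS.tails c hcS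
      refine hT.notMem ?_ ?_ hcT
      · rintro w (hw | hw)
        · rw [hc] at hw; cases hw
        · rw [hcv] at hw; cases hw; exact hvS
      · rw [weight_of_src_none hC hc]; exact odd_one
    · intro x hx
      have hxv : C.tgt x = some v := hx.2.2.1 ▸ hcv
      rcases h5.subset hxv with rfl | h
      · have := hx.2.1
        rw [hc, hfu] at this
        cases this
      · exact hx.1 h.symm
  · exact (hone d f c h3 h4 h2).elim
  · exact (hone a c f h4 h5 h1).elim
  · exact (hone a f f' h2 h3 h1).elim

/-- The roots in a tail are even, so an odd edge belongs to one of the symmetric cycles or to the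
final fork. -/
theorem IsTail.exists_parallel {C : TropicalCover} {n f : C.E → Option C.V} {SV : Set C.V}
    {r x : C.E} {T : Set C.E} (h : C.IsTail n f SV r T) (hx : x ∈ T) (hodd : Odd (C.weight x))
    (hbal : ∀ a b r v, C.Parallel a b → {e | f e = some v} = {r} → {e | n e = some v} = {a, b} →
      Even (C.weight r)) : ∃ y, C.Parallel x y := by
  induction h with
  | single r h1 h2 =>
    cases hx
    exact ((Nat.not_even_iff_odd.2 hodd) h2).elim
  | fork r a b v h1 h2 h3 h4 h5 h6 h7 =>
    rcases hx with rfl | rfl | rfl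
    · exact ((Nat.not_even_iff_odd.2 hodd) (hbal a b _ v h7 h3 h4)).elim
    · exact ⟨b, h7⟩
    · exact ⟨a, h7.symm⟩
  | cycle r a b r' v u T h1 h2 h3 h4 h5 h6 h7 h8 h9 h10 ih =>
    rcases hx with (rfl | rfl | rfl) | h
    · exact ((Nat.not_even_iff_odd.2 hodd) (hbal a b _ v h8 h4 h5)).elim
    · exact ⟨b, h8⟩
    · exact ⟨a, h8.symm⟩
    · exact ih h

/-- Three parallel left ends would exhaust the trivalent vertex, leaving no outgoing edge, against
balancing. -/
theorem parallel_unique {C : TropicalCover} {x y y' : C.E} (hx : C.src x = none)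
    (h : C.Parallel x y) (h' : C.Parallel x y') : y = y' := by
  classical
  by_contra hne
  obtain ⟨v, hv⟩ := Option.ne_none_iff_exists'.1 ((C.incident x).resolve_left (by simp [hx]))
  have h3 := C.trivalent v
  have hsub : ((({x, y, y'} : Finset C.E) : Set C.E)) ⊆ {e | C.tgt e = some v} := by
    intro e he
    simp only [Finset.coe_insert, Finset.coe_singleton, Set.mem_insert_iff,
      Set.mem_singleton_iff] at he
    rcases he with rfl | rfl | rfl
    · exact hv
    · exact h.2.2.1.symm.trans hv
    · exact h'.2.2.1.symm.trans hv
  have hle := Set.ncard_le_ncard hsub (Set.toFinite _)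
  rw [Set.ncard_coe_finset, Finset.card_eq_three.2 ⟨x, y, y', h.1, h'.1, hne, rfl⟩] at hle
  have h0 : {e | C.src e = some v}.ncard = 0 := by omega
  rw [Set.ncard_eq_zero (Set.toFinite _)] at h0
  have := C.sum_in_eq_sum_out (v := v) (S := Finset.univ.filter fun e => C.tgt e = some v) (T := ∅)
    (by ext e; simp [inE]) (by simpa [outE] using h0)
  rw [Finset.sum_empty] at this
  have hw := (Finset.sum_eq_zero_iff.1 this) x (by simpa using hv)
  exact (C.weight_pos x).ne' hw

/-- A cover with an odd number of left ends, all of weight one, has a left end in the core. -/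
theorem exists_left_end_of_odd {C : TropicalCover} {g k : ℕ} {mu : Multiset ℕ} {SV : Set C.V}
    {SE : Set C.E} (hC : C.HasType z g (ones k) mu) (hk : Odd k) (hS : C.IsZigzagCore z SV SE) :
    ∃ r ∈ SE, C.src r = none := by
  classical
  by_contra hno
  push Not at hno
  have hpar : ∀ x, C.src x = none → ∃ y, C.Parallel x y := by
    intro x hx
    have hodd : Odd (C.weight x) := by rw [weight_of_src_none hC hx]; exact odd_one
    obtain ⟨T, hxT, r, v, hv, ⟨h1, h2⟩ | ⟨h1, h2⟩⟩ := hS.tails x (fun h => hno x h hx)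
    · exact h2.exists_parallel hxT hodd C.even_of_join
    · exact h2.exists_parallel hxT hodd C.even_of_split
  choose y hy using hpar
  have hcard : (Finset.univ.filter fun e => C.src e = none).card = k := by
    have := congrArg Multiset.card hC.left
    rw [Multiset.card_map, ones, Multiset.card_replicate] at this
    rw [← this]
    congr
  -- If all left ends lay in tails, passing to the parallel partner would be an involution without
  -- fixed points on them. Summing 1 modulo 2 shows that their number would be even.
  have hsum : ∑ x ∈ Finset.univ.filter (fun e => C.src e = none), (1 : ZMod 2) = 0 := by
    refine Finset.sum_involution (fun x hx => y x (Finset.mem_filter.1 hx).2) ?_ ?_ ?_ ?_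
    · intro x hx; decide
    · intro x hx _ h
      exact (hy x (Finset.mem_filter.1 hx).2).1 h.symm
    · intro x hx
      have h := (Finset.mem_filter.1 hx).2
      exact Finset.mem_filter.2 ⟨Finset.mem_univ _, (hy x h).2.1 ▸ h⟩
    · intro x hx
      have h := (Finset.mem_filter.1 hx).2
      have h' : C.src (y x h) = none := (hy x h).2.1 ▸ h
      exact parallel_unique h' (hy _ h') (hy x h).symm
  rw [Finset.sum_const, hcard, nsmul_one, ZMod.natCast_eq_zero_iff_even] at hsum
  exact (Nat.not_even_iff_odd.2 hk) hsum

end TropicalCover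

namespace TropicalCover

variable {s t : ℕ} {z : BranchDistribution s t}

/-! ### Covers with odd multiplicity -/

section tailpairs

variable {C : TropicalCover} {n f : C.E → Option C.V} {SV : Set C.V}

/-- `r` is an edge of a tail directed away from the core, and `p` is the pair of parallel edges
behind it. -/
structure PairBehind (C : TropicalCover) (n f : C.E → Option C.V) (SV : Set C.V) (r : C.E)
    (p : Finset C.E) : Prop where
  tail : ∃ T, C.IsTail n f SV r T
  not_tail : ¬ ∃ T, C.IsTail f n SV r T
  pair : ∃ a b v, f r = some v ∧ {e | f e = some v} = {r} ∧ {e | n e = some v} = {a, b} ∧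
    C.Parallel a b ∧ (p : Set C.E) = {a, b}

/-- Seen in the reverse direction, the far vertex of `r` would lie in the core, which no tail
allows. -/
theorem IsTail.not_reverse {r : C.E} {v : C.V} (hr : n r = some v) (hv : v ∈ SV) :
    ¬ ∃ T, C.IsTail f n SV r T := by
  rintro ⟨T, h⟩
  cases h with
  | single _ h1 _ => rw [hr] at h1; cases h1
  | fork _ a b w h1 h2 => rw [hr] at h2; cases h2; exact h1 hv
  | cycle _ a b r' w u T h1 h2 h3 => rw [hr] at h3; cases h3; exact h1 hv

/-- A reverse tail from `r'` must run back through the cycle and leave it by `r`. Hence the property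
of not being reversible passes from the root of a tail to the even edges behind it. -/
theorem IsTail.reverse_of_cycle {r a b r' : C.E} {v u : C.V} (h1 : {e | f e = some v} = {r})
    (h2 : {e | n e = some v} = {a, b}) (h3 : {e | f e = some u} = {a, b})
    (h4 : {e | n e = some u} = {r'}) (h : ∃ T, C.IsTail f n SV r' T) :
    ∃ T, C.IsTail f n SV r T := by
  obtain ⟨T, h⟩ := h
  have hr' : n r' = some u := h4.symm.subset rfl
  have hna : ∀ x, f x = some u → n x = some v := fun x hx => h2.symm.subset (h3.subset hx)
  cases h with
  | single _ h1 _ => rw [hr'] at h1; cases h1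
  | fork _ a' b' w k1 k2 k3 k4 k5 k6 k7 =>
    rw [hr'] at k2; cases k2
    have := hna a' (k4.symm.subset (Or.inl rfl))
    rw [k5] at this; cases this
  | cycle _ a' b' r'' w u' T' k1 k2 k3 k4 k5 k6 k7 k8 k9 k10 =>
    rw [hr'] at k3; cases k3
    have e1 := hna a' (k5.symm.subset (Or.inl rfl))
    have e2 : n a' = some u' := k6.symm.subset (Or.inl rfl)
    rw [e1] at e2; cases e2
    have : r'' = r := h1.subset (k7.symm.subset rfl)
    exact ⟨T', this ▸ k10⟩

/-- Since the ends are odd, no tail stops with an even end: behind every even edge there is a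
symmetric cycle or fork, and every odd edge lies in one of these. -/
theorem IsTail.exists_pairBehind {r : C.E} {T : Set C.E} (h : C.IsTail n f SV r T)
    (hr : ¬ ∃ T, C.IsTail f n SV r T) (hodd : ∀ x, f x = none → Odd (C.weight x))
    (hbal : ∀ a b r v, C.Parallel a b → {e | f e = some v} = {r} → {e | n e = some v} = {a, b} →
      Even (C.weight r)) :
    (∀ x ∈ T, Even (C.weight x) → ∃ p, PairBehind C n f SV x p) ∧
      ∀ x ∈ T, Odd (C.weight x) → ∃ r p, PairBehind C n f SV r p ∧ x ∈ p := by
  classical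
  induction h with
  | single r h1 h2 => exact ((Nat.not_even_iff_odd.2 (hodd r h1)) h2).elim
  | fork r a b v h1 h2 h3 h4 h5 h6 h7 =>
    have hp : PairBehind C n f SV r {a, b} :=
      ⟨⟨_, IsTail.fork r a b v h1 h2 h3 h4 h5 h6 h7⟩, hr, a, b, v, h2, h3, h4, h7, by simp⟩
    constructor
    · rintro x (rfl | rfl | rfl) hx
      · exact ⟨_, hp⟩
      · exact ((Nat.not_even_iff_odd.2 (hodd _ h5)) hx).elim
      · exact ((Nat.not_even_iff_odd.2 (hodd _ h6)) hx).elim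
    · rintro x (rfl | rfl | rfl) hx
      · exact ((Nat.not_even_iff_odd.2 hx) (hbal _ _ _ _ h7 h3 h4)).elim
      · exact ⟨_, _, hp, by simp⟩
      · exact ⟨_, _, hp, by simp⟩
  | cycle r a b r' v u T h1 h2 h3 h4 h5 h6 h7 h8 h9 h10 ih =>
    have hp : PairBehind C n f SV r {a, b} :=
      ⟨⟨_, IsTail.cycle r a b r' v u T h1 h2 h3 h4 h5 h6 h7 h8 h9 h10⟩, hr, a, b, v, h3, h4, h5,
        h8, by simp⟩
    have ih := ih fun h => hr (IsTail.reverse_of_cycle h4 h5 h6 h7 h)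
    constructor
    · rintro x ((rfl | rfl | rfl) | h) hx
      · exact ⟨_, hp⟩
      · exact ((Nat.not_even_iff_odd.2 h9) hx).elim
      · rw [← h8.2.2.2] at hx
        exact ((Nat.not_even_iff_odd.2 h9) hx).elim
      · exact ih.1 x h hx
    · rintro x ((rfl | rfl | rfl) | h) hx
      · exact ((Nat.not_even_iff_odd.2 hx) (hbal _ _ _ _ h8 h4 h5)).elim
      · exact ⟨_, _, hp, by simp⟩
      · exact ⟨_, _, hp, by simp⟩
      · exact ih.2 x h hx

theorem PairBehind.eq_pair {r : C.E} {p p' : Finset C.E} (h : PairBehind C n f SV r p)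
    (h' : PairBehind C n f SV r p') : p = p' := by
  obtain ⟨a, b, v, h1, h2, h3, h4, h5⟩ := h.pair
  obtain ⟨a', b', v', h1', h2', h3', h4', h5'⟩ := h'.pair
  rw [h1] at h1'; cases h1'
  exact Finset.coe_injective (by rw [h5, h5', ← h3, ← h3'])

theorem PairBehind.eq_root {r r' : C.E} {p : Finset C.E} (h : PairBehind C n f SV r p)
    (h' : PairBehind C n f SV r' p) : r = r' := by
  obtain ⟨a, b, v, h1, h2, h3, h4, h5⟩ := h.pair
  obtain ⟨a', b', v', h1', h2', h3', h4', h5'⟩ := h'.pair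
  have ha : n a = some v := h3.symm.subset (Or.inl rfl)
  have ha' : n a = some v' := h3'.symm.subset (h5'.subset (h5.symm.subset (Or.inl rfl)))
  rw [ha] at ha'; cases ha'
  exact h2'.subset (h2.symm.subset rfl)

/-- Such a pair would be a cycle between `r` and `r'`. The tail from `r` would continue through
`r'`, which is excluded by `not_tail` for `r'`. -/
theorem PairBehind.not_opposite {r r' : C.E} {p : Finset C.E} (h : PairBehind C n f SV r p)
    (h' : PairBehind C f n SV r' p) : False := by
  obtain ⟨a, b, v, h1, h2, h3, h4, h5⟩ := h.pair
  obtain ⟨a', b', v', h1', h2', h3', h4', h5'⟩ := h'.pair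
  have hab : ({a, b} : Set C.E) = {a', b'} := h5.symm.trans h5'
  have ha : f a = some v' := h3'.symm.subset (hab.subset (Or.inl rfl))
  obtain ⟨T, hT⟩ := h.tail
  cases hT with
  | single _ k1 _ => rw [h1] at k1; cases k1
  | fork _ a₁ b₁ w k1 k2 k3 k4 k5 k6 k7 =>
    rw [h1] at k2; cases k2
    have : f a₁ = some v' := h3'.symm.subset (hab.subset (h3.subset (k4.symm.subset (Or.inl rfl))))
    rw [k5] at this; cases this
  | cycle _ a₁ b₁ r₁ w u T' k1 k2 k3 k4 k5 k6 k7 k8 k9 k10 =>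
    rw [h1] at k3; cases k3
    have : f a₁ = some v' := h3'.symm.subset (hab.subset (h3.subset (k5.symm.subset (Or.inl rfl))))
    have hu : f a₁ = some u := k6.symm.subset (Or.inl rfl)
    rw [this] at hu; cases hu
    have : r₁ = r' := h2'.subset (k7.symm.subset rfl)
    exact h'.not_tail ⟨T', this ▸ k10⟩

theorem PairBehind.eq_of_parallel {r : C.E} {p q : Finset C.E} {a b : C.E}
    (h : PairBehind C n f SV r p) (ha : a ∈ p) (hab : C.Parallel a b) (hn : n a = n b)
    (hq : (q : Set C.E) = {a, b}) : p = q := by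
  obtain ⟨a', b', v, h1, h2, h3, h4, h5⟩ := h.pair
  have ha' : a ∈ ({a', b'} : Set C.E) := h5.subset ha
  have hv : n a = some v := h3.symm.subset ha'
  have hb' : b ∈ ({a', b'} : Set C.E) := h3.subset (hn.symm.trans hv)
  refine Finset.coe_injective ?_
  rw [hq, h5]
  rcases ha' with rfl | rfl <;> rcases hb' with rfl | rfl
  · exact (hab.1 rfl).elim
  · rfl
  · exact Set.pair_comm _ _
  · exact (hab.1 rfl).elim

end tailpairs

/-- Without pairs of points no edge is contractible, so every even edge lies outside the core, hence
in a tail. Sending it to the symmetric pair behind it is a bijection: the pair determines the even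
edge in front of it, and every symmetric pair lies in tails as well. -/
theorem ncard_even_eq_ncard_sym {C : TropicalCover} {z : BranchDistribution 0 t} {g k k' : ℕ}
    (hC : C.IsZigzag z g (ones k) (ones k')) :
    {e | C.IsInner e ∧ Even (C.weight e)}.ncard = (C.Sym2 z).ncard := by
  classical
  obtain ⟨SV, SE, hS⟩ := hC.core
  have hsrc : ∀ e, C.src e = none → Odd (C.weight e) := fun e h => by
    rw [weight_of_src_none hC.type h]; exact odd_one
  have htgt : ∀ e, C.tgt e = none → Odd (C.weight e) := fun e h => by
    rw [weight_of_tgt_none hC.type h]; exact odd_one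
  have hcon : ∀ e, ¬ C.IsContractible z e := by
    rintro e ⟨i, -⟩; exact i.elim0
  -- Both directions of tails are covered; `not_tail` and `not_opposite` prevent them from being
  -- mixed.
  let Q : C.E → Finset C.E → Prop := fun r p =>
    PairBehind C C.src C.tgt SV r p ∨ PairBehind C C.tgt C.src SV r p
  have hmem : ∀ x ∉ SE, (Even (C.weight x) → ∃ p, Q x p) ∧
      (Odd (C.weight x) → ∃ r p, Q r p ∧ x ∈ p) := by
    intro x hx
    obtain ⟨T, hxT, r, v, hv, ⟨h1, h2⟩ | ⟨h1, h2⟩⟩ := hS.tails x hx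
    · have := h2.exists_pairBehind (IsTail.not_reverse h1 hv) hsrc C.even_of_join
      refine ⟨fun h => ?_, fun h => ?_⟩
      · obtain ⟨p, hp⟩ := this.1 x hxT h
        exact ⟨p, Or.inr hp⟩
      · obtain ⟨r, p, hp, h⟩ := this.2 x hxT h
        exact ⟨r, p, Or.inr hp, h⟩
    · have := h2.exists_pairBehind (IsTail.not_reverse h1 hv) htgt C.even_of_split
      refine ⟨fun h => ?_, fun h => ?_⟩
      · obtain ⟨p, hp⟩ := this.1 x hxT h
        exact ⟨p, Or.inl hp⟩
      · obtain ⟨r, p, hp, h⟩ := this.2 x hxT h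
        exact ⟨r, p, Or.inl hp, h⟩
  have hout : ∀ x, Even (C.weight x) → x ∉ SE := fun x hx h => hcon x (hS.odd x h hx)
  have heven : ∀ r p, Q r p → Even (C.weight r) := by
    rintro r p (⟨⟨T, h⟩, -, -⟩ | ⟨⟨T, h⟩, -, -⟩)
    · exact h.even_root C.even_of_split
    · exact h.even_root C.even_of_join
  have hsym : ∀ r p, Q r p → p ∈ C.Sym2 z := by
    rintro r p hQ
    have : p ∈ C.Sym := by
      rcases hQ with ⟨-, -, a, b, v, -, -, -, h, h'⟩ | ⟨-, -, a, b, v, -, -, -, h, h'⟩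
      · exact ⟨a, b, h, h'⟩
      · exact ⟨a, b, h, h'⟩
    exact ⟨⟨this, fun e _ => hcon e⟩, fun ⟨_, _, f, _, hf, _⟩ => hcon f hf⟩
  have hfun : ∀ r p p', Q r p → Q r p' → p = p' := by
    rintro r p p' (h | h) (h' | h')
    · exact h.eq_pair h'
    · exact (h.not_tail h'.tail).elim
    · exact (h.not_tail h'.tail).elim
    · exact h.eq_pair h'
  have hinj : ∀ r r' p, Q r p → Q r' p → r = r' := by
    rintro r r' p (h | h) (h' | h')
    · exact h.eq_root h'
    · exact (h.not_opposite h').elim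
    · exact (h.not_opposite h').elim
    · exact h.eq_root h'
  have hex : ∀ r, r ∈ {e | C.IsInner e ∧ Even (C.weight e)} → ∃ p, Q r p :=
    fun r hr => (hmem r (hout r hr.2)).1 hr.2
  choose F hF using hex
  refine Set.ncard_congr F (fun r hr => hsym r _ (hF r hr)) ?_ ?_
  · intro r r' hr hr' h
    exact hinj r r' (F r hr) (hF r hr) (h ▸ hF r' hr')
  · intro p hp
    obtain ⟨a, b, hab, hpab⟩ := hp.1.1
    have hap : a ∈ p := hpab.symm.subset (Or.inl rfl)
    have haS := hS.disjoint p hp a hap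
    have : ∃ r, Q r p := by
      rcases Nat.even_or_odd (C.weight a) with he | ho
      · obtain ⟨q, ⟨-, -, x, y, v, h1, h2, -⟩ | ⟨-, -, x, y, v, h1, h2, -⟩⟩ := (hmem a haS).1 he
        · exact (hab.1 (h2.subset (hab.2.2.1.symm.trans h1)).symm).elim
        · exact (hab.1 (h2.subset (hab.2.1.symm.trans h1)).symm).elim
      · obtain ⟨r, q, h | h, haq⟩ := (hmem a haS).2 ho
        · exact ⟨r, Or.inl (h.eq_of_parallel haq hab hab.2.1 hpab ▸ h)⟩
        · exact ⟨r, Or.inr (h.eq_of_parallel haq hab hab.2.2.1 hpab ▸ h)⟩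
    obtain ⟨r, hr⟩ := this
    have he := heven r p hr
    have hri : r ∈ {e | C.IsInner e ∧ Even (C.weight e)} :=
      ⟨⟨fun h => (Nat.not_even_iff_odd.2 (hsrc r h)) he,
        fun h => (Nat.not_even_iff_odd.2 (htgt r h)) he⟩, he⟩
    exact ⟨r, hri, hfun r _ _ (hF r hri) hr⟩

/-- Zigzag covers without pairs and with ends of weight one have odd multiplicity. -/
theorem hasOddMult_of_ones {C : TropicalCover} {z : BranchDistribution 0 t} {g k k' : ℕ}
    (hC : C.IsZigzag z g (ones k) (ones k')) : C.HasOddMult z := by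
  have hcon : ∀ e, ¬ C.IsContractible z e := by
    rintro e ⟨i, -⟩; exact i.elim0
  -- All even edges are blue and `I` is empty. The condition on signs is vacuous, the product is
  -- empty, and the multiplicity is 2 to the number of even inner edges minus the number of
  -- symmetric pairs, that is, 1.
  let ρ : C.Colouring := ⟨∅, Set.empty_subset _, fun _ => false, fun _ _ _ _ _ _ _ => rfl⟩
  have h3 : C.Sym3 z = ∅ := by
    rw [Set.eq_empty_iff_forall_notMem]
    rintro p ⟨-, e, -, f, v, hf, -⟩
    exact hcon f hf
  have hN : C.NsymC z = ∅ := by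
    rw [Set.eq_empty_iff_forall_notMem]
    rintro p ⟨e, f, h, -, -, -, h'⟩
    exact hcon e (h' e (h.symm.subset (Or.inl rfl))).1
  refine ⟨ρ, ⟨fun i => i.elim0, ?_, Set.inter_empty _⟩, 1, odd_one, ?_⟩
  · exact h3.subset
  · have hA : {e | C.IsInner e ∧ Even (C.weight e) ∧ ρ.Outside e ∧ ¬ C.IsContractible z e} =
        {e | C.IsInner e ∧ Even (C.weight e)} := by
      ext e
      simp [Colouring.Outside, ρ, hcon]
    have hI : ρ.I = ∅ := rfl
    rw [Colouring.mult, hA, h3, hN, hI, ncard_even_eq_ncard_sym hC]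
    simp

end TropicalCover

/-! ### From zigzag numbers to counts of isomorphism classes -/

theorem zigzagNumber_ones {t : ℕ} (z : BranchDistribution 0 t) (g k k' : ℕ) :
    zigzagNumber g (ones k) (ones k') z = Nat.card (ZigzagClass g (ones k) (ones k') z) := by
  classical
  have h : ∀ q : ZigzagClass g (ones k) (ones k') z, 2 ^ q.exponent = 1 := fun q => by
    rw [ZigzagClass.exponent, if_pos (TropicalCover.hasOddMult_of_ones (Quotient.out q).2), pow_zero]
  have := Fintype.ofFinite (ZigzagClass g (ones k) (ones k') z)
  rw [zigzagNumber, finsum_congr h, finsum_eq_sum_of_fintype, Nat.card_eq_fintype_card]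
  simp

/-! ### Multisets of weights -/

theorem ones_add (a b : ℕ) : ones a + ones b = ones (a + b) := (Multiset.replicate_add a b 1).symm

theorem cons_ones (a : ℕ) : 1 ::ₘ ones a = ones (a + 1) := (Multiset.replicate_succ 1 a).symm

theorem card_ones (a : ℕ) : (ones a).card = a := Multiset.card_replicate _ _

theorem sum_ones (a : ℕ) : (ones a).sum = a := by simp [ones]

theorem exists_add_self_of_even_count (N : Multiset ℕ) (h : ∀ k, Even (N.count k)) :
    ∃ D : Multiset ℕ, N = D + D := by
  refine ⟨∑ k ∈ N.toFinset, (N.count k / 2) • {k}, ?_⟩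
  rw [← Finset.sum_add_distrib]
  conv_lhs => rw [← Multiset.toFinset_sum_count_nsmul_eq N]
  refine Finset.sum_congr rfl fun k _ => ?_
  rw [← add_nsmul]
  congr 1
  obtain ⟨r, hr⟩ := h k
  omega

theorem evenPart_le (M : Multiset ℕ) : evenPart M ≤ M :=
  (Multiset.filter_le _ _).trans (Multiset.dedup_le M)

theorem even_of_mem_evenPart {M : Multiset ℕ} {k : ℕ} (h : k ∈ evenPart M) : Even k :=
  (Multiset.mem_filter.1 h).2.1

theorem count_evenPart (M : Multiset ℕ) (k : ℕ) :
    (evenPart M).count k = if Even k ∧ Odd (M.count k) then 1 else 0 := by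
  rw [evenPart, Multiset.count_filter, Multiset.count_dedup]
  split_ifs with h1 h2
  · rfl
  · rw [Multiset.count_eq_zero.2 h2] at h1
    simp at h1
  · rfl

theorem mem_evenPart {M : Multiset ℕ} {e : ℕ} (he : Even e) (h : Odd (M.count e)) :
    e ∈ evenPart M := by
  rw [← Multiset.count_pos, count_evenPart, if_pos ⟨he, h⟩]
  exact one_pos

/-- Outside the even part, the even entries come in pairs. -/
theorem exists_tail_decomposition (M : Multiset ℕ) :
    ∃ D O : Multiset ℕ, M = evenPart M + (D + D + O) ∧ (∀ k ∈ D, Even k) ∧ ∀ k ∈ O, Odd k := by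
  obtain ⟨D, hD⟩ := exists_add_self_of_even_count ((M - evenPart M).filter fun k => Even k) (by
    intro k
    rw [Multiset.count_filter]
    split_ifs with hk
    · rw [Multiset.count_sub, count_evenPart]
      split_ifs with h
      · exact (Nat.Odd.sub_odd h.2 odd_one)
      · rw [tsub_zero]
        exact Nat.not_odd_iff_even.1 fun h' => h ⟨hk, h'⟩
    · exact ⟨0, rfl⟩)
  refine ⟨D, (M - evenPart M).filter fun k => ¬ Even k, ?_, fun k hk => ?_, fun k hk => ?_⟩
  · rw [← hD, Multiset.filter_add_not, add_tsub_cancel_of_le (evenPart_le M)]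
  · exact (Multiset.mem_filter.1 (hD ▸ Multiset.mem_add.2 (Or.inl hk))).2
  · exact Nat.not_even_iff_odd.1 (Multiset.mem_filter.1 hk).2

/-- Provides both the bound of the number of odd entries by their sum and the agreement of parities,
in a form suitable for linear arithmetic. -/
theorem card_le_sum_of_odd (O : Multiset ℕ) (h : ∀ k ∈ O, Odd k) :
    ∃ r, O.sum = O.card + 2 * r := by
  induction O using Multiset.induction with
  | empty => exact ⟨0, rfl⟩
  | cons k O ih =>
    obtain ⟨r, hr⟩ := ih fun x hx => h x (Multiset.mem_cons_of_mem hx)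
    obtain ⟨q, hq⟩ := h k (Multiset.mem_cons_self k O)
    refine ⟨q + r, ?_⟩
    rw [Multiset.sum_cons, Multiset.card_cons, hr, hq]
    ring

theorem even_sum_of_even (O : Multiset ℕ) (h : ∀ k ∈ O, Even k) : ∃ r, O.sum = 2 * r := by
  obtain ⟨r, hr⟩ := Multiset.dvd_sum fun k hk => (h k hk).two_dvd
  exact ⟨r, hr⟩

namespace TropicalCover

variable {s t s' t' : ℕ} {z : BranchDistribution s t}

/-! ### Properly mixed covers -/

theorem Block.hasType {C : TropicalCover} {W : Set C.E} {SV : Set C.V} {SE : Set C.E} {g : ℕ}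
    {L R : Multiset ℕ} (h : Block z C W SV SE Set.univ Set.univ g L R) : C.HasType z g L R where
  genus := h.genus
  image := by rw [h.image, z.points_univ]
  left := by
    classical
    refine Eq.trans ?_ h.left
    rw [leftEnds, sum_ite_singleton]
  right := by
    classical
    refine Eq.trans ?_ h.right
    rw [rightEnds, sum_ite_singleton]

theorem Block.isZigzagCore {C : TropicalCover} {SV : Set C.V} {SE : Set C.E} {g : ℕ}
    {I : Set (Fin s)} {J : Set (Fin t)} {L R : Multiset ℕ} (h : Block z C ∅ SV SE I J g L R) :
    C.IsZigzagCore z SV SE where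
  subgraph := h.subgraph
  nonempty := h.nonempty
  connected := h.connected
  disjoint p hp := h.disjoint p hp fun _ _ => Set.notMem_empty _
  contractible := h.contractible
  odd := h.odd
  tails := h.tails

/-- An end is never used to pass between two inner vertices. -/
theorem joined_ne_of_end {C : TropicalCover} {x : C.E} (hx : C.src x = none ∨ C.tgt x = none)
    (u v : C.V) : C.Joined {e | e ≠ x} u v := by
  refine Relation.ReflTransGen.lift
    (p := fun a b => ∃ e ∈ {e | e ≠ x}, C.Touches e a ∧ C.Touches e b) id ?_ _ _ (C.connected u v)
  rintro a b ⟨e, ⟨h1, h2⟩ | ⟨h1, h2⟩⟩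
  · refine ⟨e, ?_, Or.inl h1, Or.inr h2⟩
    rintro rfl
    rcases hx with hx | hx <;> simp_all
  · refine ⟨e, ?_, Or.inr h2, Or.inl h1⟩
    rintro rfl
    rcases hx with hx | hx <;> simp_all

/-- The glued edge is a bridge: every other edge that meets the first part has all its inner
vertices there. -/
theorem Gluing.not_joined {A B : TropicalCover} (G : Gluing A B) (u : A.V) (v : B.V) :
    ¬ G.join.Joined {e | e ≠ G.embl.onE G.l} (G.embl.onV u) (G.embr.onV v) := by
  intro h
  have key : ∀ w, G.join.Joined {e | e ≠ G.embl.onE G.l} (G.embl.onV u) w →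
      ∃ w', w = G.embl.onV w' := by
    intro w hw
    induction hw with
    | refl => exact ⟨u, rfl⟩
    | @tail b c _ hbc ih =>
      obtain ⟨e, he, h1, h2⟩ := hbc
      obtain ⟨b', rfl⟩ := ih
      rcases G.exists_vertex c with h | ⟨c', rfl⟩
      · exact h
      · obtain ⟨x, rfl, -⟩ := G.embl.touches_iff.1 h1
        obtain ⟨y, hy, -⟩ := G.embr.touches_iff.1 h2
        have := (G.embr_eq_embl hy).1
        subst this
        exact (he rfl).elim
  obtain ⟨w, hw⟩ := key _ h
  exact G.onV_ne w v hw.symm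

/-- The glued edge is the characteristic edge. Triviality of `z` puts all pairs to the left of the
single points, as the orientation of this edge requires. -/
theorem PairSide.exists_isProperlyMixed {A B : TropicalCover} {g g' w : ℕ}
    {L R L' R' : Multiset ℕ} (hz : z.IsTrivial) (hA : PairSide z A g w L R)
    (hB : PointSide z B g' w L' R') :
    ∃ C : TropicalCover, C.IsProperlyMixed z (g + g') (L + L') (R + R') ∧ Nonempty (Emb A C) ∧
      Nonempty (Emb B C) := by
  obtain ⟨X, SVX, SEX, i, v', v, a, k, f, b, d, hX, hd, hdt, hdw, hw, hdp, hi, hv', hv, hPE, hfe,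
    hko, ha, hb, hao, hab, ⟨iA⟩⟩ := hA
  obtain ⟨Y, SVY, SEY, j, y, p, q, hY, hq, hqs, hqt, hqw, hj, hy, hpq, hin, hpo, ⟨iB⟩⟩ := hB
  let G : Gluing X Y := Gluing.ofLt d q hdt hqs (hdw.trans hqw.symm)
    (lt_of_range hX.image hY.image (by
      rintro r (⟨i, -, hr⟩ | ⟨j, hj, -⟩) r' (⟨i, hi, -⟩ | ⟨j', -, rfl⟩)
      · exact hi.elim
      · exact lt_of_le_of_lt (z.mem_pair hr).2 (hz i j')
      · exact hj.elim
      · exact hj.elim))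
  have key := Block.join G (R := R) (L' := L')
    (by rw [show X.weight G.l = w from hdw]; exact hX)
    (by rw [show Y.weight G.r = w from hqw]; exact hY) (Set.empty_subset _) (Set.empty_subset _)
    hd hq (by rw [show X.weight G.l = w from hdw]; exact hw) (Or.inr hdp) (Or.inl rfl)
    (Set.disjoint_empty _)
  rw [Set.union_empty, Set.empty_union] at key
  have hdv : X.src d = some v := hPE.2.2.2.2.2.2.symm.subset rfl
  have hne : ∀ e, X.src e = none → e ≠ G.l := fun e he => ne_of_src_tgt he hdt
  have hX' : ∀ u, X.pos u ∈ z.xPoints := by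
    intro u
    have : X.pos u ∈ z.points Set.univ ∅ := hX.image ▸ Set.mem_range_self u
    rcases this with ⟨i, -, h⟩ | ⟨j, h, -⟩
    · exact ⟨i, h⟩
    · exact h.elim
  have hY' : ∀ u, Y.pos u ∈ z.yPoints := by
    intro u
    have : Y.pos u ∈ z.points ∅ Set.univ := hY.image ▸ Set.mem_range_self u
    rcases this with ⟨i, h, -⟩ | ⟨j, -, h⟩
    · exact h.elim
    · exact ⟨j, h⟩
  refine ⟨G.join, ⟨key.hasType, fun i => key.resolving i (Set.mem_univ i), _, _, key.isZigzagCore,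
    G.embl.onE d, Or.inl ⟨d, hd, rfl⟩, G.embl.onV v, G.embr.onV y, G.embl.onV v',
    G.embl.src_onE.2 hdv, ?_, ?_, G.not_joined v y, ?_, ⟨i, hi, ?_, ?_⟩,
    ⟨_, _, _, _, G.embl.pairExchange hPE, ?_, ?_, ?_, ?_, ?_, ?_⟩, ⟨j, hj, ?_⟩, G.embr.onE p,
    G.embr.onE q, G.embr.injE.ne hpq, ?_, ?_, ?_⟩, ⟨iA.trans G.embl⟩, ⟨iB.trans G.embr⟩⟩
  · rw [show G.embl.onE d = G.embr.onE q from G.embl_l]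
    exact G.embr.tgt_onE.2 hqt
  · rw [G.embl.weight_eq, hdw]; exact hw
  · intro u
    rcases G.exists_vertex u with ⟨u, rfl⟩ | ⟨u, rfl⟩
    · refine Or.inl ⟨G.embl.joined (K := {e | e ≠ d})
        (K' := {e | e ≠ G.embl.onE d}) (fun e he h => he (G.embl.injE h))
        (joined_ne_of_end (Or.inr hdt) v u), ?_⟩
      rw [G.embl.pos_eq]; exact hX' u
    · refine Or.inr ⟨G.embr.joined (K := {e | e ≠ q})
        (K' := {e | e ≠ G.embl.onE d}) (fun e he h => he (G.embr_eq_embl h.symm).2)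
        (joined_ne_of_end (Or.inl hqs) y u), ?_⟩
      rw [G.embr.pos_eq]; exact hY' u
  · rw [G.embl.pos_eq, hv']
  · rw [G.embl.pos_eq, hv]
  · rw [G.embl.weight_eq]; exact hfe
  · rw [G.embl.weight_eq]; exact hko
  · exact G.keeps_embl.src a (hne a ha) ha
  · exact G.keeps_embl.src b (hne b hb) hb
  · rw [G.embl.weight_eq]; exact hao
  · rw [G.embl.weight_eq, G.embl.weight_eq, hab]
  · rw [G.embr.pos_eq, hy]
  · rw [G.embr.inE_onV, hin, Set.image_pair]
  · rw [G.embr.weight_eq]; exact hpo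
  · rw [G.embr.weight_eq, hqw]; exact hw

/-- The tower is built from right to left in the order splits, emissions, absorptions, joins. The
numbers `j` and `j'` count additional doubled ends of weight 1. Their positivity keeps the main edge
heavier than 1 throughout the exchanges, and `hsum` says that its weight is back at 1 before the
first pair. -/
theorem LeftTower.exists_pairSide {A : TropicalCover} {g n j j' o : ℕ}
    {L R D D' O O' : Multiset ℕ} (h : LeftTower z A g n 1 L R)
    (hn : n = 1 + (D.card + j) + O.card + O'.card + (D'.card + j')) (hs : n ≤ s)
    (hD : ∀ k ∈ D, 0 < k) (hD' : ∀ k ∈ D', 0 < k) (hO : ∀ k ∈ O, Odd k) (hO' : ∀ k ∈ O', Odd k)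
    (ho : Odd o) (ho' : o ≠ 1) (hj : 0 < j) (hj' : 0 < j')
    (hsum : 2 * (D'.sum + j') + O'.sum + O.card = 2 * (D.sum + j) + O.sum + O'.card) :
    PairSide z A g (2 * o - 1) (D + D + O + {o, o} + ones (2 * j + O'.card) + L)
      (D' + D' + O' + ones (2 * j' + O.card) + R) := by
  have hones : ∀ k x, x ∈ ones k → 0 < x := fun k x hx => by
    rw [Multiset.eq_of_mem_replicate hx]; exact one_pos
  obtain ⟨r, hr⟩ := card_le_sum_of_odd O' hO'
  have hop := ho.pos
  subst hn
  have h1 := LeftTower.splits (D' + ones j') (n := 1 + (D.card + j) + O.card + O'.card)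
    (by rwa [Multiset.card_add, card_ones]) (by rwa [Multiset.card_add, card_ones])
    (fun k hk => (Multiset.mem_add.1 hk).elim (hD' k) (hones _ k))
  rw [Multiset.sum_add, sum_ones] at h1
  have h2 := h1.emit O' (w' := 1 + 2 * (D'.sum + j') + 2 * r) (by omega) hO' (by omega) (by omega)
  have h3 := h2.absorb O (w' := 1 + 2 * (D.sum + j)) (by omega) hO (by omega) (by omega)
  have h4 := LeftTower.joins (D + ones j) (n := 1) (w := 1)
    (by rwa [Multiset.card_add, card_ones, Multiset.sum_add, sum_ones])
    (by rw [Multiset.card_add, card_ones]; omega)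
    (fun k hk => (Multiset.mem_add.1 hk).elim (hD k) (hones _ k)) one_pos
  -- The characteristic edge has weight `(o - 1) + o = 2 * o - 1`.
  have h5 := h4.pairSide (by omega) ho (f := o - 1) (by omega) (by omega)
  convert h5 using 1
  · omega
  · change _ = o ::ₘ o ::ₘ (D + ones j + (D + ones j) + (O + (ones O'.card + L)))
    rw [← ones_add, two_mul, ← ones_add]
    simp only [← Multiset.singleton_add, Multiset.insert_eq_cons]
    abel
  · change _ = ones O.card + (O' + (D' + ones j' + (D' + ones j') + R))
    rw [← ones_add, two_mul, ← ones_add]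
    abel

/-- All entries of `E'` except `e` are split off as even ends; the entry `e` is the end leaving the
last vertex. Additions come before removals, so the main edge stays positive. -/
theorem RightTower.exists_pointSide {B : TropicalCover} {g n c c' o e : ℕ}
    {L R E E' : Multiset ℕ} (h : RightTower z B g n 1 L R)
    (hn : n + E.card + 2 * c + E'.card + 2 * c' = t)
    (hE : ∀ k ∈ E, 0 < k ∧ Even k) (hE' : ∀ k ∈ E', 0 < k ∧ Even k) (ho : 0 < o) (he : e ∈ E')
    (hoe : 2 * o ≤ e) (hsum : E.sum + 2 * o + 2 * c = E'.sum + 2 * c') :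
    PointSide z B g (2 * o - 1) (E + ones (2 * c) + L) (E' + ones (2 * c') + R) := by
  obtain ⟨F, rfl⟩ := Multiset.exists_cons_of_mem he
  rw [Multiset.card_cons] at hn
  rw [Multiset.sum_cons] at hsum
  have h1 := h.joins E (by omega) hE
  have h2 := h1.forks_in c (by omega)
  -- The weight is chosen so that `e - 2 * o + 1` remains after the `c'` outgoing forks. Adding the
  -- characteristic edge of weight `2 * o - 1` then gives `e`.
  have h3 := RightTower.splits (z := z) F (w := e - 2 * o + 1 + 2 * c') (n := n + E.card + 2 * c)
    (by convert h2 using 1; omega) (by omega)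
    (fun k hk => hE' k (Multiset.mem_cons_of_mem hk)) (by omega)
  have h4 := h3.forks_out c' (by omega)
  have h5 := h4.pointSide (w' := 2 * o - 1) (by omega) ⟨o - 1, by omega⟩
  convert h5 using 1
  · change _ = ones (2 * c) + (E + L)
    abel
  · change _ = _ ::ₘ (ones (2 * c') + (F + R))
    rw [show e - 2 * o + 1 + (2 * o - 1) = e by omega]
    simp only [← Multiset.singleton_add]
    abel

theorem leftTower_move {z₁ : BranchDistribution s' 0} {A : TropicalCover} {n k : ℕ}
    (hA : A.IsZigzag z₁ 0 (ones k) (ones k)) (hk : s' + 1 = k) (hs' : 0 < s')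
    {σ : Fin s' → Fin s} {ψ : ℝ → ℝ} (hψ : PointMap z₁ z σ Fin.elim0 ψ)
    (hσ : Set.range σ = {i | n ≤ i.val}) :
    LeftTower z (move hψ hA.type) 0 n 1 (ones s') (ones k) := by
  obtain ⟨SV, SE, hS⟩ := hA.core
  obtain ⟨c, hc, hcs, hcp⟩ := exists_left_end_of_pairs hA.type hk hs' hA.resolving hS
  have hb := hS.block_move hψ hA.type hA.resolving
  rw [hσ, show Set.range (Fin.elim0 : Fin 0 → Fin t) = ∅ from Set.range_eq_empty _] at hb
  refine ⟨odd_one, move hψ hA.type, SV, SE, c, ?_, hc, hcs, weight_of_src_none hA.type hcs, hcp,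
    ⟨Emb.refl _⟩⟩
  rwa [cons_ones, hk]

theorem rightTower_move {z₂ : BranchDistribution 0 t'} {B : TropicalCover} {g k : ℕ}
    (hB : B.IsZigzag z₂ g (ones (k + 1)) (ones (k + 1))) (hk : Even k) (ht : t' + 2 ≤ t)
    {τ : Fin t' → Fin t} {ψ : ℝ → ℝ} (hψ : PointMap z₂ z Fin.elim0 τ ψ)
    (hτ : Set.range τ = {j | 2 ≤ j.val ∧ j.val < t' + 2}) :
    RightTower z (move hψ hB.type) g (t' + 2) 1 (ones (k + 2)) (ones (k + 1)) := by
  obtain ⟨SV, SE, hS⟩ := hB.core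
  obtain ⟨r, hr, hrs⟩ := exists_left_end_of_odd hB.type hk.add_one hS
  have hb := hS.block_move hψ hB.type hB.resolving
  rw [hτ, show Set.range (Fin.elim0 : Fin 0 → Fin s) = ∅ from Set.range_eq_empty _] at hb
  have := Block.rightTower (B := move hψ hB.type) (L := ones k) (by rw [cons_ones]; exact hb) r hr hrs (weight_of_src_none hB.type hrs) (by omega) ht
  rwa [cons_ones, cons_ones] at this

end TropicalCover

/-! ### The injection and the choice of the numbers -/

open TropicalCover

/-- Representatives are chosen in each class. An isomorphism of the resulting mixed covers restricts
to the embedded copies, which lie over fixed sets of points, and moving the branch points back gives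
isomorphisms of the original covers. -/
theorem card_mul_card_le {s t s' t' g : ℕ} {lam mu : Multiset ℕ} {k k' : ℕ}
    {z : BranchDistribution s t} {z₁ : BranchDistribution s' 0} {z₂ : BranchDistribution 0 t'}
    {σ : Fin s' → Fin s} {τ : Fin t' → Fin t} {ψ₁ ψ₂ : ℝ → ℝ} (h₁ : PointMap z₁ z σ Fin.elim0 ψ₁)
    (h₂ : PointMap z₂ z Fin.elim0 τ ψ₂)
    (h : ∀ (A B : TropicalCover) (hA : A.IsZigzag z₁ 0 (ones k) (ones k))
      (hB : B.IsZigzag z₂ g (ones k') (ones k')), ∃ C : TropicalCover,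
        C.IsProperlyMixed z g lam mu ∧ Nonempty (Emb (move h₁ hA.type) C) ∧
          Nonempty (Emb (move h₂ hB.type) C)) :
    Nat.card (ZigzagClass 0 (ones k) (ones k) z₁) * Nat.card (ZigzagClass g (ones k') (ones k') z₂) ≤
      Nat.card (ProperZigzagClass g lam mu z) := by
  rw [← Nat.card_prod]
  choose C hC hA hB using h
  let F : ZigzagClass 0 (ones k) (ones k) z₁ × ZigzagClass g (ones k') (ones k') z₂ →
      ProperZigzagClass g lam mu z := fun q =>
    Quotient.mk _ ⟨_, hC _ _ (Quotient.out q.1).2 (Quotient.out q.2).2⟩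
  refine Nat.card_le_card_of_injective F ?_
  rintro ⟨a, b⟩ ⟨a', b'⟩ hab
  obtain ⟨f⟩ : Nonempty (Iso _ _) := Quotient.exact hab
  obtain ⟨i⟩ := hA _ _ (Quotient.out a).2 (Quotient.out b).2
  obtain ⟨i'⟩ := hA _ _ (Quotient.out a').2 (Quotient.out b').2
  obtain ⟨j⟩ := hB _ _ (Quotient.out a).2 (Quotient.out b).2
  obtain ⟨j'⟩ := hB _ _ (Quotient.out a').2 (Quotient.out b').2
  obtain ⟨fa⟩ := Emb.nonempty_iso i i' f (by rw [range_pos_move, range_pos_move])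
  obtain ⟨fb⟩ := Emb.nonempty_iso j j' f (by rw [range_pos_move, range_pos_move])
  refine Prod.ext ?_ ?_
  · rw [← Quotient.out_eq a, ← Quotient.out_eq a']
    exact Quotient.sound (nonempty_iso_of_move h₁ _ _ fa)
  · rw [← Quotient.out_eq b, ← Quotient.out_eq b']
    exact Quotient.sound (nonempty_iso_of_move h₂ _ _ fb)

theorem theorem6p4 {d : ℕ} (lam mu : d.Partition) :
    ∃ n₀ : ℕ, ∀ o e : ℕ, Odd o → o ≠ 1 → 2 ≤ lam.parts.count o →
      Even e → 2 * o ≤ e → Odd (mu.parts.count e) →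
      ∀ g h m : ℕ, n₀ + 3 < h → 1 < m →
      ∀ (z : BranchDistribution (numTriple lam.parts mu.parts o h)
            (numSimple lam.parts mu.parts o g m))
        (z₁ : BranchDistribution (h - n₀ - 1) 0)
        (z₂ : BranchDistribution 0 (4 * m + 2 * g - 4)),
        z.IsTrivial →
        properZigzagNumber g (lam.parts + ones (numOnes lam.parts mu.parts o h m))
            (mu.parts + ones (numOnes lam.parts mu.parts o h m)) z ≥
          Nat.card (ZigzagClass 0 (ones (h - n₀)) (ones (h - n₀)) z₁) *
            zigzagNumber g (ones (2 * m - 1)) (ones (2 * m - 1)) z₂ := by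
  -- Besides the two entries `o`, each partition of `d` has at most `d` odd entries. So `d + 2`
  -- additional ones on each side pay for all exchanges and leave at least one doubled end of weight
  -- 1, whatever `o` and `e` are.
  refine ⟨d + 2, fun o e ho ho1 hcount he hoe hmu g h m hh hm z z₁ z₂ hz => ?_⟩
  obtain ⟨D, O₀, hlam, hDe, hO₀⟩ := exists_tail_decomposition lam.parts
  obtain ⟨D', O', hmu', -, hO'⟩ := exists_tail_decomposition mu.parts
  have hpl : ∀ k ∈ lam.parts, 0 < k := fun k hk => lam.parts_pos hk
  have hpm : ∀ k ∈ mu.parts, 0 < k := fun k hk => mu.parts_pos hk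
  have heE := mem_evenPart he hmu
  have hEp : ∀ k ∈ evenPart lam.parts, 0 < k ∧ Even k := fun k hk =>
    ⟨hpl k (Multiset.mem_of_le (evenPart_le _) hk), even_of_mem_evenPart hk⟩
  have hEp' : ∀ k ∈ evenPart mu.parts, 0 < k ∧ Even k := fun k hk =>
    ⟨hpm k (Multiset.mem_of_le (evenPart_le _) hk), even_of_mem_evenPart hk⟩
  have hO₀o : ({o, o} : Multiset ℕ) ≤ O₀ := by
    change Multiset.replicate 2 o ≤ O₀
    rw [← Multiset.le_count_iff_replicate_le]
    have h0 : ∀ M : Multiset ℕ, (∀ k ∈ M, Even k) → M.count o = 0 := fun M hM =>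
      Multiset.count_eq_zero.2 fun h => (Nat.not_even_iff_odd.2 ho) (hM o h)
    have := hcount
    rw [hlam, Multiset.count_add, Multiset.count_add, Multiset.count_add, h0 D hDe,
      h0 _ fun k hk => even_of_mem_evenPart hk] at this
    omega
  obtain ⟨O, rfl⟩ := exists_add_of_le hO₀o
  have hO : ∀ k ∈ O, Odd k := fun k hk => hO₀ k (Multiset.mem_add.2 (Or.inr hk))
  have hD0 : ∀ k ∈ D, 0 < k := fun k hk => hpl k (by rw [hlam]; simp [hk])
  have hD0' : ∀ k ∈ D', 0 < k := fun k hk => hpm k (by rw [hmu']; simp [hk])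
  have hsl := lam.parts_sum
  have hsm := mu.parts_sum
  have hcl : (lam.parts - evenPart lam.parts - {o, o}).card = 2 * D.card + O.card := by
    have : lam.parts - evenPart lam.parts - {o, o} = D + D + O := by
      refine tsub_eq_of_eq_add (tsub_eq_of_eq_add ?_)
      conv_lhs => rw [hlam]
      abel
    rw [this, Multiset.card_add, Multiset.card_add, two_mul]
  have hcm : (mu.parts - evenPart mu.parts).card = 2 * D'.card + O'.card := by
    have : mu.parts - evenPart mu.parts = D' + D' + O' := by
      refine tsub_eq_of_eq_add ?_
      conv_lhs => rw [hmu']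
      abel
    rw [this, Multiset.card_add, Multiset.card_add, two_mul]
  obtain ⟨a, ha⟩ := even_sum_of_even (evenPart lam.parts) fun k hk => even_of_mem_evenPart hk
  obtain ⟨b, hb⟩ := even_sum_of_even (evenPart mu.parts) fun k hk => even_of_mem_evenPart hk
  obtain ⟨r, hr⟩ := card_le_sum_of_odd O hO
  obtain ⟨r', hr'⟩ := card_le_sum_of_odd O' hO'
  rw [hlam] at hsl
  rw [hmu'] at hsm
  simp only [Multiset.sum_add, Multiset.insert_eq_cons, Multiset.sum_cons,
    Multiset.sum_singleton] at hsl hsm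
  -- The numbers of incoming and outgoing forks over the single points. One of them is zero,
  -- depending on which side has the larger even part.
  obtain ⟨c, c', hc, hcc⟩ : ∃ c c', (evenPart lam.parts).sum + 2 * o + 2 * c =
      (evenPart mu.parts).sum + 2 * c' ∧ cConst lam.parts mu.parts o = c + c' := by
    unfold cConst
    rcases le_total ((evenPart lam.parts).sum + 2 * o) (evenPart mu.parts).sum with h | h
    · exact ⟨((evenPart mu.parts).sum - ((evenPart lam.parts).sum + 2 * o)) / 2, 0, by omega,
        by omega⟩
    · exact ⟨0, ((evenPart lam.parts).sum + 2 * o - (evenPart mu.parts).sum) / 2, by omega,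
        by omega⟩
  -- The difference is even because `O'.card` and `d` have the same parity, and it is at least 2.
  -- With `j'` chosen likewise, the totals of ones on both sides and the number of pairs come out
  -- right.
  obtain ⟨j, hj⟩ : ∃ j, 2 * j + O'.card = d + 2 + 2 * c' := ⟨(d + 2 + 2 * c' - O'.card) / 2, by omega⟩
  obtain ⟨j', hj'⟩ : ∃ j', 2 * j' + O.card = d + 2 + 2 * c :=
    ⟨(d + 2 + 2 * c - O.card) / 2, by omega⟩
  have hop := ho.pos
  have hs : numTriple lam.parts mu.parts o h = 1 + (D.card + j) + O.card + O'.card +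
      (D'.card + j') + (h - (d + 2) - 1) := by
    unfold numTriple
    rw [hcl, hcm, hcc]
    omega
  have hE'pos : 0 < (evenPart mu.parts).card := Multiset.card_pos_iff_exists_mem.2 ⟨e, heE⟩
  have ht : numSimple lam.parts mu.parts o g m = (4 * m + 2 * g - 4 + 2) +
      (evenPart lam.parts).card + 2 * c + (evenPart mu.parts).card + 2 * c' := by
    unfold numSimple
    rw [hcc]
    omega
  have hN : numOnes lam.parts mu.parts o h m = 2 * (c + c') + h + 2 * m - 1 := by
    unfold numOnes
    rw [hcc]
  rw [hN]
  generalize numTriple lam.parts mu.parts o h = s at *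
  generalize numSimple lam.parts mu.parts o g m = t at *
  -- The cover `A` occupies the last pairs. The cover `B` starts at the third single point, since
  -- the first two carry the fork from which the bypass starts.
  let σ : Fin (h - (d + 2) - 1) → Fin s := fun i => ⟨s - (h - (d + 2) - 1) + i.val, by omega⟩
  let τ : Fin (4 * m + 2 * g - 4) → Fin t := fun j => ⟨j.val + 2, by omega⟩
  obtain ⟨ψ₁, h₁⟩ := exists_pointMap_x z₁ z σ fun i j hij => by
    simp only [σ, Fin.lt_def] at hij ⊢; omega
  obtain ⟨ψ₂, h₂⟩ := exists_pointMap_y z₂ z τ fun i j hij => by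
    simp only [τ, Fin.lt_def] at hij ⊢; omega
  have hσ : Set.range σ = {i | s - (h - (d + 2) - 1) ≤ i.val} := by
    ext i
    constructor
    · rintro ⟨k, rfl⟩
      exact Nat.le_add_right _ _
    · intro hi
      simp only [Set.mem_ofPred_eq] at hi
      exact ⟨⟨i.val - (s - (h - (d + 2) - 1)), by omega⟩, Fin.ext (by simp only [σ]; omega)⟩
  have hτ : Set.range τ = {j | 2 ≤ j.val ∧ j.val < 4 * m + 2 * g - 4 + 2} := by
    ext i
    constructor
    · rintro ⟨k, rfl⟩
      exact ⟨Nat.le_add_left _ _, Nat.add_lt_add_right k.isLt 2⟩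
    · rintro ⟨hi, hi'⟩
      exact ⟨⟨i.val - 2, by omega⟩, Fin.ext (by simp only [τ]; omega)⟩
  -- The number of left ends of `B` is displayed as an even number plus one; its oddness yields the
  -- left end in the core.
  rw [zigzagNumber_ones, show 2 * m - 1 = 2 * m - 2 + 1 by omega, properZigzagNumber]
  refine card_mul_card_le h₁ h₂ fun A B hA hB => ?_
  have hX := (leftTower_move hA (by omega) (by omega) h₁ hσ).exists_pairSide (j := j) (j' := j')
    (by omega) (by omega) hD0 hD0' hO hO' ho ho1 (by omega) (by omega) (by omega)
  have hY := (rightTower_move hB ⟨m - 1, by omega⟩ (by omega) h₂ hτ).exists_pointSide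
    ht.symm hEp hEp' hop heE hoe hc
  obtain ⟨C, hC, hCA, hCB⟩ := hX.exists_isProperlyMixed hz hY
  refine ⟨C, ?_, hCA, hCB⟩
  convert hC using 1
  · rw [zero_add]
  · conv_lhs => rw [hlam]
    -- The left ends of weight 1 come from the joins and emissions, from `A` without its glued end,
    -- from the incoming forks, and from `B`, where one end is glued and two are added by the
    -- initial fork.
    have : ones (2 * (c + c') + h + 2 * m - 1) = ones (2 * j + O'.card) +
        ones (h - (d + 2) - 1) + ones (2 * c) + ones (2 * m - 2 + 2) := by
      rw [ones_add, ones_add, ones_add]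
      congr 1
      omega
    rw [this]
    abel
  · conv_lhs => rw [hmu']
    have : ones (2 * (c + c') + h + 2 * m - 1) = ones (2 * j' + O.card) +
        ones (h - (d + 2)) + ones (2 * c') + ones (2 * m - 2 + 1) := by
      rw [ones_add, ones_add, ones_add]
      congr 1
      omega
    rw [this]
    abel
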